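/- Let $\mathcal T\subset\mathbb R^d$ be compact and let $L^2=L^2(\mathcal T;\mathbb R^r)$ carry the norm $\|x\|^2=\int_{\mathcal T}|x(t)|^2dt$. **Errors.** Let $(\eta_\ell)_{\ell\in\mathbb Z}$ be i.i.d. with values in a measurable space $\mathcal S$, let $g:\mathcal S^\infty\to L^2$ be measurable, and $\epsilon_\ell=g(\eta_\ell,\eta_{\ell-1},\ldots)$. Assume that for some $\epsilon>0$ and $\kappa>4+\epsilon$ we have $E\epsilon_1=0$, $E\|\epsilon_1\|^{4+\epsilon}<\infty$ and $\sum_{m\ge1}\big(E\|\epsilon_1-\epsilon_1^{(m)}\|^{4+\epsilon}\big)^{1/\kappa}<\infty$, where $\epsilon_1^{(m)}=g(\eta_1,\ldots,\eta_{2-m},\eta'_{1-m},\eta'_{-m},\ldots)$ keeps the first $m$ arguments of $\epsilon_1$ and replaces the others by those of an independent copy $(\eta'_\ell)$ of $(\eta_\ell)$. **Breaks.** Let $R\ge0$ and $0=\theta_0<\theta_1<\cdots<\theta_R<\theta_{R+1}=1$ be fixed, and put $k_j=\lfloor N\theta_j\rfloor$. For $1\le i\le N$ we observe $$X_i=\sum_{j=1}^{R+1}\mu_j\,I\{k_{j-1}<i\le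 k_j\}+\epsilon_i,$$ where the non-random mean functions $\mu_1,\ldots,\mu_{R+1}\in L^2$ may depend on $N$ and $\|\mu_{j+1}-\mu_j\|\ge c_0$ for $1\le j\le R$, with a constant $c_0>0$ that does not depend on $N$. **Algorithm.** Fix $0<\alpha<1$. For $0\le\ell<u\le N$ with $u-\ell>4$ and $\ell+2\le k\le u-2$ let $$V_N^{(\ell,u)}(k)=\frac{2}{(k-\ell)(u-k)}\sum_{i=\ell+1}^{k}\sum_{j=k+1}^{u}\|X_i-X_j\|^2-\frac1{\binom{k-\ell}{2}}\sum_{\ell<i<j\le k}\|X_i-X_j\|^2-\frac1{\binom{u-k}{2}}\sum_{k<i<j\le u}\|X_i-X_j\|^2,$$ $$Z_N^{(\ell,u)}(k)=\frac12(u-\ell)\left(\frac{(k-\ell)(u-k)}{(u-\ell)^2}\right)^{2-\alpha}V_N^{(\ell,u)}(k).$$ Binary segmentation with threshold $\tau_N$ on the subsample $\ell<i\le u$ stops if $u-\ell\le4$. Otherwise let $\widehat k$ be the smallest maximizer of $Z_N^{(\ell,u)}$ on $\{\ell+2,\ldots,u-2\}$; if $Z_N^{(\ell,u)}(\widehat k)>\tau_N$,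 then $\widehat k$ is recorded as an estimated break and the procedure is run on $\ell<i\le\widehat k$ and on $\widehat k<i\le u$; if not, it stops. Run on the whole sample ($\ell=0$, $u=N$), it returns the estimated breaks $\widehat k_1<\cdots<\widehat k_{\widehat R}$. **Theorem.** Suppose that $E\|X_i\|^\nu<\infty$ for some $\nu>4+\epsilon$, and that the thresholds $\tau_N$, positive for all large $N$, satisfy $$\frac{(\log N)^{2/\nu}}{\tau_N}+\frac{\tau_N}{N}\to0\qquad(N\to\infty).$$ Then for all $0<\alpha<1$ and every sequence $r_N\to\infty$, $$\lim_{N\to\infty}P\Big(\{\widehat R=R\}\cap\Big\{\max_{1\le j\le R}|\widehat k_j-k_j|\le r_N\Big\}\Big)=1.$$ -/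

import Mathlib

open MeasureTheory ProbabilityTheory Filter
open scoped Topology ENNReal

noncomputable section

/-- The space of square integrable functions from `T`, a subset of Euclidean `d`-space with Lebesgue
measure, to Euclidean `r`-space, with the norm `‖x‖² = ∫_T |x(t)|² dt`. -/
abbrev FunL2 (d r : ℕ) (T : Set (EuclideanSpace ℝ (Fin d))) : Type :=
  Lp (EuclideanSpace ℝ (Fin r)) 2 (volume.restrict T)

/-! ### Bernoulli shift errors -/

section Shift

variable {Ω S E : Type*}

/-- The Bernoulli shift `ε_ℓ = g(η_ℓ, η_{ℓ-1}, …)`. -/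
def shiftNoise (g : (ℕ → S) → E) (η : ℤ → Ω → S) (ℓ : ℤ) (ω : Ω) : E :=
  g (fun i => η (ℓ - (i : ℤ)) ω)

/-- The coupled variable
`ε_ℓ^{(m)} = g(η_ℓ, …, η_{ℓ-m+1}, η'_{ℓ-m}, η'_{ℓ-m-1}, …)`, where `η` is read off at the first
coordinate of a point of `Ω × Ω` and its copy `η'` at the second one; under a product measure
`P × P` the two sequences are independent with the same law. -/
def coupledNoise (g : (ℕ → S) → E) (η : ℤ → Ω → S) (m : ℕ) (ℓ : ℤ) (z : Ω × Ω) : E :=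
  g (fun i => if i < m then η (ℓ - (i : ℤ)) z.1 else η (ℓ - (i : ℤ)) z.2)

/-- The standing condition on the errors: a Bernoulli shift of i.i.d. innovations `η_ℓ`, centred,
with a finite moment of order `4 + a`, and with summable coupling coefficients
`(E‖ε_1 - ε_1^{(m)}‖^{4+a})^{1/κ}`, `m ≥ 1`. -/
structure ShiftCondition [MeasurableSpace Ω] [MeasurableSpace S]
    [NormedAddCommGroup E] [NormedSpace ℝ E]
    (P : Measure Ω) (g : (ℕ → S) → E) (η : ℤ → Ω → S) (a κ : ℝ) : Prop where
  measurable_innov : ∀ ℓ, Measurable (η ℓ)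
  indep_innov : iIndepFun η P
  ident_innov : ∀ ℓ, IdentDistrib (η ℓ) (η 0) P P
  measurable_g : StronglyMeasurable g
  a_pos : 0 < a
  moment : ∫⁻ ω, ‖shiftNoise g η 1 ω‖ₑ ^ (4 + a) ∂P < ∞
  centred : ∫ ω, shiftNoise g η 1 ω ∂P = 0
  kappa_gt : 4 + a < κ
  summable_coupling :
    ∑' m : ℕ, (∫⁻ z, ‖shiftNoise g η 1 z.1 - coupledNoise g η (m + 1) 1 z‖ₑ ^ (4 + a)
      ∂(P.prod P)) ^ (1 / κ) < ∞

end Shift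

/-! ### The multiple break model -/

/-- `k_j = ⌊N θ_j⌋`, for `j = 0, …, R + 1`. -/
def breakTime {R : ℕ} (θ : Fin (R + 2) → ℝ) (N : ℕ) (j : Fin (R + 2)) : ℕ :=
  ⌊(N : ℝ) * θ j⌋₊

/-- `X_i = ∑_j μ_j 1{k_{j-1} < i ≤ k_j} + ε_i` at sample size `N`; the regimes are numbered from
`0` to `R`, and regime `j` is `k_j < i ≤ k_{j+1}`. -/
def observation {E : Type*} [AddCommGroup E] {R : ℕ} (θ : Fin (R + 2) → ℝ)
    (μ : Fin (R + 1) → E) (ε : ℤ → E) (N i : ℕ) : E :=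
  (∑ j : Fin (R + 1),
    if breakTime θ N j.castSucc < i ∧ i ≤ breakTime θ N j.succ then μ j else 0) + ε i

/-! ### The weighted energy statistic and binary segmentation -/

section Segmentation

variable {E : Type*} [NormedAddCommGroup E]

/-- The empirical energy statistic `V^{(ℓ,u)}(k)` of the subsample `x_i`, `ℓ < i ≤ u`, which compares
`ℓ < i ≤ k` with `k < i ≤ u`. -/
def energyStat (x : ℕ → E) (ℓ u k : ℕ) : ℝ :=
  2 / (((k : ℝ) - ℓ) * ((u : ℝ) - k)) *
      ∑ i ∈ Finset.Ioc ℓ k, ∑ j ∈ Finset.Ioc k u, ‖x i - x j‖ ^ 2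
    - 1 / ((k - ℓ).choose 2 : ℝ) *
      ∑ i ∈ Finset.Ioc ℓ k, ∑ j ∈ Finset.Ioc i k, ‖x i - x j‖ ^ 2
    - 1 / ((u - k).choose 2 : ℝ) *
      ∑ i ∈ Finset.Ioc k u, ∑ j ∈ Finset.Ioc i u, ‖x i - x j‖ ^ 2

/-- The weighted statistic
`½ (u-ℓ) ((k-ℓ)(u-k)/(u-ℓ)²)^{2-α} V^{(ℓ,u)}(k)`. -/
def weightedStat (α : ℝ) (x : ℕ → E) (ℓ u k : ℕ) : ℝ :=
  1 / 2 * ((u : ℝ) - ℓ) *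
    ((((k : ℝ) - ℓ) * ((u : ℝ) - k)) / ((u : ℝ) - ℓ) ^ 2) ^ (2 - α) * energyStat x ℓ u k

open Classical in
/-- The set of maximizers of `f` on `s`. -/
def maximizers (s : Finset ℕ) (f : ℕ → ℝ) : Finset ℕ :=
  s.filter (fun k => ∀ j ∈ s, f j ≤ f k)

theorem maximizers_nonempty {s : Finset ℕ} (hs : s.Nonempty) (f : ℕ → ℝ) :
    (maximizers s f).Nonempty := by
  obtain ⟨k, hk, h⟩ := s.exists_max_image f hs
  exact ⟨k, by simp only [maximizers, Finset.mem_filter]; exact ⟨hk, h⟩⟩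

/-- The smallest maximizer of `f` on the nonempty finite set `s`. -/
def sargmax (s : Finset ℕ) (hs : s.Nonempty) (f : ℕ → ℝ) : ℕ :=
  (maximizers s f).min' (maximizers_nonempty hs f)

theorem sargmax_mem (s : Finset ℕ) (hs : s.Nonempty) (f : ℕ → ℝ) : sargmax s hs f ∈ s := by
  have h := (maximizers s f).min'_mem (maximizers_nonempty hs f)
  simp only [maximizers, Finset.mem_filter] at h
  exact h.1

theorem splits_nonempty {ℓ u : ℕ} (h : ℓ + 4 < u) : (Finset.Icc (ℓ + 2) (u - 2)).Nonempty :=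
  Finset.nonempty_Icc.2 (by omega)

/-- The estimated break of the subsample `ℓ < i ≤ u`, `u - ℓ > 4`: the smallest maximizer of the
weighted statistic over all `k` that leave at least two observations on each side. -/
def splitPoint (α : ℝ) (x : ℕ → E) (ℓ u : ℕ) (h : ℓ + 4 < u) : ℕ :=
  sargmax (Finset.Icc (ℓ + 2) (u - 2)) (splits_nonempty h) (weightedStat α x ℓ u)

theorem splitPoint_mem (α : ℝ) (x : ℕ → E) (ℓ u : ℕ) (h : ℓ + 4 < u) :
    ℓ < splitPoint α x ℓ u h ∧ splitPoint α x ℓ u h < u := by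
  have h1 := sargmax_mem _ (splits_nonempty h) (weightedStat α x ℓ u)
  rw [Finset.mem_Icc] at h1
  unfold splitPoint
  omega

open Classical in
/-- Binary segmentation with threshold `τ` on the subsample `ℓ < i ≤ u`: the set of estimated
breaks. It stops if `u - ℓ ≤ 4` or if the maximal weighted statistic does not exceed `τ`; otherwise
it records the maximizer and continues on both sides of it. -/
def energySeg (α τ : ℝ) (x : ℕ → E) (ℓ u : ℕ) : Finset ℕ :=
  if h : ℓ + 4 < u then
    if τ < weightedStat α x ℓ u (splitPoint α x ℓ u h) then
      insert (splitPoint α x ℓ u h)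
        (energySeg α τ x ℓ (splitPoint α x ℓ u h) ∪ energySeg α τ x (splitPoint α x ℓ u h) u)
    else ∅
  else ∅
termination_by u - ℓ
decreasing_by
  all_goals
    have := splitPoint_mem α x ℓ u h
    omega

/-- The estimated breaks of the whole sample `x_1, …, x_N`. -/
def estimatedBreaks (α τ : ℝ) (x : ℕ → E) (N : ℕ) : Finset ℕ :=
  energySeg α τ x 0 N

/-- The set `H` has exactly `R` elements `h_1 < … < h_R`, and `|h_j - k_j| ≤ ρ` for all `j`. -/
def BreaksRecovered {R : ℕ} (H : Finset ℕ) (k : Fin R → ℕ) (ρ : ℝ) : Prop :=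
  ∃ hR : H.card = R, ∀ j : Fin R, |((H.orderEmbOfFin hR j : ℕ) : ℝ) - (k j : ℝ)| ≤ ρ

end Segmentation

end

/-!
Let `Y(k) = ‖S_k - tS_u‖² / ((u-ℓ) (t(1-t))^α)`, with `t = (k-ℓ)/(u-ℓ)` and `S` the partial sums of
the subsample, be the weighted CUSUM statistic. An algebraic identity (`weightedStat_eq`) writes the
weighted energy statistic as `Y(k)` minus a nonnegative penalty, a weighted sum of the squared
deviations within the two parts. The penalty is bounded on the scale of single observations
(`penalty_le`) and nearly Lipschitz in `k` (`penalty_le_add`), so it only perturbs `Y`.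

*Probability.* All randomness enters through one event, `TameNoise`, on which for a level `K` the
partial sums of the errors grow from every true break `b` at most like
`‖S_k - S_b‖² ≤ K |k-b|^α N^(1-α)` and `‖S_k - S_b‖⁴ ≤ K² |k-b|³`, and the errors themselves are not
too large. For Bernoulli shifts the coupling condition bounds the `L²`-norm of the conditional
expectations of `ε_i` given the remote past (`integral_norm_sq_condExp_le_coupling`); telescoping
over these conditional expectations and Doob's `L²`-inequality for each martingale give a maximal
inequality `E max_{h ≤ n} ‖∑_{i<h} ε_{z+i}‖² ≤ C n`, uniformly in `z`
(`exists_integral_sumMax_shiftNoise_le`). Dyadic union bounds then show that the complement of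
`TameNoise` has probability at most `A / K` (`exists_measureReal_not_tameNoise_le`). Only second and
fourth moments are needed.

*Determinism.* On a tame sample everything is deterministic. Between two neighbouring breaks the
mean of the partial sums is affine, and there `Y` lies below its chord by a definite factor, because
`t(1-t)` is concave and `(·)^α` is increasing and concave (`cusumStat_le_of_chordDefect`). With `V`
the maximum of `Y` over the breaks in the segment it follows that `Y(k)` either is smaller than
`(1-c)V`, or `k` is close to a break `b` with `Y(b) ≥ V/2` and `Y` decreases from `b` to `k` linearly
in `|k-b|`, up to the local noise (`NearSegment.far_or_near`). Here `V` is at least of the order of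
the length of the segment times the squared size of the largest jump in it
(`NearSegment.norm_mean_sub_mean_le'`). Hence a maximizer `k` satisfies `|k-b| ‖jump at b‖² ≤ B` for
some break `b` in the segment, where `B` only depends on `K` (`NearSegment.splitPoint_near`), and its
value exceeds the threshold.

The scaling with the jump makes the induction work although the means may be unbounded in `N`: a
segment that starts or ends at an estimate `k` with `|k-b| ‖jump at b‖² ≤ B` contains a stray piece of
the neighbouring regime, which is negligible for every size of the jump (`NearAnchor`,
`NearAnchor.norm_resid_le`). In a segment without a break in its interior the statistic is bounded by
a constant that depends on `K` (`TameSample.weightedStat_le_of_null`), below the threshold. So binary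
segmentation finds every break once (`TameSample.energySeg_eq_image`). Finally `K = K_N → ∞` is taken
as a small power of `min(N, τ_N, ρ_N)` (`exists_calibrated`).
-/

set_option linter.unusedSectionVars false

noncomputable section

/-! ### Running maxima of partial sums -/

section RunningMax

variable {E : Type*} [NormedAddCommGroup E]

/-- The running maximum `max_{h ≤ n} ‖f_0 + ⋯ + f_{h-1}‖` of the norms of the partial sums. -/
def sumMax (f : ℕ → E) : ℕ → ℝ
  | 0 => 0
  | n + 1 => max (sumMax f n) ‖∑ i ∈ Finset.range (n + 1), f i‖

theorem sumMax_nonneg (f : ℕ → E) (n : ℕ) : 0 ≤ sumMax f n := by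
  induction n with
  | zero => simp [sumMax]
  | succ n ih => exact ih.trans (le_max_left _ _)

theorem norm_sum_le_sumMax (f : ℕ → E) {h n : ℕ} (hn : h ≤ n) :
    ‖∑ i ∈ Finset.range h, f i‖ ≤ sumMax f n := by
  induction n with
  | zero => simp [Nat.le_zero.1 hn, sumMax]
  | succ n ih =>
    rcases Nat.lt_or_ge h (n + 1) with h1 | h1
    · exact (ih (by omega)).trans (le_max_left _ _)
    · obtain rfl : h = n + 1 := by omega
      exact le_max_right _ _

theorem sumMax_le_of_forall {f : ℕ → E} {n : ℕ} {c : ℝ}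
    (hf : ∀ h ≤ n, ‖∑ i ∈ Finset.range h, f i‖ ≤ c) : sumMax f n ≤ c := by
  induction n with
  | zero => simpa [sumMax] using hf 0 le_rfl
  | succ n ih => exact max_le (ih fun h hh => hf h (by omega)) (hf (n + 1) le_rfl)

theorem sumMax_le_sum_norm (f : ℕ → E) (n : ℕ) :
    sumMax f n ≤ ∑ i ∈ Finset.range n, ‖f i‖ := by
  refine sumMax_le_of_forall fun h hh => (norm_sum_le _ _).trans ?_
  exact Finset.sum_le_sum_of_subset_of_nonneg (Finset.range_mono hh) fun _ _ _ => norm_nonneg _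

theorem sumMax_add_le (f g : ℕ → E) (n : ℕ) :
    sumMax (fun i => f i + g i) n ≤ sumMax f n + sumMax g n := by
  refine sumMax_le_of_forall fun h hh => ?_
  rw [Finset.sum_add_distrib]
  exact (norm_add_le _ _).trans
    (add_le_add (norm_sum_le_sumMax f hh) (norm_sum_le_sumMax g hh))

theorem sumMax_sum_le {ι : Type*} (s : Finset ι) (f : ι → ℕ → E) (n : ℕ) :
    sumMax (fun i => ∑ j ∈ s, f j i) n ≤ ∑ j ∈ s, sumMax (f j) n := by
  refine sumMax_le_of_forall fun h hh => ?_
  rw [Finset.sum_comm]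
  exact (norm_sum_le _ _).trans (Finset.sum_le_sum fun j _ => norm_sum_le_sumMax (f j) hh)

/-- The pathwise form of Doob's maximal inequality in `L²`: the sum on the right is a martingale
transform whose expectation is nonnegative when the norms form a submartingale. -/
theorem sumMax_sq_le (f : ℕ → E) (n : ℕ) :
    sumMax f n ^ 2 ≤ 4 * ‖∑ i ∈ Finset.range n, f i‖ ^ 2
      - 4 * ∑ i ∈ Finset.range n, sumMax f i *
        (‖∑ j ∈ Finset.range (i + 1), f j‖ - ‖∑ j ∈ Finset.range i, f j‖) := by
  have key : ∀ n, sumMax f n ^ 2 / 2 ≤ sumMax f n * ‖∑ i ∈ Finset.range n, f i‖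
      - ∑ i ∈ Finset.range n, sumMax f i *
        (‖∑ j ∈ Finset.range (i + 1), f j‖ - ‖∑ j ∈ Finset.range i, f j‖) := by
    intro n
    induction n with
    | zero => simp [sumMax]
    | succ n ih =>
      rw [Finset.sum_range_succ (fun i => sumMax f i * _)]
      have hs : sumMax f (n + 1) = max (sumMax f n) ‖∑ i ∈ Finset.range (n + 1), f i‖ := rfl
      rcases le_total (sumMax f n) ‖∑ i ∈ Finset.range (n + 1), f i‖ with h | h
      · rw [hs, max_eq_right h]
        nlinarith
      · rw [hs, max_eq_left h]
        nlinarith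
  have h := key n
  nlinarith [sq_nonneg (sumMax f n / 2 - ‖∑ i ∈ Finset.range n, f i‖)]

theorem memLp_sumMax {Ω : Type*} {mΩ : MeasurableSpace Ω} {P : Measure Ω} {d : ℕ → Ω → E}
    (hd : ∀ i, MemLp (d i) 2 P) (n : ℕ) :
    MemLp (fun ω => sumMax (fun i => d i ω) n) 2 P := by
  have hm : AEStronglyMeasurable (fun ω => sumMax (fun i => d i ω) n) P := by
    induction n with
    | zero => exact aestronglyMeasurable_const
    | succ n ih =>
      exact ih.sup (Finset.aestronglyMeasurable_fun_sum _ fun i _ => (hd i).1).norm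
  have h : MemLp (fun ω => ∑ i ∈ Finset.range n, ‖d i ω‖) 2 P :=
    memLp_finsetSum _ fun i _ => (hd i).norm
  refine h.mono hm (ae_of_all _ fun ω => ?_)
  rw [Real.norm_of_nonneg (sumMax_nonneg _ _)]
  exact (sumMax_le_sum_norm _ _).trans (le_abs_self _)

end RunningMax

/-! ### Doob's maximal inequality for Hilbert space valued martingale differences -/

section Doob

variable {Ω E : Type*} [NormedAddCommGroup E] [InnerProductSpace ℝ E] [CompleteSpace E]
  {m mΩ : MeasurableSpace Ω} {P : Measure Ω} [IsProbabilityMeasure P]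

open scoped InnerProductSpace

theorem integrable_inner_of_memLp {f g : Ω → E} (hf : MemLp f 2 P) (hg : MemLp g 2 P) :
    Integrable (fun ω => ⟪f ω, g ω⟫_ℝ) P := by
  have h : Integrable (fun ω => ‖f ω‖ ^ 2 + ‖g ω‖ ^ 2) P :=
    (hf.integrable_norm_pow (by norm_num)).add (hg.integrable_norm_pow (by norm_num))
  refine h.mono' (hf.1.inner hg.1) (ae_of_all _ fun ω => ?_)
  rw [Real.norm_eq_abs]
  have := abs_real_inner_le_norm (f ω) (g ω)
  nlinarith [sq_nonneg (‖f ω‖ - ‖g ω‖), norm_nonneg (f ω), norm_nonneg (g ω),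
    sq_nonneg (‖f ω‖), sq_nonneg (‖g ω‖)]

theorem memLp_two_condExp {f : Ω → E} (hf : MemLp f 2 P) : MemLp (P[f | m]) 2 P := by
  have hi : Integrable (fun ω => ‖f ω‖ ^ (2 : ℝ)) P := by
    simpa using hf.integrable_norm_pow (p := 2) (by norm_num)
  have h := Integrable.norm_condExp_rpow_le (m := m) (f := f) (p := 2) (by norm_num) hi
  by_cases hm : m ≤ mΩ
  · rw [memLp_two_iff_integrable_sq_norm
      (stronglyMeasurable_condExp.mono hm).aestronglyMeasurable]
    refine (integrable_condExp (m := m) (f := fun ω => ‖f ω‖ ^ (2 : ℝ))).mono'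
      ((stronglyMeasurable_condExp.mono hm).norm.pow 2).aestronglyMeasurable ?_
    filter_upwards [h] with ω hω
    simpa using hω
  · rw [condExp_of_not_le hm]
    exact MemLp.zero

/-- Conditional expectation is symmetric against measurable square integrable functions. -/
theorem integral_inner_condExp (hm : m ≤ mΩ) {V f : Ω → E} (hV : StronglyMeasurable[m] V)
    (hV2 : MemLp V 2 P) (hf : MemLp f 2 P) :
    ∫ ω, ⟪V ω, (P[f | m]) ω⟫_ℝ ∂P = ∫ ω, ⟪V ω, f ω⟫_ℝ ∂P := by
  have h := condExp_bilin_of_stronglyMeasurable_left (innerSL ℝ (E := E)) hV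
    (integrable_inner_of_memLp hV2 hf) (hf.integrable (by norm_num))
  rw [← integral_condExp hm (f := fun ω => ⟪V ω, f ω⟫_ℝ)]
  exact integral_congr_ae (h.symm.trans (by rfl))

theorem integral_inner_eq_zero_of_condExp (hm : m ≤ mΩ) {V f : Ω → E}
    (hV : StronglyMeasurable[m] V) (hV2 : MemLp V 2 P) (hf : MemLp f 2 P)
    (h0 : P[f | m] =ᵐ[P] 0) : ∫ ω, ⟪V ω, f ω⟫_ℝ ∂P = 0 := by
  rw [← integral_inner_condExp hm hV hV2 hf,
    integral_congr_ae (g := fun _ => (0 : ℝ)) (by filter_upwards [h0] with ω hω; simp [hω])]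
  simp

/-- The residual of a conditional expectation has a smaller `L²` norm. -/
theorem integral_norm_sq_sub_condExp_le (hm : m ≤ mΩ) {f : Ω → E} (hf : MemLp f 2 P) :
    ∫ ω, ‖f ω - (P[f | m]) ω‖ ^ 2 ∂P ≤ ∫ ω, ‖f ω‖ ^ 2 ∂P := by
  have hc : MemLp (P[f | m]) 2 P := memLp_two_condExp hf
  have h1 := integral_inner_condExp hm stronglyMeasurable_condExp hc hf
  have i1 := integrable_inner_of_memLp hc hf
  have i2 := integrable_inner_of_memLp hc hc
  have i3 : Integrable (fun ω => ‖f ω‖ ^ 2) P := hf.integrable_norm_pow (by norm_num)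
  have e : ∀ ω, ‖f ω - (P[f | m]) ω‖ ^ 2 = ‖f ω‖ ^ 2 - 2 * ⟪(P[f | m]) ω, f ω⟫_ℝ
      + ⟪(P[f | m]) ω, (P[f | m]) ω⟫_ℝ := by
    intro ω
    rw [norm_sub_sq_real, real_inner_self_eq_norm_sq, real_inner_comm]
  have h2 : 0 ≤ ∫ ω, ⟪(P[f | m]) ω, (P[f | m]) ω⟫_ℝ ∂P :=
    integral_nonneg fun ω => real_inner_self_nonneg
  simp_rw [e]
  rw [integral_add (by exact i3.sub (i1.const_mul 2)) i2, integral_sub i3 (i1.const_mul 2),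
    integral_const_mul]
  linarith

variable {G : ℕ → MeasurableSpace Ω} {d : ℕ → Ω → E}

theorem stronglyMeasurable_sum_range (hG : Monotone G)
    (hd : ∀ i, StronglyMeasurable[G (i + 1)] (d i)) (n : ℕ) :
    StronglyMeasurable[G n] (fun ω => ∑ i ∈ Finset.range n, d i ω) := by
  refine Finset.stronglyMeasurable_fun_sum _ fun i hi => (hd i).mono (hG ?_)
  have := Finset.mem_range.1 hi
  omega

theorem stronglyMeasurable_sumMax (hG : Monotone G)
    (hd : ∀ i, StronglyMeasurable[G (i + 1)] (d i)) (n : ℕ) :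
    StronglyMeasurable[G n] (fun ω => sumMax (fun i => d i ω) n) := by
  induction n with
  | zero => exact stronglyMeasurable_const
  | succ n ih =>
    have h1 : StronglyMeasurable[G (n + 1)] (fun ω => sumMax (fun i => d i ω) n) :=
      ih.mono (hG (Nat.le_succ n))
    exact @StronglyMeasurable.sup Ω ℝ _ _ (G (n + 1)) _ _ _ h1
      (stronglyMeasurable_sum_range hG hd (n + 1)).norm

/-- **Doob's maximal inequality in `L²`** for Hilbert space valued martingale differences. -/
theorem integral_sumMax_sq_le (hle : ∀ i, G i ≤ mΩ) (hG : Monotone G)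
    (hd : ∀ i, StronglyMeasurable[G (i + 1)] (d i)) (hd2 : ∀ i, MemLp (d i) 2 P)
    (h0 : ∀ i, P[d i | G i] =ᵐ[P] 0) (n : ℕ) :
    ∫ ω, sumMax (fun i => d i ω) n ^ 2 ∂P ≤
      4 * ∑ i ∈ Finset.range n, ∫ ω, ‖d i ω‖ ^ 2 ∂P := by
  have hS2 : ∀ n, MemLp (fun ω => ∑ i ∈ Finset.range n, d i ω) 2 P := fun n =>
    memLp_finsetSum _ fun i _ => hd2 i
  have hsq : ∀ n, Integrable (fun ω => ‖∑ i ∈ Finset.range n, d i ω‖ ^ 2) P := fun n =>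
    (hS2 n).integrable_norm_pow (by norm_num)
  have horth : ∀ n, ∫ ω, ‖∑ i ∈ Finset.range n, d i ω‖ ^ 2 ∂P =
      ∑ i ∈ Finset.range n, ∫ ω, ‖d i ω‖ ^ 2 ∂P := by
    intro n
    induction n with
    | zero => simp
    | succ n ih =>
      rw [Finset.sum_range_succ, ← ih]
      have i1 := integrable_inner_of_memLp (hS2 n) (hd2 n)
      have i2 : Integrable (fun ω => ‖d n ω‖ ^ 2) P :=
        (hd2 n).integrable_norm_pow (by norm_num)
      have e : ∀ ω, ‖∑ i ∈ Finset.range (n + 1), d i ω‖ ^ 2 =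
          ‖∑ i ∈ Finset.range n, d i ω‖ ^ 2 +
            2 * ⟪∑ i ∈ Finset.range n, d i ω, d n ω⟫_ℝ + ‖d n ω‖ ^ 2 := by
        intro ω
        rw [Finset.sum_range_succ, norm_add_sq_real]
      simp_rw [e]
      rw [integral_add (by exact (hsq n).add (i1.const_mul 2)) i2,
        integral_add (hsq n) (i1.const_mul 2), integral_const_mul,
        integral_inner_eq_zero_of_condExp (hle n) (stronglyMeasurable_sum_range hG hd n)
          (hS2 n) (hd2 n) (h0 n)]
      ring
  -- `V i = b_i M_i / ‖M_i‖`, with the running maximum `b_i` and the martingale `M_i`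
  let V : ℕ → Ω → E := fun i ω =>
    (sumMax (fun i => d i ω) i / ‖∑ j ∈ Finset.range i, d j ω‖) • ∑ j ∈ Finset.range i, d j ω
  have hVm : ∀ i, StronglyMeasurable[G i] (V i) := fun i =>
    (((stronglyMeasurable_sumMax hG hd i).measurable.div
      (stronglyMeasurable_sum_range hG hd i).norm.measurable).stronglyMeasurable).smul
        (stronglyMeasurable_sum_range hG hd i)
  have hV2 : ∀ i, MemLp (V i) 2 P := by
    intro i
    refine (memLp_sumMax hd2 i).mono ((hVm i).mono (hle i)).aestronglyMeasurable
      (ae_of_all _ fun ω => ?_)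
    simp only [V]
    rw [norm_smul, norm_div, norm_norm]
    rcases eq_or_ne ‖∑ j ∈ Finset.range i, d j ω‖ 0 with h | h
    · rw [h, mul_zero]
      exact norm_nonneg _
    · rw [div_mul_cancel₀ _ h]
  have hVd : ∀ i, ∫ ω, ⟪V i ω, d i ω⟫_ℝ ∂P = 0 := fun i =>
    integral_inner_eq_zero_of_condExp (hle i) (hVm i) (hV2 i) (hd2 i) (h0 i)
  have hpath : ∀ ω, sumMax (fun i => d i ω) n ^ 2 ≤
      4 * ‖∑ i ∈ Finset.range n, d i ω‖ ^ 2
        - 4 * ∑ i ∈ Finset.range n, ⟪V i ω, d i ω⟫_ℝ := by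
    intro ω
    refine (sumMax_sq_le (fun i => d i ω) n).trans ?_
    gcongr 4 * _ - 4 * ∑ i ∈ _, ?_ with i
    set M := ∑ j ∈ Finset.range i, d j ω with hM
    have hb := sumMax_nonneg (fun i => d i ω) i
    by_cases hM0 : M = 0
    · simp only [V, ← hM, hM0]
      simp only [norm_zero, smul_zero, inner_zero_left, sub_zero]
      positivity
    · have hMpos : 0 < ‖M‖ := norm_pos_iff.2 hM0
      have h1 : ⟪M, d i ω⟫_ℝ ≤ ‖M‖ * (‖∑ j ∈ Finset.range (i + 1), d j ω‖ - ‖M‖) := by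
        have h2 := real_inner_le_norm M (M + d i ω)
        rw [inner_add_right, real_inner_self_eq_norm_sq] at h2
        rw [Finset.sum_range_succ, ← hM]
        nlinarith
      simp only [V, ← hM]
      rw [real_inner_smul_left]
      calc sumMax (fun i => d i ω) i / ‖M‖ * ⟪M, d i ω⟫_ℝ
          ≤ sumMax (fun i => d i ω) i / ‖M‖ *
            (‖M‖ * (‖∑ j ∈ Finset.range (i + 1), d j ω‖ - ‖M‖)) := by gcongr
        _ = _ := by field_simp
  have hmem : MemLp (fun ω => sumMax (fun i => d i ω) n) 2 P := memLp_sumMax hd2 n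
  have iV : Integrable (fun ω => ∑ i ∈ Finset.range n, ⟪V i ω, d i ω⟫_ℝ) P :=
    integrable_finsetSum _ fun i _ => integrable_inner_of_memLp (hV2 i) (hd2 i)
  calc ∫ ω, sumMax (fun i => d i ω) n ^ 2 ∂P
      ≤ ∫ ω, (4 * ‖∑ i ∈ Finset.range n, d i ω‖ ^ 2
        - 4 * ∑ i ∈ Finset.range n, ⟪V i ω, d i ω⟫_ℝ) ∂P :=
        integral_mono hmem.integrable_sq (((hsq n).const_mul 4).sub (iV.const_mul 4)) hpath
    _ = _ := by
        rw [integral_sub ((hsq n).const_mul 4) (iV.const_mul 4), integral_const_mul,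
          integral_const_mul, integral_finsetSum _ fun i _ =>
            integrable_inner_of_memLp (hV2 i) (hd2 i), horth]
        simp [hVd]

end Doob

/-! ### A maximal inequality from conditional expectations -/

section MaximalInequality

variable {Ω E : Type*} [NormedAddCommGroup E] {mΩ : MeasurableSpace Ω} {P : Measure Ω}

theorem eLpNorm_two_eq_ofReal_sqrt {f : Ω → E} (hf : MemLp f 2 P) :
    eLpNorm f 2 P = ENNReal.ofReal (√(∫ ω, ‖f ω‖ ^ 2 ∂P)) := by
  rw [hf.eLpNorm_eq_integral_rpow_norm (by norm_num) (by norm_num), Real.sqrt_eq_rpow]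
  simp

theorem eLpNorm_two_le_iff {f : Ω → E} (hf : MemLp f 2 P) {c : ℝ} (hc : 0 ≤ c) :
    eLpNorm f 2 P ≤ ENNReal.ofReal c ↔ ∫ ω, ‖f ω‖ ^ 2 ∂P ≤ c ^ 2 := by
  rw [eLpNorm_two_eq_ofReal_sqrt hf, ENNReal.ofReal_le_ofReal_iff hc, Real.sqrt_le_left hc]

variable [InnerProductSpace ℝ E] [CompleteSpace E] [IsProbabilityMeasure P]

/-- A maximal inequality for partial sums of a process adapted to a filtration, when the predictions
`E[ε_i | F_{i-m}]` have summable `L²` norms: `ε_i` is the sum over `m` of the martingale differences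
`E[ε_i | F_{i-m}] - E[ε_i | F_{i-m-1}]`, and Doob's inequality applies for each `m`. -/
theorem integral_sumMax_sq_le_of_summable {F : ℤ → MeasurableSpace Ω} (hF : Monotone F)
    (hle : ∀ j, F j ≤ mΩ) {ε : ℤ → Ω → E} (hε2 : ∀ i, MemLp (ε i) 2 P)
    (hεm : ∀ i, StronglyMeasurable[F i] (ε i)) {c : ℕ → ℝ} (hc0 : ∀ m, 0 ≤ c m)
    (hc : Summable c)
    (hcond : ∀ (i : ℤ) (m : ℕ), ∫ ω, ‖(P[ε i | F (i - m)]) ω‖ ^ 2 ∂P ≤ c m ^ 2)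
    (z : ℤ) (n : ℕ) :
    ∫ ω, sumMax (fun i => ε (z + i) ω) n ^ 2 ∂P ≤ (2 * ∑' m, c m) ^ 2 * n := by
  -- the martingale differences of lag `m`, and the remainder after `M` of them
  let D : ℕ → ℕ → Ω → E := fun m i =>
    P[ε (z + i) | F (z + i - m)] - P[ε (z + i) | F (z + i - (m + 1))]
  let Rm : ℕ → ℕ → Ω → E := fun M i => P[ε (z + i) | F (z + i - M)]
  have hR2 : ∀ M i, MemLp (Rm M i) 2 P := fun M i => memLp_two_condExp (hε2 _)
  have hD2 : ∀ m i, MemLp (D m i) 2 P := fun m i =>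
    (memLp_two_condExp (hε2 _)).sub (memLp_two_condExp (hε2 _))
  have hDn : ∀ m i, ∫ ω, ‖D m i ω‖ ^ 2 ∂P ≤ c m ^ 2 := by
    intro m i
    have h1 := integral_norm_sq_sub_condExp_le (hle (z + i - (m + 1))) (hR2 m i)
    refine le_trans (le_of_eq ?_) (h1.trans (hcond _ m))
    refine integral_congr_ae ?_
    filter_upwards [condExp_condExp_of_le (μ := P) (f := ε (z + i))
      (hF (by omega : z + (i : ℤ) - (m + 1) ≤ z + i - m)) (hle _)] with ω hω
    simp only [D, Rm, Pi.sub_apply, hω]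
  have hDoob : ∀ m, eLpNorm (fun ω => sumMax (fun i => D m i ω) n) 2 P ≤
      ENNReal.ofReal (2 * √n * c m) := by
    intro m
    rw [eLpNorm_two_le_iff (memLp_sumMax (hD2 m) n) (by have := hc0 m; positivity)]
    simp only [Real.norm_eq_abs, sq_abs]
    have h := integral_sumMax_sq_le (P := P) (G := fun i : ℕ => F (z + i - (m + 1))) (d := D m)
      (fun i => hle _) (fun i j hij => hF (by simpa using hij)) ?_ (hD2 m) ?_ n
    · refine h.trans ?_
      calc 4 * ∑ i ∈ Finset.range n, ∫ ω, ‖D m i ω‖ ^ 2 ∂P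
          ≤ 4 * ∑ i ∈ Finset.range n, c m ^ 2 := by
            gcongr with i
            exact hDn m i
        _ = _ := by
            rw [Finset.sum_const, Finset.card_range, mul_pow, mul_pow,
              Real.sq_sqrt (Nat.cast_nonneg n), nsmul_eq_mul]
            ring
    · intro i
      have e : z + ((i + 1 : ℕ) : ℤ) - (m + 1) = z + i - m := by push_cast; ring
      change StronglyMeasurable[F (z + ((i + 1 : ℕ) : ℤ) - (m + 1))] (D m i)
      rw [e]
      exact stronglyMeasurable_condExp.sub (stronglyMeasurable_condExp.mono (hF (by omega)))
    · intro i
      have h1 := condExp_condExp_of_le (μ := P) (f := ε (z + i))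
        (hF (by omega : z + (i : ℤ) - (m + 1) ≤ z + i - m)) (hle _)
      have h2 := condExp_condExp_of_le (μ := P) (f := ε (z + i))
        (le_refl (F (z + (i : ℤ) - (m + 1)))) (hle _)
      refine (condExp_sub integrable_condExp integrable_condExp _).trans ?_
      filter_upwards [h1, h2] with ω hω hω'
      simp [hω, hω']
  have hRem : ∀ M, eLpNorm (fun ω => sumMax (fun i => Rm M i ω) n) 2 P ≤
      ENNReal.ofReal (n * c M) := by
    intro M
    have h1 : ∀ i, eLpNorm (fun ω => ‖Rm M i ω‖) 2 P ≤ ENNReal.ofReal (c M) := fun i => by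
      rw [eLpNorm_norm, eLpNorm_two_le_iff (hR2 M i) (hc0 M)]
      exact hcond _ M
    calc eLpNorm (fun ω => sumMax (fun i => Rm M i ω) n) 2 P
        ≤ eLpNorm (∑ i ∈ Finset.range n, fun ω => ‖Rm M i ω‖) 2 P := by
          refine eLpNorm_mono_real fun ω => ?_
          rw [Real.norm_of_nonneg (sumMax_nonneg _ _), Finset.sum_apply]
          exact sumMax_le_sum_norm _ _
      _ ≤ ∑ i ∈ Finset.range n, eLpNorm (fun ω => ‖Rm M i ω‖) 2 P :=
          eLpNorm_sum_le (fun i _ => (hR2 M i).1.norm) (by norm_num)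
      _ ≤ ∑ i ∈ Finset.range n, ENNReal.ofReal (c M) := Finset.sum_le_sum fun i _ => h1 i
      _ = ENNReal.ofReal (n * c M) := by
          rw [Finset.sum_const, Finset.card_range, nsmul_eq_mul,
            ENNReal.ofReal_mul (Nat.cast_nonneg n), ENNReal.ofReal_natCast]
  have htel : ∀ M ω, sumMax (fun i => ε (z + i) ω) n ≤
      ∑ m ∈ Finset.range M, sumMax (fun i => D m i ω) n + sumMax (fun i => Rm M i ω) n := by
    intro M ω
    have e : ∀ i : ℕ, ε (z + i) ω = ∑ m ∈ Finset.range M, D m i ω + Rm M i ω := by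
      intro i
      have h0 : P[ε (z + i) | F (z + i - (0 : ℕ))] = ε (z + i) := by
        have e0 : z + (i : ℤ) - (0 : ℕ) = z + i := by simp
        rw [e0]
        exact condExp_of_stronglyMeasurable (hle _) (hεm _) ((hε2 _).integrable (by norm_num))
      have h1 := Finset.sum_range_sub' (fun m : ℕ => (P[ε (z + i) | F (z + i - m)]) ω) M
      simp only [h0] at h1
      have h2 : ∑ m ∈ Finset.range M, D m i ω = ε (z + i) ω - Rm M i ω := by
        rw [← h1]
        refine Finset.sum_congr rfl fun m _ => ?_
        simp [D]
      rw [h2]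
      abel
    have e2 : (fun i : ℕ => ε (z + i) ω) = fun i => ∑ m ∈ Finset.range M, D m i ω + Rm M i ω :=
      funext e
    rw [e2]
    exact (sumMax_add_le _ _ n).trans (add_le_add (sumMax_sum_le _ _ n) le_rfl)
  have hε2' : ∀ i : ℕ, MemLp (ε (z + i)) 2 P := fun i => hε2 _
  have hbound : ∀ M : ℕ, eLpNorm (fun ω => sumMax (fun i => ε (z + i) ω) n) 2 P ≤
      ENNReal.ofReal (2 * √n * ∑' m, c m + n * c M) := by
    intro M
    have hsum : ∑ m ∈ Finset.range M, c m ≤ ∑' m, c m := hc.sum_le_tsum _ fun m _ => hc0 m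
    have hmeas : ∀ m, AEStronglyMeasurable (fun ω => sumMax (fun i => D m i ω) n) P := fun m =>
      (memLp_sumMax (hD2 m) n).1
    calc eLpNorm (fun ω => sumMax (fun i => ε (z + i) ω) n) 2 P
        ≤ eLpNorm ((∑ m ∈ Finset.range M, fun ω => sumMax (fun i => D m i ω) n) +
            fun ω => sumMax (fun i => Rm M i ω) n) 2 P := by
          refine eLpNorm_mono_real fun ω => ?_
          rw [Real.norm_of_nonneg (sumMax_nonneg _ _), Pi.add_apply, Finset.sum_apply]
          exact htel M ω
      _ ≤ ∑ m ∈ Finset.range M, eLpNorm (fun ω => sumMax (fun i => D m i ω) n) 2 P +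
            eLpNorm (fun ω => sumMax (fun i => Rm M i ω) n) 2 P :=
          (eLpNorm_add_le (Finset.aestronglyMeasurable_sum _ fun m _ => hmeas m)
            (memLp_sumMax (hR2 M) n).1 (by norm_num)).trans
            (add_le_add (eLpNorm_sum_le (fun m _ => hmeas m) (by norm_num)) le_rfl)
      _ ≤ ∑ m ∈ Finset.range M, ENNReal.ofReal (2 * √n * c m) + ENNReal.ofReal (n * c M) :=
          add_le_add (Finset.sum_le_sum fun m _ => hDoob m) (hRem M)
      _ = ENNReal.ofReal (2 * √n * ∑ m ∈ Finset.range M, c m + n * c M) := by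
          rw [← ENNReal.ofReal_sum_of_nonneg fun m _ => by have := hc0 m; positivity,
            ← Finset.mul_sum, ENNReal.ofReal_add _ (by have := hc0 M; positivity)]
          have : 0 ≤ ∑ m ∈ Finset.range M, c m := Finset.sum_nonneg fun m _ => hc0 m
          positivity
      _ ≤ _ := by gcongr
  have hlim : Tendsto (fun M : ℕ => ENNReal.ofReal (2 * √n * ∑' m, c m + n * c M)) atTop
      (𝓝 (ENNReal.ofReal (2 * √n * ∑' m, c m + n * 0))) :=
    ENNReal.tendsto_ofReal (tendsto_const_nhds.add (hc.tendsto_atTop_zero.const_mul _))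
  have hfin := ge_of_tendsto' hlim hbound
  have hS : 0 ≤ ∑' m, c m := tsum_nonneg hc0
  rw [mul_zero, add_zero, eLpNorm_two_le_iff (memLp_sumMax hε2' n) (by positivity)] at hfin
  simp only [Real.norm_eq_abs, sq_abs] at hfin
  refine hfin.trans (le_of_eq ?_)
  rw [mul_pow, mul_pow, mul_pow, Real.sq_sqrt (Nat.cast_nonneg n)]
  ring

end MaximalInequality

/-! ### Bernoulli shifts: stationarity and coupling -/

section Shifts

open scoped InnerProductSpace

variable {Ω S E : Type*} [mΩ : MeasurableSpace Ω] [MeasurableSpace S]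
  {P : Measure Ω} [IsProbabilityMeasure P] {η : ℤ → Ω → S}

/-- The innovations seen from time `ℓ` backwards. -/
def innovPath (η : ℤ → Ω → S) (ℓ : ℤ) (ω : Ω) : ℕ → S := fun i => η (ℓ - (i : ℤ)) ω

/-- The `σ`-algebra generated by the innovations with index in `s`. -/
@[reducible] def innovSigma (η : ℤ → Ω → S) (s : Set ℤ) : MeasurableSpace Ω :=
  ⨆ i ∈ s, MeasurableSpace.comap (η i) inferInstance

theorem innovSigma_le (hη : ∀ ℓ, Measurable (η ℓ)) (s : Set ℤ) : innovSigma η s ≤ mΩ :=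
  iSup₂_le fun i _ => (hη i).comap_le

theorem innovSigma_mono {s t : Set ℤ} (h : s ⊆ t) : innovSigma η s ≤ innovSigma η t :=
  biSup_mono fun _ hi => h hi

theorem measurable_innovSigma {s : Set ℤ} {i : ℤ} (hi : i ∈ s) :
    Measurable[innovSigma η s] (η i) :=
  (comap_measurable (η i)).mono (le_biSup (fun i => MeasurableSpace.comap (η i) inferInstance) hi)
    le_rfl

theorem measurable_innovPath (hη : ∀ ℓ, Measurable (η ℓ)) (ℓ : ℤ) :
    Measurable (innovPath η ℓ) :=
  measurable_pi_iff.2 fun _ => hη _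

theorem map_innovPath (hη : ∀ ℓ, Measurable (η ℓ)) (hind : iIndepFun η P)
    (hid : ∀ ℓ, IdentDistrib (η ℓ) (η 0) P P) (ℓ : ℤ) :
    P.map (innovPath η ℓ) = Measure.infinitePi (fun _ : ℕ => P.map (η 0)) := by
  have hinj : Function.Injective (fun i : ℕ => ℓ - (i : ℤ)) := fun i j h => by
    simpa using h
  have h := (hind.precomp hinj).map_fun_eq_infinitePi_map (fun i => hη _)
  refine Eq.trans h ?_
  congr 1
  funext i
  exact (hid _).map_eq

theorem lintegral_innovPath (hη : ∀ ℓ, Measurable (η ℓ)) (hind : iIndepFun η P)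
    (hid : ∀ ℓ, IdentDistrib (η ℓ) (η 0) P P) (ℓ ℓ' : ℤ) {ψ : (ℕ → S) → ℝ≥0∞}
    (hψ : Measurable ψ) :
    ∫⁻ ω, ψ (innovPath η ℓ ω) ∂P = ∫⁻ ω, ψ (innovPath η ℓ' ω) ∂P := by
  rw [← lintegral_map hψ (measurable_innovPath hη ℓ),
    ← lintegral_map hψ (measurable_innovPath hη ℓ'), map_innovPath hη hind hid ℓ,
    map_innovPath hη hind hid ℓ']

theorem lintegral_innovPath_prod (hη : ∀ ℓ, Measurable (η ℓ)) (hind : iIndepFun η P)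
    (hid : ∀ ℓ, IdentDistrib (η ℓ) (η 0) P P) (ℓ ℓ' : ℤ) {ψ : (ℕ → S) × (ℕ → S) → ℝ≥0∞}
    (hψ : Measurable ψ) :
    ∫⁻ z, ψ (innovPath η ℓ z.1, innovPath η ℓ z.2) ∂(P.prod P) =
      ∫⁻ z, ψ (innovPath η ℓ' z.1, innovPath η ℓ' z.2) ∂(P.prod P) := by
  have h : ∀ ℓ, ∫⁻ z, ψ (innovPath η ℓ z.1, innovPath η ℓ z.2) ∂(P.prod P) =
      ∫⁻ y, ψ y ∂((P.map (innovPath η ℓ)).prod (P.map (innovPath η ℓ))) := fun ℓ => by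
    rw [Measure.map_prod_map _ _ (measurable_innovPath hη ℓ) (measurable_innovPath hη ℓ),
      lintegral_map hψ ((measurable_innovPath hη ℓ).prodMap (measurable_innovPath hη ℓ))]
    rfl
  rw [h, h, map_innovPath hη hind hid ℓ, map_innovPath hη hind hid ℓ']

/-- Two sequences spliced after the first `m` entries. -/
def splice (m : ℕ) (y : (ℕ → S) × (ℕ → S)) : ℕ → S := fun i => if i < m then y.1 i else y.2 i

theorem measurable_splice (m : ℕ) : Measurable (splice m : (ℕ → S) × (ℕ → S) → ℕ → S) := by
  refine measurable_pi_iff.2 fun i => ?_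
  by_cases h : i < m
  · simp only [splice, h, if_true]
    fun_prop
  · simp only [splice, h, if_false]
    fun_prop

variable [NormedAddCommGroup E] {g : (ℕ → S) → E}

theorem stronglyMeasurable_shiftNoise (hg : StronglyMeasurable g) (ℓ : ℤ) :
    StronglyMeasurable[innovSigma η (Set.Iic ℓ)] (shiftNoise g η ℓ) :=
  hg.comp_measurable ((@measurable_pi_iff _ _ _ (innovSigma η (Set.Iic ℓ)) _ _).2 fun i =>
    measurable_innovSigma (by simp : ℓ - (i : ℤ) ∈ Set.Iic ℓ))

theorem stronglyMeasurable_coupledNoise (hη : ∀ ℓ, Measurable (η ℓ)) (hg : StronglyMeasurable g)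
    (m : ℕ) (ℓ : ℤ) : StronglyMeasurable (coupledNoise g η m ℓ) :=
  hg.comp_measurable ((measurable_splice m).comp
    ((measurable_innovPath hη ℓ).prodMap (measurable_innovPath hη ℓ)))

theorem stronglyMeasurable_coupledNoise_left (hg : StronglyMeasurable g) (m : ℕ) (ℓ : ℤ)
    (y : Ω) :
    StronglyMeasurable[innovSigma η (Set.Ioi (ℓ - m))] (fun x => coupledNoise g η m ℓ (x, y)) := by
  refine hg.comp_measurable
    ((@measurable_pi_iff _ _ _ (innovSigma η (Set.Ioi (ℓ - m))) _ _).2 fun i => ?_)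
  by_cases h : i < m
  · simp only [h, if_true]
    exact measurable_innovSigma (by simp [h])
  · simp only [h, if_false]
    exact measurable_const

variable [InnerProductSpace ℝ E] [CompleteSpace E]

/-- The prediction of `ε_ℓ` from the innovations up to time `ℓ - m` is controlled by the coupling
distance: conditionally on the copy, the coupled variable depends on later innovations only, hence
is orthogonal to that prediction. -/
theorem integral_norm_sq_condExp_le_coupling (hη : ∀ ℓ, Measurable (η ℓ))
    (hind : iIndepFun η P) (hg : StronglyMeasurable g) (m : ℕ) (ℓ : ℤ)
    (hε : MemLp (shiftNoise g η ℓ) 2 P) (h0 : ∫ ω, shiftNoise g η ℓ ω ∂P = 0)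
    (hf : MemLp (fun z : Ω × Ω => shiftNoise g η ℓ z.1 - coupledNoise g η m ℓ z) 2
      (P.prod P)) :
    ∫ ω, ‖(P[shiftNoise g η ℓ | innovSigma η (Set.Iic (ℓ - m))]) ω‖ ^ 2 ∂P ≤
      ∫ z, ‖shiftNoise g η ℓ z.1 - coupledNoise g η m ℓ z‖ ^ 2 ∂(P.prod P) := by
  set V : Ω → E := P[shiftNoise g η ℓ | innovSigma η (Set.Iic (ℓ - m))] with hV
  set f : Ω × Ω → E := fun z => shiftNoise g η ℓ z.1 - coupledNoise g η m ℓ z with hfdef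
  have hle := innovSigma_le (η := η) hη
  have hV2 : MemLp V 2 P := memLp_two_condExp hε
  have hmp : MeasurePreserving (Prod.fst : Ω × Ω → Ω) (P.prod P) P := measurePreserving_fst
  have hV2' : MemLp (fun z : Ω × Ω => V z.1) 2 (P.prod P) := hV2.comp_measurePreserving hmp
  have hε2' : MemLp (fun z : Ω × Ω => shiftNoise g η ℓ z.1) 2 (P.prod P) :=
    hε.comp_measurePreserving hmp
  have hc2 : MemLp (coupledNoise g η m ℓ) 2 (P.prod P) := by
    have h := hε2'.sub hf
    refine h.ae_eq (ae_of_all _ fun z => ?_)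
    simp [hfdef]
  have hEV : ∫ ω, V ω ∂P = 0 := by rw [hV, integral_condExp (hle _), h0]
  have hindep : Indep (innovSigma η (Set.Iic (ℓ - m))) (innovSigma η (Set.Ioi (ℓ - m))) P :=
    indep_iSup_of_disjoint (fun i => (hη i).comap_le) hind
      (Set.disjoint_left.2 fun x hx hx' => (Set.mem_Ioi.1 hx').not_ge (Set.mem_Iic.1 hx))
  have hVfut : P[V | innovSigma η (Set.Ioi (ℓ - m))] =ᵐ[P] 0 := by
    have hVm : StronglyMeasurable[innovSigma η (Set.Iic (ℓ - m))] V := stronglyMeasurable_condExp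
    have h := condExp_indep_eq (μ := P) (hle _) (hle (Set.Ioi (ℓ - m))) hVm hindep
    rw [hEV] at h
    exact h
  have hzero : ∫ z, ⟪V z.1, coupledNoise g η m ℓ z⟫_ℝ ∂(P.prod P) = 0 := by
    rw [integral_prod_symm _ (integrable_inner_of_memLp hV2' hc2)]
    have hsq : Integrable (fun z : Ω × Ω => ‖coupledNoise g η m ℓ z‖ ^ 2) (P.prod P) :=
      hc2.integrable_norm_pow (by norm_num)
    have hae : ∀ᵐ y ∂P, ∫ x, ⟪V x, coupledNoise g η m ℓ (x, y)⟫_ℝ ∂P = 0 := by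
      filter_upwards [hsq.prod_left_ae] with y hy
      have hm := stronglyMeasurable_coupledNoise_left (η := η) hg m ℓ y
      have hm2 : MemLp (fun x => coupledNoise g η m ℓ (x, y)) 2 P :=
        (memLp_two_iff_integrable_sq_norm (hm.mono (hle _)).aestronglyMeasurable).2 hy
      have h := integral_inner_eq_zero_of_condExp (hle _) hm hm2 hV2 hVfut
      simp_rw [real_inner_comm]
      exact h
    rw [integral_congr_ae (g := fun _ => (0 : ℝ)) hae]
    simp
  have h1 : ∫ ω, ⟪V ω, V ω⟫_ℝ ∂P = ∫ ω, ⟪V ω, shiftNoise g η ℓ ω⟫_ℝ ∂P :=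
    integral_inner_condExp (hle _) stronglyMeasurable_condExp hV2 hε
  have h2 : ∫ ω, ⟪V ω, shiftNoise g η ℓ ω⟫_ℝ ∂P =
      ∫ z : Ω × Ω, ⟪V z.1, shiftNoise g η ℓ z.1⟫_ℝ ∂(P.prod P) := by
    rw [integral_fun_fst (fun ω => ⟪V ω, shiftNoise g η ℓ ω⟫_ℝ)]
    simp
  have h3 : ∫ z : Ω × Ω, ⟪V z.1, shiftNoise g η ℓ z.1⟫_ℝ ∂(P.prod P) =
      ∫ z : Ω × Ω, ⟪V z.1, f z⟫_ℝ ∂(P.prod P) := by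
    have e : ∀ z : Ω × Ω, ⟪V z.1, shiftNoise g η ℓ z.1⟫_ℝ =
        ⟪V z.1, f z⟫_ℝ + ⟪V z.1, coupledNoise g η m ℓ z⟫_ℝ := fun z => by
      rw [← inner_add_right, hfdef]
      simp
    simp_rw [e]
    rw [integral_add (integrable_inner_of_memLp hV2' hf) (integrable_inner_of_memLp hV2' hc2),
      hzero, add_zero]
  have iV : Integrable (fun z : Ω × Ω => ‖V z.1‖ ^ 2) (P.prod P) :=
    hV2'.integrable_norm_pow (by norm_num)
  have iF : Integrable (fun z : Ω × Ω => ‖f z‖ ^ 2) (P.prod P) :=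
    hf.integrable_norm_pow (by norm_num)
  have h4 : ∫ z : Ω × Ω, ⟪V z.1, f z⟫_ℝ ∂(P.prod P) ≤
      ∫ z : Ω × Ω, (1 / 2 * ‖V z.1‖ ^ 2 + 1 / 2 * ‖f z‖ ^ 2) ∂(P.prod P) := by
    refine integral_mono (integrable_inner_of_memLp hV2' hf)
      ((iV.const_mul _).add (iF.const_mul _)) fun z => ?_
    have := real_inner_le_norm (V z.1) (f z)
    nlinarith [sq_nonneg (‖V z.1‖ - ‖f z‖)]
  rw [integral_add (iV.const_mul _) (iF.const_mul _), integral_const_mul, integral_const_mul]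
    at h4
  have h5 : ∫ z : Ω × Ω, ‖V z.1‖ ^ 2 ∂(P.prod P) = ∫ ω, ‖V ω‖ ^ 2 ∂P := by
    rw [integral_fun_fst (fun ω => ‖V ω‖ ^ 2)]
    simp
  simp_rw [real_inner_self_eq_norm_sq] at h1
  rw [h5] at h4
  linarith

end Shifts

/-! ### The maximal inequality for Bernoulli shifts -/

section ShiftCondition

variable {Ω S E : Type*} [mΩ : MeasurableSpace Ω] [MeasurableSpace S]
  [NormedAddCommGroup E] [InnerProductSpace ℝ E] [CompleteSpace E]
  {P : Measure Ω} [IsProbabilityMeasure P] {η : ℤ → Ω → S} {g : (ℕ → S) → E} {a κ : ℝ}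

theorem lintegral_enorm_shiftNoise_rpow (h : ShiftCondition P g η a κ) (p : ℝ) (ℓ : ℤ) :
    ∫⁻ ω, ‖shiftNoise g η ℓ ω‖ₑ ^ p ∂P = ∫⁻ ω, ‖shiftNoise g η 1 ω‖ₑ ^ p ∂P :=
  lintegral_innovPath h.measurable_innov h.indep_innov h.ident_innov ℓ 1
    (ψ := fun s => ‖g s‖ₑ ^ p) (h.measurable_g.enorm.pow_const p)

theorem lintegral_enorm_coupling_rpow (h : ShiftCondition P g η a κ) (p : ℝ) (m : ℕ) (ℓ : ℤ) :
    ∫⁻ z, ‖shiftNoise g η ℓ z.1 - coupledNoise g η m ℓ z‖ₑ ^ p ∂(P.prod P) =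
      ∫⁻ z, ‖shiftNoise g η 1 z.1 - coupledNoise g η m 1 z‖ₑ ^ p ∂(P.prod P) := by
  have hm : StronglyMeasurable (fun y : (ℕ → S) × (ℕ → S) => g y.1 - g (splice m y)) :=
    (h.measurable_g.comp_measurable measurable_fst).sub
      (h.measurable_g.comp_measurable (measurable_splice m))
  exact lintegral_innovPath_prod h.measurable_innov h.indep_innov h.ident_innov ℓ 1
    (ψ := fun y => ‖g y.1 - g (splice m y)‖ₑ ^ p) (hm.enorm.pow_const p)

theorem integral_shiftNoise (h : ShiftCondition P g η a κ) (ℓ : ℤ) :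
    ∫ ω, shiftNoise g η ℓ ω ∂P = 0 := by
  have hℓ : ∀ ℓ, ∫ ω, shiftNoise g η ℓ ω ∂P =
      ∫ s, g s ∂(Measure.infinitePi (fun _ : ℕ => P.map (η 0))) := fun ℓ => by
    rw [← map_innovPath h.measurable_innov h.indep_innov h.ident_innov ℓ,
      integral_map (measurable_innovPath h.measurable_innov ℓ).aemeasurable
        h.measurable_g.aestronglyMeasurable]
    rfl
  rw [hℓ, ← hℓ 1, h.centred]

theorem stronglyMeasurable_shiftNoise' (h : ShiftCondition P g η a κ) (ℓ : ℤ) :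
    StronglyMeasurable (shiftNoise g η ℓ) :=
  (stronglyMeasurable_shiftNoise h.measurable_g ℓ).mono (innovSigma_le h.measurable_innov _)

theorem memLp_shiftNoise (h : ShiftCondition P g η a κ) (ℓ : ℤ) :
    MemLp (shiftNoise g η ℓ) (ENNReal.ofReal (4 + a)) P := by
  have ha := h.a_pos
  refine ⟨(stronglyMeasurable_shiftNoise' h ℓ).aestronglyMeasurable, ?_⟩
  refine (eLpNorm_lt_top_iff_lintegral_rpow_enorm_lt_top (by simp; linarith) (by simp)).2 ?_
  rw [ENNReal.toReal_ofReal (by linarith), lintegral_enorm_shiftNoise_rpow h]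
  exact h.moment

theorem memLp_two_shiftNoise (h : ShiftCondition P g η a κ) (ℓ : ℤ) :
    MemLp (shiftNoise g η ℓ) 2 P := by
  have ha := h.a_pos
  refine (memLp_shiftNoise h ℓ).mono_exponent ?_
  rw [← ENNReal.ofReal_ofNat]
  exact ENNReal.ofReal_le_ofReal (by linarith)

theorem memLp_four_shiftNoise (h : ShiftCondition P g η a κ) (ℓ : ℤ) :
    MemLp (shiftNoise g η ℓ) 4 P := by
  have ha := h.a_pos
  refine (memLp_shiftNoise h ℓ).mono_exponent ?_
  rw [← ENNReal.ofReal_ofNat]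
  exact ENNReal.ofReal_le_ofReal (by linarith)

/-- A summable series of `p`-th roots stays summable when the order `p` of the root decreases. -/
theorem tsum_rpow_one_div_lt_top {δ : ℕ → ℝ≥0∞} {p q : ℝ} (hq : 0 < q) (hpq : q ≤ p)
    (h : ∑' m, δ m ^ (1 / p) < ∞) : ∑' m, δ m ^ (1 / q) < ∞ := by
  have hp : 0 < p := hq.trans_le hpq
  set T := ∑' m, δ m ^ (1 / p) with hT
  have h1 : ∀ m, δ m ^ (1 / q) ≤ δ m ^ (1 / p) * T ^ (p / q - 1) := by
    intro m
    have hm : δ m ^ (1 / p) ≤ T := ENNReal.le_tsum m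
    have hr : 0 ≤ p / q - 1 := by
      rw [sub_nonneg, one_le_div hq]
      exact hpq
    have e : δ m ^ (1 / q) = (δ m ^ (1 / p)) ^ (1 + (p / q - 1)) := by
      rw [← ENNReal.rpow_mul]
      congr 1
      field_simp
      ring
    rw [e, ENNReal.rpow_add_of_nonneg _ _ zero_le_one hr, ENNReal.rpow_one]
    gcongr
  refine (ENNReal.tsum_le_tsum h1).trans_lt ?_
  rw [ENNReal.tsum_mul_right]
  refine ENNReal.mul_lt_top h (ENNReal.rpow_lt_top_of_nonneg ?_ h.ne)
  rw [sub_nonneg, one_le_div hq]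
  exact hpq

/-- Maximal inequality for the errors, uniform in the starting point. -/
theorem exists_integral_sumMax_shiftNoise_le (h : ShiftCondition P g η a κ) :
    ∃ C : ℝ, 0 < C ∧ ∀ (z : ℤ) (n : ℕ),
      ∫ ω, sumMax (fun i => shiftNoise g η (z + i) ω) n ^ 2 ∂P ≤ C * n := by
  have ha := h.a_pos
  have hle := innovSigma_le h.measurable_innov
  have hq : 0 < 4 + a := by linarith
  set δ : ℕ → ℝ≥0∞ := fun m =>
    ∫⁻ z, ‖shiftNoise g η 1 z.1 - coupledNoise g η (m + 1) 1 z‖ₑ ^ (4 + a) ∂(P.prod P) with hδ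
  have hsum : ∑' m, δ m ^ (1 / (4 + a)) < ∞ :=
    tsum_rpow_one_div_lt_top hq h.kappa_gt.le h.summable_coupling
  have hδfin : ∀ m, δ m ^ (1 / (4 + a)) < ∞ := fun m => (ENNReal.le_tsum m).trans_lt hsum
  let c : ℕ → ℝ := fun m => Nat.casesOn m (√(∫ ω, ‖shiftNoise g η 1 ω‖ ^ 2 ∂P) + 1)
    (fun m => (δ m ^ (1 / (4 + a))).toReal)
  have hc0 : ∀ m, 0 ≤ c m := by
    intro m
    cases m with
    | zero => exact add_nonneg (Real.sqrt_nonneg _) zero_le_one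
    | succ m => exact ENNReal.toReal_nonneg
  have hcs : Summable c := by
    rw [← summable_nat_add_iff 1]
    exact ENNReal.summable_toReal hsum.ne
  have hcpl : ∀ (m : ℕ) (ℓ : ℤ),
      eLpNorm (fun z : Ω × Ω => shiftNoise g η ℓ z.1 - coupledNoise g η (m + 1) ℓ z)
        (ENNReal.ofReal (4 + a)) (P.prod P) = δ m ^ (1 / (4 + a)) := by
    intro m ℓ
    rw [eLpNorm_eq_lintegral_rpow_enorm_toReal (by simp; linarith) (by simp),
      ENNReal.toReal_ofReal hq.le, lintegral_enorm_coupling_rpow h]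
  have hmeas : ∀ (m : ℕ) (ℓ : ℤ), AEStronglyMeasurable
      (fun z : Ω × Ω => shiftNoise g η ℓ z.1 - coupledNoise g η m ℓ z) (P.prod P) := fun m ℓ =>
    (((stronglyMeasurable_shiftNoise' h ℓ).comp_measurable measurable_fst).sub
      (stronglyMeasurable_coupledNoise h.measurable_innov h.measurable_g m ℓ)).aestronglyMeasurable
  have h2q : (2 : ℝ≥0∞) ≤ ENNReal.ofReal (4 + a) := by
    rw [← ENNReal.ofReal_ofNat]
    exact ENNReal.ofReal_le_ofReal (by linarith)
  have hcond : ∀ (i : ℤ) (m : ℕ),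
      ∫ ω, ‖(P[shiftNoise g η i | innovSigma η (Set.Iic (i - m))]) ω‖ ^ 2 ∂P ≤ c m ^ 2 := by
    intro i m
    cases m with
    | zero =>
      have e : P[shiftNoise g η i | innovSigma η (Set.Iic (i - (0 : ℕ)))] = shiftNoise g η i :=
        condExp_of_stronglyMeasurable (hle _)
          ((stronglyMeasurable_shiftNoise h.measurable_g i).mono (innovSigma_mono (by simp)))
          ((memLp_two_shiftNoise h i).integrable (by norm_num))
      rw [e]
      have hst : ∫ ω, ‖shiftNoise g η i ω‖ ^ 2 ∂P = ∫ ω, ‖shiftNoise g η 1 ω‖ ^ 2 ∂P := by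
        have h1 := lintegral_enorm_shiftNoise_rpow h (2 : ℝ) i
        have e2 : ∀ ℓ, eLpNorm (shiftNoise g η ℓ) 2 P =
            (∫⁻ ω, ‖shiftNoise g η ℓ ω‖ₑ ^ (2 : ℝ) ∂P) ^ (1 / (2 : ℝ)) := fun ℓ => by
          rw [eLpNorm_eq_lintegral_rpow_enorm_toReal (by norm_num) (by norm_num)]
          simp
        have h3 : eLpNorm (shiftNoise g η i) 2 P = eLpNorm (shiftNoise g η 1) 2 P := by
          rw [e2, e2, h1]
        rw [eLpNorm_two_eq_ofReal_sqrt (memLp_two_shiftNoise h i),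
          eLpNorm_two_eq_ofReal_sqrt (memLp_two_shiftNoise h 1),
          ENNReal.ofReal_eq_ofReal_iff (Real.sqrt_nonneg _) (Real.sqrt_nonneg _)] at h3
        exact (Real.sqrt_inj (integral_nonneg fun _ => by positivity)
          (integral_nonneg fun _ => by positivity)).1 h3
      rw [hst]
      have h0 : 0 ≤ ∫ ω, ‖shiftNoise g η 1 ω‖ ^ 2 ∂P := integral_nonneg fun _ => by positivity
      change _ ≤ (√(∫ ω, ‖shiftNoise g η 1 ω‖ ^ 2 ∂P) + 1) ^ 2
      nlinarith [Real.sq_sqrt h0, Real.sqrt_nonneg (∫ ω, ‖shiftNoise g η 1 ω‖ ^ 2 ∂P)]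
    | succ m =>
      have hle2 : eLpNorm (fun z : Ω × Ω => shiftNoise g η i z.1 - coupledNoise g η (m + 1) i z)
          2 (P.prod P) ≤ ENNReal.ofReal (c (m + 1)) := by
        refine (eLpNorm_le_eLpNorm_of_exponent_le h2q (hmeas (m + 1) i)).trans ?_
        rw [hcpl]
        exact (ENNReal.ofReal_toReal (hδfin m).ne).ge
      have hf : MemLp (fun z : Ω × Ω => shiftNoise g η i z.1 - coupledNoise g η (m + 1) i z)
          2 (P.prod P) := ⟨hmeas (m + 1) i, hle2.trans_lt ENNReal.ofReal_lt_top⟩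
      exact (integral_norm_sq_condExp_le_coupling h.measurable_innov h.indep_innov h.measurable_g
        (m + 1) i (memLp_two_shiftNoise h i) (integral_shiftNoise h i) hf).trans
        ((eLpNorm_two_le_iff hf (hc0 (m + 1))).1 hle2)
  refine ⟨(2 * ∑' m, c m) ^ 2 + 1, by positivity, fun z n => ?_⟩
  refine (integral_sumMax_sq_le_of_summable (F := fun j => innovSigma η (Set.Iic j))
    (fun i j hij => innovSigma_mono (Set.Iic_subset_Iic.2 hij)) (fun j => hle _)
    (memLp_two_shiftNoise h) (stronglyMeasurable_shiftNoise h.measurable_g) hc0 hcs hcond z n).trans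
    ?_
  have : (0 : ℝ) ≤ n := Nat.cast_nonneg n
  nlinarith

end ShiftCondition

/-! ### The event on which the noise is tame -/

section Tame

variable {E : Type*} [NormedAddCommGroup E]

/-- The partial sums `x_1 + ⋯ + x_k`. -/
def psum (x : ℕ → E) (k : ℕ) : E := ∑ i ∈ Finset.Ioc 0 k, x i

theorem psum_succ (x : ℕ → E) (k : ℕ) : psum x (k + 1) = psum x k + x (k + 1) := by
  unfold psum
  rw [Finset.sum_Ioc_succ_top (Nat.zero_le k)]

theorem psum_sub_psum (x : ℕ → E) {ℓ k : ℕ} (h : ℓ ≤ k) :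
    psum x k - psum x ℓ = ∑ i ∈ Finset.Ioc ℓ k, x i := by
  unfold psum
  rw [← Finset.sum_Ioc_consecutive x (Nat.zero_le ℓ) h, add_sub_cancel_left]

theorem psum_add_sub_psum (x : ℕ → E) (k h : ℕ) :
    psum x (k + h) - psum x k = ∑ i ∈ Finset.range h, x (k + 1 + i) := by
  induction h with
  | zero => simp
  | succ h ih =>
    rw [Finset.sum_range_succ, ← ih, ← add_assoc, psum_succ, add_right_comm k h 1]
    abel

/-- Noise that is well behaved around the anchors `b_0, …, b_n` at level `K`: its sums over intervals
starting or ending at an anchor grow at a controlled rate, on the global and on the local scale, and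
no single observation is large. -/
structure TameNoise (α K : ℝ) (N n : ℕ) (b : ℕ → ℕ) (e : ℕ → E) : Prop where
  global : ∀ j ≤ n, ∀ k ≤ N, ‖psum e k - psum e (b j)‖ ^ 2 ≤
    K * (|(k : ℝ) - b j| ^ α * (N : ℝ) ^ (1 - α))
  local' : ∀ j ≤ n, ∀ k ≤ N, ‖psum e k - psum e (b j)‖ ^ 4 ≤ K ^ 2 * |(k : ℝ) - b j| ^ 3
  sum_sq : ∑ i ∈ Finset.Ioc 0 N, ‖e i‖ ^ 2 ≤ K * N
  four : ∀ i, 0 < i → i ≤ N → ‖e i‖ ^ 4 ≤ K * N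

end Tame

section TameProb

variable {Ω E : Type*} [NormedAddCommGroup E] {mΩ : MeasurableSpace Ω} {P : Measure Ω}
  [IsProbabilityMeasure P]

theorem measureReal_le_div_of_integral_le {f : Ω → ℝ} (hf0 : ∀ ω, 0 ≤ f ω) (hf : Integrable f P)
    {c A : ℝ} (hc : 0 < c) (hA : ∫ ω, f ω ∂P ≤ A) : P.real {ω | c ≤ f ω} ≤ A / c := by
  rw [le_div_iff₀ hc, mul_comm]
  exact (mul_meas_ge_le_integral_of_nonneg (ae_of_all _ hf0) hf c).trans hA

/-- A dyadic union bound turning a maximal inequality into a bound for the whole path. -/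
theorem measureReal_exists_lt_sq_le {ε : ℤ → Ω → E} (hε : ∀ i, MemLp (ε i) 2 P) {C : ℝ}
    (hC : ∀ (z : ℤ) (n : ℕ), ∫ ω, sumMax (fun i => ε (z + i) ω) n ^ 2 ∂P ≤ C * n)
    {B : ℕ → Ω → ℝ} (hB0 : ∀ h ω, 0 ≤ B h ω) {z : ℕ → ℤ}
    (hB : ∀ p h ω, h ≤ 2 ^ (p + 1) →
      B h ω ≤ 2 * sumMax (fun i => ε (z p + i) ω) (2 ^ (p + 1)))
    {f : ℕ → ℝ} (hf : ∀ h h', h ≤ h' → f h ≤ f h') (hf0 : ∀ h, 0 < h → 0 < f h)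
    {K : ℝ} (hK : 0 < K) (N : ℕ) :
    P.real {ω | ∃ h, 0 < h ∧ h ≤ N ∧ K * f h < B h ω ^ 2} ≤
      4 * C / K * ∑ p ∈ Finset.range (Nat.log 2 N + 1), 2 ^ (p + 1) / f (2 ^ p) := by
  have hsub : {ω | ∃ h, 0 < h ∧ h ≤ N ∧ K * f h < B h ω ^ 2} ⊆
      ⋃ p ∈ Finset.range (Nat.log 2 N + 1),
        {ω | K * f (2 ^ p) / 4 ≤ sumMax (fun i => ε (z p + i) ω) (2 ^ (p + 1)) ^ 2} := by
    rintro ω ⟨h, h0, hN, hlt⟩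
    simp only [Set.mem_iUnion, Set.mem_ofPred_eq]
    refine ⟨Nat.log 2 h, ?_, ?_⟩
    · have := Nat.log_mono_right (b := 2) hN
      simp only [Finset.mem_range]
      omega
    · have h1 : f (2 ^ Nat.log 2 h) ≤ f h := hf _ _ (Nat.pow_log_le_self 2 h0.ne')
      have h2 := hB (Nat.log 2 h) h ω (Nat.lt_pow_succ_log_self (by norm_num) h).le
      have h3 := hB0 h ω
      have h4 : K * f (2 ^ Nat.log 2 h) ≤ K * f h := by gcongr
      have h5 : B h ω ^ 2 ≤
          (2 * sumMax (fun i => ε (z (Nat.log 2 h) + i) ω) (2 ^ (Nat.log 2 h + 1))) ^ 2 := by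
        gcongr
      linarith
  refine (measureReal_mono hsub (measure_ne_top _ _)).trans ((measureReal_biUnion_finset_le _ _).trans ?_)
  rw [Finset.mul_sum]
  refine Finset.sum_le_sum fun p _ => ?_
  have hfp : 0 < f (2 ^ p) := hf0 _ (by positivity)
  have hi : Integrable (fun ω => sumMax (fun i => ε (z p + i) ω) (2 ^ (p + 1)) ^ 2) P :=
    (memLp_sumMax (d := fun (i : ℕ) => ε (z p + i)) (fun i => hε _) _).integrable_sq
  refine (measureReal_le_div_of_integral_le (fun ω => sq_nonneg _) hi (by positivity)
    (hC (z p) (2 ^ (p + 1)))).trans (le_of_eq ?_)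
  push_cast
  field_simp

theorem sum_two_pow_div_rpow_le (n : ℕ) :
    ∑ p ∈ Finset.range n, (2 : ℝ) ^ (p + 1) / ((2 ^ p : ℕ) : ℝ) ^ (3 / 2 : ℝ) ≤
      2 / (1 - 2 ^ (-(1 / 2) : ℝ)) := by
  have hx1 : (2 : ℝ) ^ (-(1 / 2) : ℝ) < 1 := Real.rpow_lt_one_of_one_lt_of_neg (by norm_num)
    (by norm_num)
  have e : ∀ p : ℕ, (2 : ℝ) ^ (p + 1) / ((2 ^ p : ℕ) : ℝ) ^ (3 / 2 : ℝ) =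
      2 * ((2 : ℝ) ^ (-(1 / 2) : ℝ)) ^ p := by
    intro p
    rw [← Real.rpow_natCast ((2 : ℝ) ^ (-(1 / 2) : ℝ)), ← Real.rpow_mul (by norm_num)]
    push_cast
    rw [← Real.rpow_natCast 2 p, ← Real.rpow_mul (by norm_num), pow_succ, ← Real.rpow_natCast 2 p,
      mul_comm _ (2 : ℝ), mul_div_assoc, ← Real.rpow_sub (by norm_num)]
    congr 2
    ring
  simp_rw [e]
  rw [← Finset.mul_sum, div_eq_mul_inv]
  have h := (summable_geometric_of_lt_one (by positivity) hx1).sum_le_tsum (Finset.range n)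
    fun p _ => by positivity
  rw [tsum_geometric_of_lt_one (by positivity) hx1] at h
  exact mul_le_mul_of_nonneg_left h zero_le_two

theorem sum_two_pow_div_rpow_mul_le {α : ℝ} (hα : α < 1) {N : ℕ} (hN : 0 < N) :
    ∑ p ∈ Finset.range (Nat.log 2 N + 1),
        (2 : ℝ) ^ (p + 1) / (((2 ^ p : ℕ) : ℝ) ^ α * (N : ℝ) ^ (1 - α)) ≤
      2 / (1 - 2 ^ (-(1 - α))) := by
  set L := Nat.log 2 N with hL
  have hx1 : (2 : ℝ) ^ (-(1 - α)) < 1 := Real.rpow_lt_one_of_one_lt_of_neg (by norm_num)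
    (by linarith)
  have hLN : (2 : ℝ) ^ L ≤ N := by exact_mod_cast Nat.pow_log_le_self 2 hN.ne'
  have e : ∀ p ∈ Finset.range (L + 1),
      (2 : ℝ) ^ (p + 1) / (((2 ^ p : ℕ) : ℝ) ^ α * (N : ℝ) ^ (1 - α)) ≤
      2 * ((2 : ℝ) ^ (-(1 - α))) ^ (L - p) := by
    intro p hp
    have hp' : p ≤ L := by have := Finset.mem_range.1 hp; omega
    have h1 : ((2 : ℝ) ^ L) ^ (1 - α) ≤ (N : ℝ) ^ (1 - α) :=
      Real.rpow_le_rpow (by positivity) hLN (by linarith)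
    have h2 : (2 : ℝ) ^ (p + 1) / (((2 ^ p : ℕ) : ℝ) ^ α * (N : ℝ) ^ (1 - α)) ≤
        (2 : ℝ) ^ (p + 1) / (((2 ^ p : ℕ) : ℝ) ^ α * ((2 : ℝ) ^ L) ^ (1 - α)) := by
      gcongr
    refine h2.trans (le_of_eq ?_)
    rw [← Real.rpow_natCast ((2 : ℝ) ^ (-(1 - α))), ← Real.rpow_mul (by norm_num)]
    push_cast [hp']
    rw [← Real.rpow_natCast 2 p, ← Real.rpow_mul (by norm_num), pow_succ, ← Real.rpow_natCast 2 p,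
      ← Real.rpow_natCast 2 L, ← Real.rpow_mul (by norm_num), ← Real.rpow_add (by norm_num),
      mul_comm _ (2 : ℝ), mul_div_assoc, ← Real.rpow_sub (by norm_num)]
    congr 2
    ring
  refine (Finset.sum_le_sum e).trans ?_
  rw [← Finset.mul_sum, div_eq_mul_inv]
  have hr := Finset.sum_range_reflect (fun p => ((2 : ℝ) ^ (-(1 - α))) ^ p) (L + 1)
  simp only [Nat.add_sub_cancel] at hr
  rw [hr]
  have h := (summable_geometric_of_lt_one (by positivity) hx1).sum_le_tsum (Finset.range (L + 1))
    fun p _ => by positivity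
  rw [tsum_geometric_of_lt_one (by positivity) hx1] at h
  linarith

/-- The sums of the noise before and after a given time `b` grow at most like a prescribed rate `f`,
up to an event whose probability is controlled by a dyadic series. -/
theorem measureReal_exists_psum_le {ε : ℤ → Ω → E} (hε : ∀ i, MemLp (ε i) 2 P) {C : ℝ}
    (hC : ∀ (z : ℤ) (n : ℕ), ∫ ω, sumMax (fun i => ε (z + i) ω) n ^ 2 ∂P ≤ C * n)
    {f : ℕ → ℝ} (hf : ∀ h h', h ≤ h' → f h ≤ f h') (hf0 : ∀ h, 0 < h → 0 < f h)
    {K : ℝ} (hK : 0 < K) (N b : ℕ) (hb : b ≤ N) :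
    P.real {ω | ∃ h k, 0 < h ∧ k ≤ N ∧ (k = b + h ∨ b = k + h) ∧
        K * f h < ‖psum (fun i => ε i ω) k - psum (fun i => ε i ω) b‖ ^ 2} ≤
      8 * C / K * ∑ p ∈ Finset.range (Nat.log 2 N + 1), 2 ^ (p + 1) / f (2 ^ p) := by
  let B1 : ℕ → Ω → ℝ := fun h ω => ‖∑ i ∈ Finset.range h, ε ((b + 1 : ℤ) + i) ω‖
  let B2 : ℕ → Ω → ℝ := fun h ω => ‖∑ i ∈ Finset.range h, ε ((b + 1 - h : ℤ) + i) ω‖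
  have h1 := measureReal_exists_lt_sq_le hε hC (B := B1) (fun h ω => norm_nonneg _)
    (z := fun _ => b + 1) (fun p h ω hh => by
      have h1 := norm_sum_le_sumMax (fun i : ℕ => ε ((b + 1 : ℤ) + i) ω) hh
      have h2 := sumMax_nonneg (fun i : ℕ => ε ((b + 1 : ℤ) + i) ω) (2 ^ (p + 1))
      simp only [B1]
      linarith) hf hf0 hK N
  have h2 := measureReal_exists_lt_sq_le hε hC (B := B2) (fun h ω => norm_nonneg _)
    (z := fun p => b + 1 - (2 ^ (p + 1) : ℕ)) (fun p h ω hh => by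
      set n := 2 ^ (p + 1) with hn
      set F : ℕ → E := fun i : ℕ => ε ((b + 1 - n : ℤ) + i) ω with hF
      have e1 : ∑ i ∈ Finset.range h, ε ((b + 1 - h : ℤ) + i) ω =
          ∑ i ∈ Finset.range n, F i - ∑ i ∈ Finset.range (n - h), F i := by
        obtain ⟨r, hr⟩ := Nat.exists_eq_add_of_le' hh
        rw [hr, Nat.add_sub_cancel, Finset.sum_range_add, add_sub_cancel_left]
        refine Finset.sum_congr rfl fun i _ => ?_
        simp only [hF]
        congr 1
        rw [hr]
        push_cast
        ring
      have h1 := norm_sum_le_sumMax F (le_refl n)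
      have h2 := norm_sum_le_sumMax F (Nat.sub_le n h)
      change ‖∑ i ∈ Finset.range h, ε ((b + 1 - h : ℤ) + i) ω‖ ≤ _
      rw [e1]
      refine (norm_sub_le _ _).trans ?_
      linarith) hf hf0 hK N
  refine (measureReal_mono (s₂ := {ω | ∃ h, 0 < h ∧ h ≤ N ∧ K * f h < B1 h ω ^ 2} ∪
    {ω | ∃ h, 0 < h ∧ h ≤ N ∧ K * f h < B2 h ω ^ 2}) ?_ (measure_ne_top _ _)).trans
    ((measureReal_union_le _ _).trans ?_)
  · rintro ω ⟨h, k, hh, hk, rfl | rfl, hlt⟩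
    · left
      refine ⟨h, hh, by omega, ?_⟩
      rw [psum_add_sub_psum] at hlt
      simpa [B1] using hlt
    · right
      refine ⟨h, hh, by omega, ?_⟩
      rw [norm_sub_rev, psum_add_sub_psum] at hlt
      have e : ((k + h : ℕ) + 1 - h : ℤ) = k + 1 := by push_cast; ring
      simp only [B2, e]
      simpa using hlt
  · refine (add_le_add h1 h2).trans (le_of_eq ?_)
    ring

/-- With probability close to `1` the noise is tame at a high level. -/
theorem exists_measureReal_not_tameNoise_le {ε : ℤ → Ω → E} (hε : ∀ i, MemLp (ε i) 4 P) {C C4 : ℝ}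
    (hC0 : 0 < C)
    (hC : ∀ (z : ℤ) (n : ℕ), ∫ ω, sumMax (fun i => ε (z + i) ω) n ^ 2 ∂P ≤ C * n)
    (hC4 : ∀ i, ∫ ω, ‖ε i ω‖ ^ 4 ∂P ≤ C4) {α : ℝ} (hα0 : 0 < α) (hα1 : α < 1) (n : ℕ) :
    ∃ A : ℝ, ∀ (K : ℝ) (N : ℕ) (b : ℕ → ℕ), 1 ≤ K → 0 < N → (∀ j ≤ n, b j ≤ N) →
      P.real {ω | ¬ TameNoise α K N n b (fun i => ε i ω)} ≤ A / K := by
  have hε2 : ∀ i, MemLp (ε i) 2 P := fun i => (hε i).mono_exponent (by norm_num)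
  have i4 : ∀ i, Integrable (fun ω => ‖ε i ω‖ ^ 4) P := fun i =>
    (hε i).integrable_norm_pow (by norm_num)
  have i2 : ∀ i, Integrable (fun ω => ‖ε i ω‖ ^ 2) P := fun i =>
    (hε2 i).integrable_norm_pow (by norm_num)
  have hC2 : ∀ i, ∫ ω, ‖ε i ω‖ ^ 2 ∂P ≤ 1 + C4 := by
    intro i
    have h1 : ∫ ω, ‖ε i ω‖ ^ 2 ∂P ≤ ∫ ω, (1 + ‖ε i ω‖ ^ 4) ∂P :=
      integral_mono (i2 i) ((integrable_const _).add (i4 i)) fun ω => by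
        simp only
        nlinarith [sq_nonneg (‖ε i ω‖ ^ 2 - 1), sq_nonneg (‖ε i ω‖ ^ 2)]
    rw [integral_add (integrable_const _) (i4 i)] at h1
    simp only [integral_const, probReal_univ, smul_eq_mul, mul_one] at h1
    linarith [hC4 i]
  set D1 : ℝ := 2 / (1 - 2 ^ (-(1 / 2) : ℝ)) with hD1
  set D2 : ℝ := 2 / (1 - 2 ^ (-(1 - α))) with hD2
  refine ⟨(n + 1) * (8 * C * D1 + 8 * C * D2) + (1 + C4) + C4, fun K N b hK hN hb => ?_⟩
  have hK0 : 0 < K := by linarith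
  have hN0 : (0 : ℝ) < N := by exact_mod_cast hN
  let f1 : ℕ → ℝ := fun h => (h : ℝ) ^ (3 / 2 : ℝ)
  let f2 : ℕ → ℝ := fun h => (h : ℝ) ^ α * (N : ℝ) ^ (1 - α)
  let Bad : (ℕ → ℝ) → ℕ → Set Ω := fun f j =>
    {ω | ∃ h k, 0 < h ∧ k ≤ N ∧ (k = b j + h ∨ b j = k + h) ∧
        K * f h < ‖psum (fun i => ε i ω) k - psum (fun i => ε i ω) (b j)‖ ^ 2}
  let B3 : Set Ω := {ω | K * N ≤ ∑ i ∈ Finset.Ioc 0 N, ‖ε i ω‖ ^ 2}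
  let B4 : Set Ω := {ω | K * N ≤ ∑ i ∈ Finset.Ioc 0 N, ‖ε i ω‖ ^ 4}
  have h1 : ∀ j ≤ n, P.real (Bad f1 j) ≤ 8 * C / K * D1 := fun j hj =>
    (measureReal_exists_psum_le hε2 hC (f := f1)
      (fun h h' hh => Real.rpow_le_rpow (by positivity) (by exact_mod_cast hh) (by norm_num))
      (fun h hh => Real.rpow_pos_of_pos (by exact_mod_cast hh) _) hK0 N (b j) (hb j hj)).trans
      (mul_le_mul_of_nonneg_left (sum_two_pow_div_rpow_le _) (by positivity))
  have h2 : ∀ j ≤ n, P.real (Bad f2 j) ≤ 8 * C / K * D2 := fun j hj =>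
    (measureReal_exists_psum_le hε2 hC (f := f2)
      (fun h h' hh => mul_le_mul_of_nonneg_right
        (Real.rpow_le_rpow (by positivity) (by exact_mod_cast hh) hα0.le) (by positivity))
      (fun h hh => mul_pos (Real.rpow_pos_of_pos (by exact_mod_cast hh) _)
        (Real.rpow_pos_of_pos hN0 _)) hK0 N (b j) (hb j hj)).trans
      (mul_le_mul_of_nonneg_left (sum_two_pow_div_rpow_mul_le hα1 hN) (by positivity))
  have h3 : P.real B3 ≤ (1 + C4) / K := by
    have := measureReal_le_div_of_integral_le (P := P)
      (f := fun ω => ∑ i ∈ Finset.Ioc 0 N, ‖ε i ω‖ ^ 2) (c := K * N) (A := N * (1 + C4))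
      (fun ω => by positivity) (integrable_finsetSum _ fun i _ => i2 i) (by positivity) (by
        rw [integral_finsetSum _ fun (i : ℕ) _ => i2 i]
        refine (Finset.sum_le_sum fun (i : ℕ) _ => hC2 i).trans (le_of_eq ?_)
        simp
        ring)
    refine this.trans (le_of_eq ?_)
    field_simp
  have h4 : P.real B4 ≤ C4 / K := by
    have := measureReal_le_div_of_integral_le (P := P)
      (f := fun ω => ∑ i ∈ Finset.Ioc 0 N, ‖ε i ω‖ ^ 4) (c := K * N) (A := N * C4)
      (fun ω => by positivity) (integrable_finsetSum _ fun i _ => i4 i) (by positivity) (by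
        rw [integral_finsetSum _ fun (i : ℕ) _ => i4 i]
        refine (Finset.sum_le_sum fun (i : ℕ) _ => hC4 i).trans (le_of_eq ?_)
        simp)
    refine this.trans (le_of_eq ?_)
    field_simp
  have hsub : {ω | ¬ TameNoise α K N n b (fun i => ε i ω)} ⊆
      (⋃ j ∈ Finset.range (n + 1), (Bad f1 j ∪ Bad f2 j)) ∪ (B3 ∪ B4) := by
    intro ω hω
    by_contra hcon
    simp only [Set.mem_union, Set.mem_iUnion, not_or, not_exists] at hcon
    obtain ⟨hj, hb3, hb4⟩ := hcon
    have habs : ∀ (j k h : ℕ), (k = b j + h ∨ b j = k + h) → |(k : ℝ) - b j| = h := by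
      rintro j k h (e | e)
      · rw [e]; simp
      · rw [e]; simp
    have hdist : ∀ j k, ∃ h, k = b j + h ∨ b j = k + h := by
      intro j k
      rcases le_total (b j) k with h | h
      · exact ⟨k - b j, Or.inl (by omega)⟩
      · exact ⟨b j - k, Or.inr (by omega)⟩
    have hf : ∀ (f : ℕ → ℝ) (j k h : ℕ), k ≤ N → (k = b j + h ∨ b j = k + h) → 0 ≤ f 0 →
        ω ∉ Bad f j →
        ‖psum (fun i => ε i ω) k - psum (fun i => ε i ω) (b j)‖ ^ 2 ≤ K * f h := by
      intro f j k h hk e hf0 hnot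
      rcases Nat.eq_zero_or_pos h with rfl | hh
      · have : k = b j := by omega
        rw [this]
        simpa using mul_nonneg hK0.le hf0
      · by_contra hlt
        exact hnot ⟨h, k, hh, hk, e, not_le.1 hlt⟩
    refine hω ⟨fun j hjn k hk => ?_, fun j hjn k hk => ?_, ?_, ?_⟩
    · obtain ⟨h, e⟩ := hdist j k
      rw [habs j k h e]
      exact hf f2 j k h hk e (by simp only [f2]; positivity)
        (hj j (Finset.mem_range.2 (by omega))).2
    · obtain ⟨h, e⟩ := hdist j k
      rw [habs j k h e]
      have h5 := hf f1 j k h hk e (by simp only [f1]; positivity)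
        (hj j (Finset.mem_range.2 (by omega))).1
      have h6 : (‖psum (fun i => ε i ω) k - psum (fun i => ε i ω) (b j)‖ ^ 2) ^ 2 ≤
          (K * f1 h) ^ 2 := by gcongr
      have h7 : f1 h ^ 2 = (h : ℝ) ^ 3 := by
        simp only [f1]
        rw [← Real.rpow_natCast, ← Real.rpow_mul (Nat.cast_nonneg h), ← Real.rpow_natCast]
        norm_num
      rw [mul_pow, h7] at h6
      calc _ = (‖psum (fun i => ε i ω) k - psum (fun i => ε i ω) (b j)‖ ^ 2) ^ 2 := by ring
        _ ≤ _ := h6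
    · exact (not_le.1 hb3).le
    · intro i hi0 hiN
      have h5 := Finset.single_le_sum (f := fun i : ℕ => ‖ε i ω‖ ^ 4)
        (fun i _ => by positivity) (Finset.mem_Ioc.2 ⟨hi0, hiN⟩)
      exact h5.trans (not_le.1 hb4).le
  refine (measureReal_mono hsub (measure_ne_top _ _)).trans
    ((measureReal_union_le _ _).trans ?_)
  have h5 : P.real (⋃ j ∈ Finset.range (n + 1), (Bad f1 j ∪ Bad f2 j)) ≤
      (n + 1) * (8 * C / K * D1 + 8 * C / K * D2) := by
    refine (measureReal_biUnion_finset_le _ _).trans ?_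
    refine (Finset.sum_le_card_nsmul _ _ (8 * C / K * D1 + 8 * C / K * D2) fun j hj => ?_).trans
      (le_of_eq ?_)
    · have hjn : j ≤ n := by have := Finset.mem_range.1 hj; omega
      exact (measureReal_union_le _ _).trans (add_le_add (h1 j hjn) (h2 j hjn))
    · rw [Finset.card_range, nsmul_eq_mul]
      push_cast
      ring
  have h6 := measureReal_union_le (μ := P) B3 B4
  refine (add_le_add h5 (h6.trans (add_le_add h3 h4))).trans (le_of_eq ?_)
  field_simp
  ring

end TameProb

/-! ### The statistic as a CUSUM statistic minus a penalty -/

section Algebra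

open scoped InnerProductSpace

variable {E : Type*} [NormedAddCommGroup E] [InnerProductSpace ℝ E]

/-- The sum of squared deviations from the mean of `x_i`, `i ∈ s`. -/
def devSq (x : ℕ → E) (s : Finset ℕ) : ℝ :=
  ∑ i ∈ s, ‖x i‖ ^ 2 - ‖∑ i ∈ s, x i‖ ^ 2 / s.card

theorem sum_norm_sub_sq (x : ℕ → E) (s : Finset ℕ) (v : E) :
    ∑ i ∈ s, ‖x i - v‖ ^ 2 =
      ∑ i ∈ s, ‖x i‖ ^ 2 - 2 * ⟪∑ i ∈ s, x i, v⟫_ℝ + s.card * ‖v‖ ^ 2 := by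
  simp_rw [norm_sub_sq_real]
  rw [Finset.sum_add_distrib, Finset.sum_sub_distrib, ← Finset.mul_sum, sum_inner]
  simp

/-- The mean of `x_i`, `i ∈ s`. -/
def avg (x : ℕ → E) (s : Finset ℕ) : E := (s.card : ℝ)⁻¹ • ∑ i ∈ s, x i

theorem sum_norm_sub_avg_sq (x : ℕ → E) {s : Finset ℕ} (hs : s.Nonempty) :
    ∑ i ∈ s, ‖x i - avg x s‖ ^ 2 = devSq x s := by
  have hc : (s.card : ℝ) ≠ 0 := by
    have := hs.card_pos
    positivity
  rw [sum_norm_sub_sq, avg, inner_smul_right, real_inner_self_eq_norm_sq, norm_smul, devSq,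
    Real.norm_of_nonneg (by positivity), mul_pow]
  field_simp
  ring

theorem devSq_le (x : ℕ → E) {s : Finset ℕ} (hs : s.Nonempty) (v : E) :
    devSq x s ≤ ∑ i ∈ s, ‖x i - v‖ ^ 2 := by
  have hc : (0 : ℝ) < s.card := by
    have := hs.card_pos
    positivity
  have h : 0 ≤ ‖(s.card : ℝ)⁻¹ • ∑ i ∈ s, x i - v‖ ^ 2 := by positivity
  rw [norm_sub_sq_real, inner_smul_left, norm_smul, mul_pow, norm_inv, RCLike.norm_natCast] at h
  simp only [conj_trivial] at h
  have h2 := mul_nonneg hc.le h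
  rw [sum_norm_sub_sq, devSq]
  have e : (s.card : ℝ) * (((s.card : ℝ)⁻¹) ^ 2 * ‖∑ i ∈ s, x i‖ ^ 2
      - 2 * ((s.card : ℝ)⁻¹ * ⟪∑ i ∈ s, x i, v⟫_ℝ) + ‖v‖ ^ 2) =
      ‖∑ i ∈ s, x i‖ ^ 2 / s.card - 2 * ⟪∑ i ∈ s, x i, v⟫_ℝ + s.card * ‖v‖ ^ 2 := by
    field_simp
  linarith

theorem devSq_nonneg (x : ℕ → E) {s : Finset ℕ} (hs : s.Nonempty) : 0 ≤ devSq x s := by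
  rw [← sum_norm_sub_avg_sq x hs]
  positivity

theorem devSq_mono (x : ℕ → E) {s t : Finset ℕ} (hs : s.Nonempty) (hst : s ⊆ t) :
    devSq x s ≤ devSq x t := by
  rw [← sum_norm_sub_avg_sq x (hs.mono hst)]
  exact (devSq_le x hs _).trans
    (Finset.sum_le_sum_of_subset_of_nonneg hst fun _ _ _ => by positivity)

theorem norm_avg_sub_sq_le (x : ℕ → E) {s : Finset ℕ} (hs : s.Nonempty) {v : E} {G : ℝ}
    (hG : ∀ i ∈ s, ‖x i - v‖ ^ 2 ≤ G) : ‖avg x s - v‖ ^ 2 ≤ G := by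
  have hc : (0 : ℝ) < s.card := by
    have := hs.card_pos
    positivity
  have hG0 : 0 ≤ G := by
    obtain ⟨i, hi⟩ := hs
    exact (sq_nonneg _).trans (hG i hi)
  have e : avg x s - v = (s.card : ℝ)⁻¹ • ∑ i ∈ s, (x i - v) := by
    rw [avg, Finset.sum_sub_distrib, smul_sub, Finset.sum_const, ← Nat.cast_smul_eq_nsmul ℝ,
      smul_smul, inv_mul_cancel₀ hc.ne', one_smul]
  have h1 : ‖∑ i ∈ s, (x i - v)‖ ≤ s.card * √G := by
    refine (norm_sum_le _ _).trans ?_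
    refine (Finset.sum_le_card_nsmul _ _ (√G) fun i hi => ?_).trans (le_of_eq (nsmul_eq_mul _ _))
    exact Real.le_sqrt_of_sq_le (hG i hi)
  have h2 : ‖avg x s - v‖ ≤ √G := by
    rw [e, norm_smul, norm_inv, RCLike.norm_natCast, inv_mul_le_iff₀ hc]
    exact h1
  calc ‖avg x s - v‖ ^ 2 ≤ √G ^ 2 := by gcongr
    _ = G := Real.sq_sqrt hG0

theorem devSq_le_add (x : ℕ → E) {s t : Finset ℕ} (hs : s.Nonempty) (hst : s ⊆ t) {v : E}
    {G : ℝ} (hG : ∀ i ∈ t, ‖x i - v‖ ^ 2 ≤ G) :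
    devSq x t ≤ devSq x s + (t \ s).card * (4 * G) := by
  rw [← sum_norm_sub_avg_sq x hs]
  refine (devSq_le x (hs.mono hst) (avg x s)).trans ?_
  rw [← Finset.sum_sdiff hst, add_comm]
  gcongr
  refine (Finset.sum_le_card_nsmul _ _ (4 * G) fun i hi => ?_).trans (le_of_eq (nsmul_eq_mul _ _))
  have h1 := hG i (Finset.mem_sdiff.1 hi).1
  have h2 := norm_avg_sub_sq_le x hs fun i hi => hG i (hst hi)
  have h3 : ‖x i - avg x s‖ ≤ ‖x i - v‖ + ‖avg x s - v‖ := by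
    have e : x i - avg x s = (x i - v) - (avg x s - v) := by abel
    rw [e]
    exact norm_sub_le _ _
  have h4 : ‖x i - avg x s‖ ^ 2 ≤ (‖x i - v‖ + ‖avg x s - v‖) ^ 2 := by gcongr
  nlinarith [sq_nonneg (‖x i - v‖ - ‖avg x s - v‖)]

theorem sum_pairs_norm_sub_sq (x : ℕ → E) {ℓ k : ℕ} (h : ℓ ≤ k) :
    ∑ i ∈ Finset.Ioc ℓ k, ∑ j ∈ Finset.Ioc i k, ‖x i - x j‖ ^ 2 =
      ((k : ℝ) - ℓ) * ∑ i ∈ Finset.Ioc ℓ k, ‖x i‖ ^ 2 - ‖∑ i ∈ Finset.Ioc ℓ k, x i‖ ^ 2 := by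
  induction k, h using Nat.le_induction with
  | base => simp
  | succ k hk ih =>
    have h1 : ∑ i ∈ Finset.Ioc ℓ (k + 1), ∑ j ∈ Finset.Ioc i (k + 1), ‖x i - x j‖ ^ 2 =
        ∑ i ∈ Finset.Ioc ℓ k, ∑ j ∈ Finset.Ioc i k, ‖x i - x j‖ ^ 2 +
          ∑ i ∈ Finset.Ioc ℓ k, ‖x i - x (k + 1)‖ ^ 2 := by
      rw [Finset.sum_Ioc_succ_top hk, Finset.Ioc_self, Finset.sum_empty, add_zero,
        ← Finset.sum_add_distrib]
      refine Finset.sum_congr rfl fun i hi => ?_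
      rw [Finset.sum_Ioc_succ_top (Finset.mem_Ioc.1 hi).2]
    rw [h1, ih, sum_norm_sub_sq, Finset.sum_Ioc_succ_top hk, Finset.sum_Ioc_succ_top hk,
      norm_add_sq_real, Nat.card_Ioc, Nat.cast_sub hk]
    push_cast
    ring

theorem sum_cross_norm_sub_sq (x : ℕ → E) (s t : Finset ℕ) :
    ∑ i ∈ s, ∑ j ∈ t, ‖x i - x j‖ ^ 2 =
      t.card * ∑ i ∈ s, ‖x i‖ ^ 2 + s.card * ∑ j ∈ t, ‖x j‖ ^ 2
        - 2 * ⟪∑ i ∈ s, x i, ∑ j ∈ t, x j⟫_ℝ := by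
  have h : ∀ i, ∑ j ∈ t, ‖x i - x j‖ ^ 2 =
      ∑ j ∈ t, ‖x j‖ ^ 2 - 2 * ⟪x i, ∑ j ∈ t, x j⟫_ℝ + t.card * ‖x i‖ ^ 2 := fun i => by
    rw [real_inner_comm, ← sum_norm_sub_sq]
    exact Finset.sum_congr rfl fun j _ => by rw [norm_sub_rev]
  simp_rw [h]
  rw [Finset.sum_add_distrib, Finset.sum_sub_distrib, ← Finset.mul_sum, ← Finset.mul_sum,
    ← sum_inner, Finset.sum_const, nsmul_eq_mul]
  ring

/-- The CUSUM process `∑_{ℓ<i≤k} x_i - (k-ℓ)/(u-ℓ) ∑_{ℓ<i≤u} x_i` of a subsample. -/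
def cusum (x : ℕ → E) (ℓ u k : ℕ) : E :=
  (psum x k - psum x ℓ) - (((k : ℝ) - ℓ) / ((u : ℝ) - ℓ)) • (psum x u - psum x ℓ)

/-- The proportion `(k-ℓ)(u-k)/(u-ℓ)²`. -/
def splitRatio (ℓ u k : ℕ) : ℝ := (((k : ℝ) - ℓ) * ((u : ℝ) - k)) / ((u : ℝ) - ℓ) ^ 2

/-- The weighted CUSUM statistic; it vanishes at the end points, where numerator and denominator
are zero. -/
def cusumStat (α : ℝ) (x : ℕ → E) (ℓ u k : ℕ) : ℝ :=
  ‖cusum x ℓ u k‖ ^ 2 / (((u : ℝ) - ℓ) * splitRatio ℓ u k ^ α)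

/-- The penalty which the weighted statistic subtracts from the weighted CUSUM statistic. -/
def penalty (α : ℝ) (x : ℕ → E) (ℓ u k : ℕ) : ℝ :=
  ((u : ℝ) - ℓ) * splitRatio ℓ u k ^ (2 - α) / (((k : ℝ) - ℓ) * ((k : ℝ) - ℓ - 1)) *
      devSq x (Finset.Ioc ℓ k) +
    ((u : ℝ) - ℓ) * splitRatio ℓ u k ^ (2 - α) / (((u : ℝ) - k) * ((u : ℝ) - k - 1)) *
      devSq x (Finset.Ioc k u)

/-- The double sums of the energy statistic reduce to sums of squares and squared norms of sums; the
U-statistic normalization of the within terms leaves the penalty as its only bias. -/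
theorem weightedStat_eq (α : ℝ) (x : ℕ → E) {ℓ u k : ℕ} (h1 : ℓ + 2 ≤ k) (h2 : k + 2 ≤ u) :
    weightedStat α x ℓ u k = cusumStat α x ℓ u k - penalty α x ℓ u k := by
  have hk1 : (ℓ : ℝ) + 2 ≤ k := by exact_mod_cast h1
  have hk2 : (k : ℝ) + 2 ≤ u := by exact_mod_cast h2
  obtain ⟨m, hm⟩ : ∃ m : ℝ, m = (k : ℝ) - ℓ := ⟨_, rfl⟩
  obtain ⟨n, hn⟩ : ∃ n : ℝ, n = (u : ℝ) - k := ⟨_, rfl⟩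
  have hL : (u : ℝ) - ℓ = m + n := by rw [hm, hn]; ring
  have hm2 : 2 ≤ m := by linarith
  have hn2 : 2 ≤ n := by linarith
  have hm0 : 0 < m := by linarith
  have hn0 : 0 < n := by linarith
  have hm1 : m - 1 ≠ 0 := by linarith
  have hn1 : n - 1 ≠ 0 := by linarith
  have hcm : ((k - ℓ : ℕ) : ℝ) = m := by rw [Nat.cast_sub (by omega), hm]
  have hcn : ((u - k : ℕ) : ℝ) = n := by rw [Nat.cast_sub (by omega), hn]
  set SA := ∑ i ∈ Finset.Ioc ℓ k, x i with hSA
  set SB := ∑ i ∈ Finset.Ioc k u, x i with hSB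
  have hP : cusum x ℓ u k = (n / (m + n)) • SA - (m / (m + n)) • SB := by
    have e1 : psum x u - psum x ℓ = SA + SB := by
      rw [psum_sub_psum x (by omega), Finset.sum_Ioc_consecutive x (by omega) (by omega)]
    rw [cusum, psum_sub_psum x (by omega : ℓ ≤ k), e1, hL, ← hm, ← hSA]
    have e2 : n / (m + n) = 1 - m / (m + n) := by field_simp; ring
    rw [e2]
    module
  have hP2 : (m + n) ^ 2 * ‖cusum x ℓ u k‖ ^ 2 =
      n ^ 2 * ‖SA‖ ^ 2 - 2 * (m * n) * ⟪SA, SB⟫_ℝ + m ^ 2 * ‖SB‖ ^ 2 := by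
    rw [hP, norm_sub_sq_real, norm_smul, norm_smul, inner_smul_left, inner_smul_right,
      Real.norm_of_nonneg (by positivity), Real.norm_of_nonneg (by positivity)]
    simp only [conj_trivial]
    field_simp
  have hs0 : 0 < m * n / (m + n) ^ 2 := by positivity
  have hsr : splitRatio ℓ u k = m * n / (m + n) ^ 2 := by
    rw [splitRatio, hL, ← hm, ← hn]
  have hpow : (m * n / (m + n) ^ 2) ^ (2 - α) * (m * n / (m + n) ^ 2) ^ α =
      (m * n / (m + n) ^ 2) ^ 2 := by
    rw [← Real.rpow_add hs0, sub_add_cancel, Real.rpow_two]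
  have hpα : 0 < (m * n / (m + n) ^ 2) ^ α := Real.rpow_pos_of_pos hs0 _
  have hY : cusumStat α x ℓ u k = (m * n / (m + n) ^ 2) ^ (2 - α) *
      ((m + n) * ((m + n) ^ 2 * ‖cusum x ℓ u k‖ ^ 2) / (m * n) ^ 2) := by
    rw [cusumStat, hsr, hL, div_eq_iff (by positivity)]
    calc ‖cusum x ℓ u k‖ ^ 2 = (m * n / (m + n) ^ 2) ^ 2 *
          ((m + n) * ((m + n) ^ 2 * ‖cusum x ℓ u k‖ ^ 2) / (m * n) ^ 2) * (m + n) := by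
          field_simp
      _ = _ := by rw [← hpow]; ring
  rw [hY, hP2, weightedStat, energyStat, penalty, sum_cross_norm_sub_sq,
    sum_pairs_norm_sub_sq x (by omega : ℓ ≤ k), sum_pairs_norm_sub_sq x (by omega : k ≤ u),
    Nat.cast_choose_two, Nat.cast_choose_two, Nat.card_Ioc, Nat.card_Ioc, hcm, hcn, hL, hsr,
    devSq, devSq, Nat.card_Ioc, Nat.card_Ioc, hcm, hcn, ← hm, ← hn, ← hSA, ← hSB]
  field_simp
  ring

end Algebra

/-! ### Bounds for the penalty -/

section Penalty

variable {E : Type*} [NormedAddCommGroup E] [InnerProductSpace ℝ E]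

/-- A penalty weight changes at most by a factor `1 + O(|m-m'| / L)`, uniformly away from the ends. -/
theorem penaltyWeight_le_mul {α γ L m n m' n' h : ℝ} (hα0 : 0 < α) (hα1 : α < 2)
    (hγ0 : 0 < γ) (hL : 2 ≤ γ * L) (hmn : m + n = L) (hmn' : m' + n' = L)
    (hm : γ * L ≤ m) (hn : γ * L ≤ n) (hm' : γ * L ≤ m') (hn' : γ * L ≤ n')
    (hh : |m - m'| ≤ h) (hhL : h ≤ L) :
    L * (m' * n' / L ^ 2) ^ (2 - α) / (m' * (m' - 1)) ≤
      L * (m * n / L ^ 2) ^ (2 - α) / (m * (m - 1)) * (1 + 240 * γ⁻¹ ^ 4 * (h / L)) := by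
  have hL0 : 0 < L := by
    by_contra hcon
    have := mul_nonpos_of_nonneg_of_nonpos hγ0.le (not_lt.1 hcon)
    linarith
  have hγ1 : γ ≤ 1 := by
    by_contra hcon
    nlinarith [not_le.1 hcon]
  have hm0 : 0 < m := by linarith
  have hn0 : 0 < n := by linarith
  have hm0' : 0 < m' := by linarith
  have hn0' : 0 < n' := by linarith
  have hh0 : 0 ≤ h := (abs_nonneg _).trans hh
  obtain ⟨hh1, hh2⟩ := abs_le.1 hh
  -- `x` bounds all the relative increments
  set x := 2 * h / (γ * L) with hx
  have hx0 : 0 ≤ x := by positivity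
  have hxL : x * (γ * L) = 2 * h := by rw [hx]; field_simp
  have hxm : ∀ y, γ * L ≤ y → 2 * h ≤ x * y := fun y hy => by
    rw [← hxL]
    exact mul_le_mul_of_nonneg_left hy hx0
  have e1 : m' * n' ≤ m * n * (1 + x) := by
    have h1 := hxm m hm
    have h2 := hxm n hn
    rcases le_total m m' with hle | hle
    · have h3 : m' ≤ m * (1 + x) := by linarith
      have h4 : n' ≤ n := by linarith
      calc m' * n' ≤ (m * (1 + x)) * n := by gcongr
        _ = _ := by ring
    · have h3 : n' ≤ n * (1 + x) := by linarith
      calc m' * n' ≤ m * (n * (1 + x)) := by gcongr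
        _ = _ := by ring
  have e2 : m * (m - 1) ≤ m' * (m' - 1) * (1 + x) ^ 2 := by
    have h1 := hxm m' hm'
    have h2 : m ≤ m' * (1 + x) := by linarith
    have h3 : m - 1 ≤ (m' - 1) * (1 + x) := by
      -- `m' - 1 ≥ γ L / 2`
      have h5 : γ * L / 2 ≤ m' - 1 := by linarith
      have h6 : x * (γ * L / 2) ≤ x * (m' - 1) := mul_le_mul_of_nonneg_left h5 hx0
      linarith
    calc m * (m - 1) ≤ (m' * (1 + x)) * ((m' - 1) * (1 + x)) :=
          mul_le_mul h2 h3 (by linarith) (by positivity)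
      _ = _ := by ring
  have hp0 : 0 < m * n / L ^ 2 := by positivity
  have e3 : (m' * n' / L ^ 2) ^ (2 - α) ≤ (m * n / L ^ 2) ^ (2 - α) * (1 + x) ^ 2 := by
    have h1 : m' * n' / L ^ 2 ≤ m * n / L ^ 2 * (1 + x) := by
      rw [div_mul_eq_mul_div]
      gcongr
    calc (m' * n' / L ^ 2) ^ (2 - α) ≤ (m * n / L ^ 2 * (1 + x)) ^ (2 - α) :=
          Real.rpow_le_rpow (by positivity) h1 (by linarith)
      _ = (m * n / L ^ 2) ^ (2 - α) * (1 + x) ^ (2 - α) :=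
          Real.mul_rpow hp0.le (by positivity)
      _ ≤ _ := by
          gcongr
          rw [← Real.rpow_two]
          exact Real.rpow_le_rpow_of_exponent_le (by linarith) (by linarith)
  have e4 : (1 + x) ^ 4 ≤ 1 + 240 * γ⁻¹ ^ 4 * (h / L) := by
    have hX : x ≤ 2 * γ⁻¹ := by
      rw [hx, div_le_iff₀ (by positivity)]
      have : 2 * γ⁻¹ * (γ * L) = 2 * L := by field_simp
      linarith
    have hg1 : 1 ≤ γ⁻¹ := (one_le_inv₀ hγ0).2 hγ1
    have e5 : 240 * γ⁻¹ ^ 4 * (h / L) = 120 * γ⁻¹ ^ 3 * x := by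
      rw [hx]; field_simp; ring
    rw [e5]
    have e6 : (1 + x) ^ 4 = 1 + x * (4 + 6 * x + 4 * x ^ 2 + x ^ 3) := by ring
    rw [e6]
    have e7 : 4 + 6 * x + 4 * x ^ 2 + x ^ 3 ≤ 120 * γ⁻¹ ^ 3 := by
      have hx2 : x ^ 2 ≤ (2 * γ⁻¹) ^ 2 := by gcongr
      have hx3 : x ^ 3 ≤ (2 * γ⁻¹) ^ 3 := by gcongr
      have g1 : γ⁻¹ ≤ γ⁻¹ ^ 3 := le_self_pow₀ hg1 (by norm_num)
      have g2 : γ⁻¹ ^ 2 ≤ γ⁻¹ ^ 3 := pow_le_pow_right₀ hg1 (by norm_num)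
      rw [mul_pow] at hx2 hx3
      linarith
    linarith [mul_le_mul_of_nonneg_left e7 hx0]
  have hden : 0 < m * (m - 1) := mul_pos hm0 (by linarith)
  have hden' : 0 < m' * (m' - 1) := mul_pos hm0' (by linarith)
  have hpp : 0 < (m * n / L ^ 2) ^ (2 - α) := Real.rpow_pos_of_pos hp0 _
  calc L * (m' * n' / L ^ 2) ^ (2 - α) / (m' * (m' - 1))
      ≤ L * ((m * n / L ^ 2) ^ (2 - α) * (1 + x) ^ 2) / (m' * (m' - 1)) := by gcongr
    _ ≤ L * (m * n / L ^ 2) ^ (2 - α) / (m * (m - 1)) * (1 + x) ^ 4 := by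
        rw [div_mul_eq_mul_div, div_le_div_iff₀ hden' hden]
        have h1 : 0 ≤ L * (m * n / L ^ 2) ^ (2 - α) * (1 + x) ^ 2 := by positivity
        linarith [mul_le_mul_of_nonneg_left e2 h1]
    _ ≤ _ := by gcongr

theorem penaltyWeight_le {α γ L m n : ℝ} (hα1 : α < 2)
    (hγ0 : 0 < γ) (hL : 2 ≤ γ * L) (hmn : m + n = L) (hm : γ * L ≤ m) (hn : γ * L ≤ n) :
    L * (m * n / L ^ 2) ^ (2 - α) / (m * (m - 1)) ≤ 2 * γ⁻¹ ^ 2 / L := by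
  have hm0 : 0 < m := by linarith
  have hn0 : 0 < n := by linarith
  have hL0 : 0 < L := by linarith
  have hp1 : m * n / L ^ 2 ≤ 1 := by
    rw [div_le_one (by positivity), ← hmn]
    nlinarith
  have h1 : (m * n / L ^ 2) ^ (2 - α) ≤ 1 := Real.rpow_le_one (by positivity) hp1 (by linarith)
  have hm2 : (γ * L) ^ 2 / 2 ≤ m * (m - 1) := by
    have h2 : γ * L / 2 ≤ m - 1 := by linarith
    calc (γ * L) ^ 2 / 2 = (γ * L) * (γ * L / 2) := by ring
      _ ≤ _ := mul_le_mul hm h2 (by linarith) hm0.le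
  calc L * (m * n / L ^ 2) ^ (2 - α) / (m * (m - 1)) ≤ L * 1 / ((γ * L) ^ 2 / 2) := by
        gcongr
    _ = _ := by field_simp

theorem penaltyWeight_nonneg {α L m n : ℝ} (hL : 0 ≤ L) (hm : 1 ≤ m) (hn : 0 ≤ n) :
    0 ≤ L * (m * n / L ^ 2) ^ (2 - α) / (m * (m - 1)) :=
  div_nonneg (by positivity) (mul_nonneg (by linarith) (by linarith))

theorem penalty_nonneg (α : ℝ) (x : ℕ → E) {ℓ u k : ℕ} (h1 : ℓ + 2 ≤ k) (h2 : k + 2 ≤ u) :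
    0 ≤ penalty α x ℓ u k := by
  have hk1 : (ℓ : ℝ) + 2 ≤ k := by exact_mod_cast h1
  have hk2 : (k : ℝ) + 2 ≤ u := by exact_mod_cast h2
  have w1 := penaltyWeight_nonneg (α := α) (L := (u : ℝ) - ℓ) (m := (k : ℝ) - ℓ)
    (n := (u : ℝ) - k) (by linarith) (by linarith) (by linarith)
  have w2 := penaltyWeight_nonneg (α := α) (L := (u : ℝ) - ℓ) (m := (u : ℝ) - k)
    (n := (k : ℝ) - ℓ) (by linarith) (by linarith) (by linarith)
  rw [mul_comm ((u : ℝ) - k) ((k : ℝ) - ℓ)] at w2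
  exact add_nonneg (mul_nonneg w1 (devSq_nonneg x (Finset.nonempty_Ioc.2 (by omega))))
    (mul_nonneg w2 (devSq_nonneg x (Finset.nonempty_Ioc.2 (by omega))))

/-- The penalty is of the order of the mean squared deviation. -/
theorem penalty_le {α γ : ℝ} (hα1 : α < 2) (hγ0 : 0 < γ) (x : ℕ → E) {ℓ u k : ℕ}
    (hL : 2 ≤ γ * ((u : ℝ) - ℓ)) (h1 : γ * ((u : ℝ) - ℓ) ≤ (k : ℝ) - ℓ)
    (h2 : γ * ((u : ℝ) - ℓ) ≤ (u : ℝ) - k) {v : E} {H : ℝ}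
    (hH : ∑ i ∈ Finset.Ioc ℓ u, ‖x i - v‖ ^ 2 ≤ H) :
    penalty α x ℓ u k ≤ 2 * γ⁻¹ ^ 2 * (H / ((u : ℝ) - ℓ)) := by
  have hk1 : ℓ < k := by
    have : (ℓ : ℝ) < k := by linarith
    exact_mod_cast this
  have hk2 : k < u := by
    have : (k : ℝ) < u := by linarith
    exact_mod_cast this
  have w1 := penaltyWeight_le (α := α) hα1 hγ0 hL (by ring) h1 h2
  have w2 := penaltyWeight_le (α := α) hα1 hγ0 hL (by ring) h2 h1
  rw [mul_comm ((u : ℝ) - k) ((k : ℝ) - ℓ)] at w2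
  have d1 := devSq_le x (Finset.nonempty_Ioc.2 hk1) v
  have d2 := devSq_le x (Finset.nonempty_Ioc.2 hk2) v
  have n1 := devSq_nonneg x (Finset.nonempty_Ioc.2 hk1)
  have n2 := devSq_nonneg x (Finset.nonempty_Ioc.2 hk2)
  have hs := Finset.sum_Ioc_consecutive (fun i => ‖x i - v‖ ^ 2) hk1.le hk2.le
  have hL0 : 0 < (u : ℝ) - ℓ := by linarith
  calc penalty α x ℓ u k ≤ 2 * γ⁻¹ ^ 2 / ((u : ℝ) - ℓ) * devSq x (Finset.Ioc ℓ k) +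
        2 * γ⁻¹ ^ 2 / ((u : ℝ) - ℓ) * devSq x (Finset.Ioc k u) :=
        add_le_add (mul_le_mul_of_nonneg_right w1 n1) (mul_le_mul_of_nonneg_right w2 n2)
    _ = 2 * γ⁻¹ ^ 2 / ((u : ℝ) - ℓ) *
        (devSq x (Finset.Ioc ℓ k) + devSq x (Finset.Ioc k u)) := by ring
    _ ≤ 2 * γ⁻¹ ^ 2 / ((u : ℝ) - ℓ) * H := by
        gcongr
        linarith
    _ = _ := by ring

/-- The increments of the penalty are small compared with those of the signal. -/
theorem penalty_le_add {α γ : ℝ} (hα0 : 0 < α) (hα1 : α < 2) (hγ0 : 0 < γ) (x : ℕ → E)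
    {ℓ u k k' : ℕ} (hL : 2 ≤ γ * ((u : ℝ) - ℓ)) (h1 : γ * ((u : ℝ) - ℓ) ≤ (k : ℝ) - ℓ)
    (h2 : γ * ((u : ℝ) - ℓ) ≤ (u : ℝ) - k) (h1' : γ * ((u : ℝ) - ℓ) ≤ (k' : ℝ) - ℓ)
    (h2' : γ * ((u : ℝ) - ℓ) ≤ (u : ℝ) - k') {v : E} {G H : ℝ}
    (hG : ∀ i ∈ Finset.Ioc ℓ u, ‖x i - v‖ ^ 2 ≤ G)
    (hH : ∑ i ∈ Finset.Ioc ℓ u, ‖x i - v‖ ^ 2 ≤ H) :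
    penalty α x ℓ u k' ≤ penalty α x ℓ u k +
      1000 * γ⁻¹ ^ 6 * (|(k : ℝ) - k'| / ((u : ℝ) - ℓ)) * (G + H / ((u : ℝ) - ℓ)) := by
  have hk1 : ℓ < k := by
    have : (ℓ : ℝ) < k := by linarith
    exact_mod_cast this
  have hk2 : k < u := by
    have : (k : ℝ) < u := by linarith
    exact_mod_cast this
  have hk1' : ℓ < k' := by
    have : (ℓ : ℝ) < k' := by linarith
    exact_mod_cast this
  have hk2' : k' < u := by
    have : (k' : ℝ) < u := by linarith
    exact_mod_cast this
  set L := (u : ℝ) - ℓ with hLdef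
  have hL0 : 0 < L := by linarith
  have hγ1 : γ ≤ 1 := by
    by_contra hcon
    nlinarith [not_le.1 hcon]
  have hg1 : 1 ≤ γ⁻¹ := (one_le_inv₀ hγ0).2 hγ1
  set h := |(k : ℝ) - k'| with hh
  have hh0 : 0 ≤ h := abs_nonneg _
  have hhL : h ≤ L := by
    rw [hh, abs_le]
    constructor <;> linarith
  have hG0 : 0 ≤ G := (sq_nonneg _).trans (hG u (Finset.mem_Ioc.2 ⟨by omega, le_rfl⟩))
  have hH0 : 0 ≤ H := le_trans (Finset.sum_nonneg fun _ _ => by positivity) hH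
  -- one of the two halves
  have half : ∀ (m n m' n' : ℝ) (s t : Finset ℕ), s.Nonempty → t.Nonempty →
      s ⊆ Finset.Ioc ℓ u → t ⊆ Finset.Ioc ℓ u → m + n = L → m' + n' = L → γ * L ≤ m →
      γ * L ≤ n → γ * L ≤ m' → γ * L ≤ n' → |m - m'| ≤ h →
      devSq x t ≤ devSq x s + h * (4 * G) →
      L * (m' * n' / L ^ 2) ^ (2 - α) / (m' * (m' - 1)) * devSq x t ≤
        L * (m * n / L ^ 2) ^ (2 - α) / (m * (m - 1)) * devSq x s +
          500 * γ⁻¹ ^ 6 * (h / L) * (G + H / L) := by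
    intro m n m' n' s t hs ht hsu htu hmn hmn' hm hn hm' hn' hmm hst
    have w1 := penaltyWeight_le_mul hα0 hα1 hγ0 hL hmn hmn' hm hn hm' hn' hmm hhL
    have w2 := penaltyWeight_le (α := α) hα1 hγ0 hL hmn hm hn
    have w3 := penaltyWeight_le (α := α) hα1 hγ0 hL hmn' hm' hn'
    have w0 := penaltyWeight_nonneg (α := α) (L := L) (m := m) (n := n) hL0.le (by linarith)
      (by linarith)
    have w0' := penaltyWeight_nonneg (α := α) (L := L) (m := m') (n := n') hL0.le (by linarith)
      (by linarith)
    set w := L * (m * n / L ^ 2) ^ (2 - α) / (m * (m - 1)) with hw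
    set w' := L * (m' * n' / L ^ 2) ^ (2 - α) / (m' * (m' - 1)) with hw'
    have ds0 := devSq_nonneg x hs
    have dsH : devSq x s ≤ H := (devSq_le x hs v).trans
      ((Finset.sum_le_sum_of_subset_of_nonneg hsu fun _ _ _ => by positivity).trans hH)
    have g3 : γ⁻¹ ^ 2 ≤ γ⁻¹ ^ 6 := pow_le_pow_right₀ hg1 (by norm_num)
    calc w' * devSq x t ≤ w' * (devSq x s + h * (4 * G)) :=
          mul_le_mul_of_nonneg_left hst w0'
      _ = w' * devSq x s + w' * (h * (4 * G)) := by ring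
      _ ≤ w * (1 + 240 * γ⁻¹ ^ 4 * (h / L)) * devSq x s +
          2 * γ⁻¹ ^ 2 / L * (h * (4 * G)) := by gcongr
      _ = w * devSq x s + 240 * γ⁻¹ ^ 4 * (h / L) * (w * devSq x s) +
          8 * γ⁻¹ ^ 2 * (h / L) * G := by ring
      _ ≤ w * devSq x s + 240 * γ⁻¹ ^ 4 * (h / L) * (2 * γ⁻¹ ^ 2 / L * H) +
          500 * γ⁻¹ ^ 6 * (h / L) * G := by
          gcongr
          norm_num
      _ = w * devSq x s + 480 * γ⁻¹ ^ 6 * (h / L) * (H / L) +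
          500 * γ⁻¹ ^ 6 * (h / L) * G := by ring
      _ ≤ w * devSq x s + 500 * γ⁻¹ ^ 6 * (h / L) * (H / L) +
          500 * γ⁻¹ ^ 6 * (h / L) * G := by
          gcongr
          norm_num
      _ = _ := by ring
  have hGI : ∀ {s : Finset ℕ}, s ⊆ Finset.Ioc ℓ u → ∀ i ∈ s, ‖x i - v‖ ^ 2 ≤ G :=
    fun hs i hi => hG i (hs hi)
  have hsubl : ∀ {q}, q ≤ u → Finset.Ioc ℓ q ⊆ Finset.Ioc ℓ u := fun hq =>
    Finset.Ioc_subset_Ioc_right hq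
  have hsubr : ∀ {q}, ℓ ≤ q → Finset.Ioc q u ⊆ Finset.Ioc ℓ u := fun hq =>
    Finset.Ioc_subset_Ioc_left hq
  have hdev : ∀ {s t : Finset ℕ}, s.Nonempty → t.Nonempty → t ⊆ Finset.Ioc ℓ u →
      (s ⊆ t ∧ ((t \ s).card : ℝ) ≤ h) ∨ t ⊆ s → devSq x t ≤ devSq x s + h * (4 * G) := by
    rintro s t hs ht htu (⟨hst, hc⟩ | hts)
    · refine (devSq_le_add x hs hst (hGI htu)).trans ?_
      gcongr
    · have := devSq_mono x ht hts
      have : 0 ≤ h * (4 * G) := by positivity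
      linarith
  have hA := half ((k : ℝ) - ℓ) ((u : ℝ) - k) ((k' : ℝ) - ℓ) ((u : ℝ) - k') (Finset.Ioc ℓ k)
    (Finset.Ioc ℓ k') (Finset.nonempty_Ioc.2 hk1) (Finset.nonempty_Ioc.2 hk1')
    (hsubl hk2.le) (hsubl hk2'.le) (by rw [hLdef]; ring) (by rw [hLdef]; ring) h1 h2 h1' h2'
    (by rw [hh]; apply le_of_eq; congr 1; ring)
    (hdev (Finset.nonempty_Ioc.2 hk1) (Finset.nonempty_Ioc.2 hk1') (hsubl hk2'.le) (by
      rcases le_total k k' with hkk | hkk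
      · refine Or.inl ⟨Finset.Ioc_subset_Ioc_right hkk, ?_⟩
        have hc : (Finset.Ioc ℓ k' \ Finset.Ioc ℓ k).card = k' - k := by
          rw [Finset.card_sdiff_of_subset (Finset.Ioc_subset_Ioc_right hkk), Nat.card_Ioc,
            Nat.card_Ioc]
          omega
        rw [hc, Nat.cast_sub hkk, hh, abs_sub_comm]
        exact le_abs_self _
      · exact Or.inr (Finset.Ioc_subset_Ioc_right hkk)))
  have hB := half ((u : ℝ) - k) ((k : ℝ) - ℓ) ((u : ℝ) - k') ((k' : ℝ) - ℓ) (Finset.Ioc k u)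
    (Finset.Ioc k' u) (Finset.nonempty_Ioc.2 hk2) (Finset.nonempty_Ioc.2 hk2')
    (hsubr hk1.le) (hsubr hk1'.le) (by rw [hLdef]; ring) (by rw [hLdef]; ring) h2 h1 h2' h1'
    (by rw [hh, abs_sub_comm]; apply le_of_eq; congr 1; ring)
    (hdev (Finset.nonempty_Ioc.2 hk2) (Finset.nonempty_Ioc.2 hk2') (hsubr hk1'.le) (by
      rcases le_total k k' with hkk | hkk
      · exact Or.inr (Finset.Ioc_subset_Ioc_left hkk)
      · refine Or.inl ⟨Finset.Ioc_subset_Ioc_left hkk, ?_⟩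
        have hc : (Finset.Ioc k' u \ Finset.Ioc k u).card = k - k' := by
          rw [Finset.card_sdiff_of_subset (Finset.Ioc_subset_Ioc_left hkk), Nat.card_Ioc,
            Nat.card_Ioc]
          omega
        rw [hc, Nat.cast_sub hkk, hh]
        exact le_abs_self _))
  rw [mul_comm ((u : ℝ) - k) ((k : ℝ) - ℓ), mul_comm ((u : ℝ) - k') ((k' : ℝ) - ℓ)] at hB
  have e : 1000 * γ⁻¹ ^ 6 * (h / L) * (G + H / L) = 500 * γ⁻¹ ^ 6 * (h / L) * (G + H / L) +
      500 * γ⁻¹ ^ 6 * (h / L) * (G + H / L) := by ring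
  rw [e]
  simp only [penalty, splitRatio, ← hLdef]
  linarith

end Penalty

/-! ### Quantitative convexity of the weighted CUSUM statistic between breaks -/

section Convexity

variable {E : Type*} [NormedAddCommGroup E] [InnerProductSpace ℝ E]

theorem two_rpow_sub_one_pos {α : ℝ} (hα : 0 < α) : 0 < (2 : ℝ) ^ α - 1 := by
  have := Real.one_lt_rpow (by norm_num : (1 : ℝ) < 2) hα
  linarith

theorem two_rpow_sub_one_le {α : ℝ} (hα : α ≤ 1) : (2 : ℝ) ^ α - 1 ≤ 1 := by
  have := Real.rpow_le_rpow_of_exponent_le (by norm_num : (1 : ℝ) ≤ 2) hα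
  rw [Real.rpow_one] at this
  linarith

/-- Strict concavity of `(t(1-t))^α`: adding `y` to a convex combination of values in `[0, 1/4]`
raises the power by a definite factor. -/
theorem rpow_combination_mul_le {α t pa pb y : ℝ} (hα0 : 0 < α) (hα1 : α ≤ 1) (ht0 : 0 ≤ t)
    (ht1 : t ≤ 1) (hpa : 0 ≤ pa) (hpb : 0 ≤ pb) (hy : 0 ≤ y)
    (hp : (1 - t) * pa + t * pb + y ≤ 1 / 4) :
    (1 + (2 ^ α - 1) * (4 * y)) * ((1 - t) * pa ^ α + t * pb ^ α) ≤
      ((1 - t) * pa + t * pb + y) ^ α := by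
  set p := (1 - t) * pa + t * pb with hpdef
  have ht : 0 ≤ 1 - t := by linarith
  have hp0 : 0 ≤ p := by positivity
  have hconc := Real.concaveOn_rpow hα0.le hα1
  have h1 : (1 - t) * pa ^ α + t * pb ^ α ≤ p ^ α := by
    have := hconc.2 (Set.mem_Ici.2 hpa) (Set.mem_Ici.2 hpb) ht ht0 (by ring)
    simpa [smul_eq_mul] using this
  have h2 : 1 + (2 ^ α - 1) * (4 * y) ≤ (1 + 4 * y) ^ α := by
    have := hconc.2 (Set.mem_Ici.2 (zero_le_one : (0 : ℝ) ≤ 1))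
      (Set.mem_Ici.2 (zero_le_two : (0 : ℝ) ≤ 2)) (by linarith : (0 : ℝ) ≤ 1 - 4 * y)
      (by linarith : (0 : ℝ) ≤ 4 * y) (by ring)
    simp only [smul_eq_mul, Real.one_rpow] at this
    have e : (1 - 4 * y) * 1 + 4 * y * 2 = 1 + 4 * y := by ring
    rw [e] at this
    linarith
  have h3 : (1 + 4 * y) * p ≤ p + y := by nlinarith
  calc (1 + (2 ^ α - 1) * (4 * y)) * ((1 - t) * pa ^ α + t * pb ^ α)
      ≤ (1 + 4 * y) ^ α * p ^ α := by
        refine mul_le_mul h2 h1 ?_ (by positivity)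
        have := Real.rpow_nonneg hpa α
        have := Real.rpow_nonneg hpb α
        positivity
    _ = ((1 + 4 * y) * p) ^ α := (Real.mul_rpow (by positivity) hp0).symm
    _ ≤ (p + y) ^ α := Real.rpow_le_rpow (by positivity) h3 hα0.le

/-- Joint convexity of `(P, s) ↦ ‖P‖² / s`, without division. -/
theorem norm_combination_sq_le {t sa sb ya yb : ℝ} {Pa Pb : E} (ht0 : 0 ≤ t) (ht1 : t ≤ 1)
    (hsa : 0 ≤ sa) (hsb : 0 ≤ sb) (hya : 0 ≤ ya) (hyb : 0 ≤ yb) (ha : ‖Pa‖ ^ 2 ≤ sa * ya)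
    (hb : ‖Pb‖ ^ 2 ≤ sb * yb) :
    ‖(1 - t) • Pa + t • Pb‖ ^ 2 ≤ ((1 - t) * sa + t * sb) * ((1 - t) * ya + t * yb) := by
  have ht : 0 ≤ 1 - t := by linarith
  have hab : 2 * (‖Pa‖ * ‖Pb‖) ≤ sa * yb + sb * ya := by
    have h1 : (‖Pa‖ * ‖Pb‖) ^ 2 ≤ (sa * yb) * (sb * ya) := by
      rw [mul_pow]
      calc ‖Pa‖ ^ 2 * ‖Pb‖ ^ 2 ≤ (sa * ya) * (sb * yb) := by gcongr
        _ = _ := by ring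
    have h2 : (2 * (‖Pa‖ * ‖Pb‖)) ^ 2 ≤ (sa * yb + sb * ya) ^ 2 := by
      nlinarith [sq_nonneg (sa * yb - sb * ya)]
    exact le_of_sq_le_sq h2 (by positivity)
  have h3 : ‖(1 - t) • Pa + t • Pb‖ ≤ (1 - t) * ‖Pa‖ + t * ‖Pb‖ := by
    refine (norm_add_le _ _).trans (le_of_eq ?_)
    rw [norm_smul, norm_smul, Real.norm_of_nonneg ht, Real.norm_of_nonneg ht0]
  calc ‖(1 - t) • Pa + t • Pb‖ ^ 2 ≤ ((1 - t) * ‖Pa‖ + t * ‖Pb‖) ^ 2 := by gcongr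
    _ = (1 - t) ^ 2 * ‖Pa‖ ^ 2 + (1 - t) * t * (2 * (‖Pa‖ * ‖Pb‖)) + t ^ 2 * ‖Pb‖ ^ 2 := by ring
    _ ≤ (1 - t) ^ 2 * (sa * ya) + (1 - t) * t * (sa * yb + sb * ya) + t ^ 2 * (sb * yb) := by
        gcongr
    _ = _ := by ring

/-- How far the partial sum at `k` is from the chord through the partial sums at `p` and `p'`. -/
def chordDefect (x : ℕ → E) (p p' k : ℕ) : E :=
  psum x k - ((1 - ((k : ℝ) - p) / ((p' : ℝ) - p)) • psum x p +
    (((k : ℝ) - p) / ((p' : ℝ) - p)) • psum x p')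

theorem cusum_eq_combination (x : ℕ → E) {ℓ u p p' k : ℕ} (hp : (p' : ℝ) - p ≠ 0)  :
    cusum x ℓ u k = (1 - ((k : ℝ) - p) / ((p' : ℝ) - p)) • cusum x ℓ u p +
      (((k : ℝ) - p) / ((p' : ℝ) - p)) • cusum x ℓ u p' + chordDefect x p p' k := by
  obtain ⟨t, ht⟩ : ∃ t : ℝ, t = ((k : ℝ) - p) / ((p' : ℝ) - p) := ⟨_, rfl⟩
  have hk : (k : ℝ) = p + t * ((p' : ℝ) - p) := by rw [ht]; field_simp; ring
  simp only [cusum, chordDefect]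
  rw [← ht]
  have e : ((k : ℝ) - ℓ) / ((u : ℝ) - ℓ) =
      (1 - t) * (((p : ℝ) - ℓ) / ((u : ℝ) - ℓ)) + t * (((p' : ℝ) - ℓ) / ((u : ℝ) - ℓ)) := by
    rw [hk]
    ring
  rw [e]
  module

theorem cusum_left (x : ℕ → E) (ℓ u : ℕ) : cusum x ℓ u ℓ = 0 := by simp [cusum]

theorem cusum_right (x : ℕ → E) {ℓ u : ℕ} (h : ℓ < u) : cusum x ℓ u u = 0 := by
  have : (u : ℝ) - ℓ ≠ 0 := by
    have : (ℓ : ℝ) < u := by exact_mod_cast h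
    linarith
  simp [cusum, div_self this]

theorem splitRatio_nonneg {ℓ u k : ℕ} (h1 : ℓ ≤ k) (h2 : k ≤ u) : 0 ≤ splitRatio ℓ u k := by
  have h1' : (ℓ : ℝ) ≤ k := by exact_mod_cast h1
  have h2' : (k : ℝ) ≤ u := by exact_mod_cast h2
  exact div_nonneg (mul_nonneg (by linarith) (by linarith)) (sq_nonneg _)

theorem splitRatio_le (ℓ u k : ℕ) : splitRatio ℓ u k ≤ 1 / 4 := by
  unfold splitRatio
  refine div_le_of_le_mul₀ (sq_nonneg _) (by norm_num) ?_
  nlinarith [sq_nonneg (((k : ℝ) - ℓ) - ((u : ℝ) - k))]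

/-- The function `t ↦ t(1-t)` on a chord: its excess over the chord. -/
theorem splitRatio_eq_combination {ℓ u p p' k : ℕ} (hL : (u : ℝ) - ℓ ≠ 0)
    (hp : (p' : ℝ) - p ≠ 0) :
    splitRatio ℓ u k = (1 - ((k : ℝ) - p) / ((p' : ℝ) - p)) * splitRatio ℓ u p +
      (((k : ℝ) - p) / ((p' : ℝ) - p)) * splitRatio ℓ u p' +
      (((k : ℝ) - p) / ((p' : ℝ) - p)) * (1 - ((k : ℝ) - p) / ((p' : ℝ) - p)) *
        (((p' : ℝ) - p) / ((u : ℝ) - ℓ)) ^ 2 := by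
  unfold splitRatio
  field_simp
  ring

theorem cusumStat_nonneg (α : ℝ) (x : ℕ → E) {ℓ u k : ℕ} (h1 : ℓ ≤ k) (h2 : k ≤ u) :
    0 ≤ cusumStat α x ℓ u k := by
  have h3 : (ℓ : ℝ) ≤ u := by exact_mod_cast h1.trans h2
  exact div_nonneg (sq_nonneg _)
    (mul_nonneg (by linarith) (Real.rpow_nonneg (splitRatio_nonneg h1 h2) _))

theorem splitRatio_pos {ℓ u k : ℕ} (h1 : ℓ < k) (h2 : k < u) : 0 < splitRatio ℓ u k := by
  have h1' : (ℓ : ℝ) < k := by exact_mod_cast h1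
  have h2' : (k : ℝ) < u := by exact_mod_cast h2
  have : 0 < ((k : ℝ) - ℓ) * ((u : ℝ) - k) := mul_pos (by linarith) (by linarith)
  have : 0 < (u : ℝ) - ℓ := by linarith
  unfold splitRatio
  positivity

/-- This also holds at the end points, where the CUSUM process vanishes. -/
theorem norm_cusum_sq (α : ℝ) (x : ℕ → E) {ℓ u k : ℕ} (hℓu : ℓ < u) (h1 : ℓ ≤ k) (h2 : k ≤ u) :
    ‖cusum x ℓ u k‖ ^ 2 =
      (((u : ℝ) - ℓ) * splitRatio ℓ u k ^ α) * cusumStat α x ℓ u k := by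
  rcases h1.eq_or_lt with rfl | h1
  · simp [cusumStat, cusum_left]
  rcases h2.eq_or_lt with rfl | h2
  · simp [cusumStat, cusum_right x hℓu]
  have hL : (0 : ℝ) < (u : ℝ) - ℓ := by
    have : (ℓ : ℝ) < u := by exact_mod_cast hℓu
    linarith
  have := Real.rpow_pos_of_pos (splitRatio_pos h1 h2) α
  unfold cusumStat
  field_simp

/-- The convexity bound: up to the chord defect of the partial sums, which carries the noise, the
weighted CUSUM statistic between two points lies below the chord, by a definite factor. -/
theorem cusumStat_le_of_chordDefect {α : ℝ} (hα0 : 0 < α) (hα1 : α ≤ 1) (x : ℕ → E)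
    {ℓ u p p' k : ℕ} (hp : ℓ ≤ p) (hpk : p ≤ k) (hpp : p < p') (hkp : k ≤ p') (hp' : p' ≤ u)
    (hℓk : ℓ < k) (hku : k < u) {t : ℝ} (ht : t = ((k : ℝ) - p) / ((p' : ℝ) - p)) {y : ℝ}
    (hy : y = t * (1 - t) * (((p' : ℝ) - p) / ((u : ℝ) - ℓ)) ^ 2) {ρ : ℝ} (hρ0 : 0 ≤ ρ)
    (hρ : ‖chordDefect x p p' k‖ ^ 2 ≤ ρ ^ 2 * (((u : ℝ) - ℓ) * splitRatio ℓ u k ^ α)) :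
    cusumStat α x ℓ u k ≤
      (√((1 - 2 * (2 ^ α - 1) * y) *
        ((1 - t) * cusumStat α x ℓ u p + t * cusumStat α x ℓ u p')) + ρ) ^ 2 := by
  have hℓu : ℓ < u := hℓk.trans hku
  have hp1 : (p : ℝ) < p' := by exact_mod_cast hpp
  have hp2 : (p : ℝ) ≤ k := by exact_mod_cast hpk
  have hp3 : (k : ℝ) ≤ p' := by exact_mod_cast hkp
  have hL : (ℓ : ℝ) < u := by exact_mod_cast hℓu
  have hL0 : (0 : ℝ) < (u : ℝ) - ℓ := by linarith
  have hd0 : (0 : ℝ) < (p' : ℝ) - p := by linarith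
  have ht0 : 0 ≤ t := by rw [ht]; exact div_nonneg (by linarith) hd0.le
  have ht1 : t ≤ 1 := by rw [ht, div_le_one hd0]; linarith
  have hts : 0 ≤ 1 - t := by linarith
  have hy0 : 0 ≤ y := by rw [hy]; positivity
  have hsp := splitRatio_nonneg hp (hpk.trans hku.le)
  have hsp' := splitRatio_nonneg (hp.trans hpp.le) hp'
  have hsk := splitRatio_pos hℓk hku
  have hske := splitRatio_eq_combination (k := k) hL0.ne' hd0.ne'
  rw [← ht, ← hy] at hske
  have hk4 := splitRatio_le ℓ u k
  have hya := cusumStat_nonneg α x hp (hpk.trans hku.le)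
  have hyb := cusumStat_nonneg α x (hp.trans hpp.le) hp'
  set ya := cusumStat α x ℓ u p with hyadef
  set yb := cusumStat α x ℓ u p' with hybdef
  set L := (u : ℝ) - ℓ with hLdef
  set c := (2 : ℝ) ^ α - 1 with hc
  have hc0 : 0 < c := two_rpow_sub_one_pos hα0
  have hc1 : c ≤ 1 := two_rpow_sub_one_le hα1
  have hrp := rpow_combination_mul_le hα0 hα1 ht0 ht1 hsp hsp' hy0 (by rw [← hske]; exact hk4)
  rw [← hske] at hrp
  have hPa := (norm_cusum_sq α x hℓu hp (hpk.trans hku.le)).le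
  have hPb := (norm_cusum_sq α x hℓu (hp.trans hpp.le) hp').le
  have hsa := Real.rpow_nonneg hsp α
  have hsb := Real.rpow_nonneg hsp' α
  have hcomb := norm_combination_sq_le ht0 ht1 (mul_nonneg hL0.le hsa) (mul_nonneg hL0.le hsb)
    hya hyb hPa hPb
  set Pt := (1 - t) • cusum x ℓ u p + t • cusum x ℓ u p' with hPt
  have hskα : 0 < splitRatio ℓ u k ^ α := Real.rpow_pos_of_pos hsk α
  set s := L * splitRatio ℓ u k ^ α with hs
  have hs0 : 0 < s := mul_pos hL0 hskα
  have hlerp : 0 ≤ (1 - t) * ya + t * yb := by positivity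
  have hy4 : 4 * y ≤ 1 := by
    have h1 : (0 : ℝ) ≤ (1 - t) * splitRatio ℓ u p + t * splitRatio ℓ u p' := by positivity
    linarith
  set A := (1 - 2 * c * y) * ((1 - t) * ya + t * yb) with hA
  have hcy : 2 * c * y ≤ 1 / 2 := by
    have := mul_le_mul_of_nonneg_right hc1 hy0
    linarith
  have hA0 : 0 ≤ A := mul_nonneg (by linarith) hlerp
  have hPtA : ‖Pt‖ ^ 2 ≤ s * A := by
    have h1 : (1 + c * (4 * y)) * ‖Pt‖ ^ 2 ≤ s * ((1 - t) * ya + t * yb) := by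
      calc (1 + c * (4 * y)) * ‖Pt‖ ^ 2
          ≤ (1 + c * (4 * y)) * (((1 - t) * (L * splitRatio ℓ u p ^ α) +
            t * (L * splitRatio ℓ u p' ^ α)) * ((1 - t) * ya + t * yb)) := by gcongr
        _ = L * ((1 + c * (4 * y)) * ((1 - t) * splitRatio ℓ u p ^ α +
            t * splitRatio ℓ u p' ^ α)) * ((1 - t) * ya + t * yb) := by ring
        _ ≤ L * splitRatio ℓ u k ^ α * ((1 - t) * ya + t * yb) := by gcongr
    -- `(1 + z)⁻¹ ≤ 1 - z / 2` for `z = 4 c y ≤ 1`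
    have h2 : 1 ≤ (1 - 2 * c * y) * (1 + c * (4 * y)) := by
      have hcy0 : 0 ≤ c * y := by positivity
      have hcy1 : 0 ≤ 1 - 4 * (c * y) := by linarith
      have e : (1 - 2 * c * y) * (1 + c * (4 * y)) = 1 + 2 * ((c * y) * (1 - 4 * (c * y))) := by
        ring
      rw [e]
      linarith [mul_nonneg hcy0 hcy1]
    have h3 : 0 ≤ 1 - 2 * c * y := by linarith
    calc ‖Pt‖ ^ 2 ≤ ((1 - 2 * c * y) * (1 + c * (4 * y))) * ‖Pt‖ ^ 2 :=
          le_mul_of_one_le_left (sq_nonneg _) h2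
      _ = (1 - 2 * c * y) * ((1 + c * (4 * y)) * ‖Pt‖ ^ 2) := by ring
      _ ≤ (1 - 2 * c * y) * (s * ((1 - t) * ya + t * yb)) := by gcongr
      _ = _ := by rw [hA]; ring
  have hPk : ‖cusum x ℓ u k‖ ≤ √s * (√A + ρ) := by
    have e := cusum_eq_combination x (ℓ := ℓ) (u := u) (k := k) hd0.ne'
    rw [← ht, ← hPt] at e
    rw [e]
    have h1 : ‖Pt‖ ≤ √s * √A := by
      rw [← Real.sqrt_mul hs0.le]
      exact Real.le_sqrt_of_sq_le hPtA
    have h2 : ‖chordDefect x p p' k‖ ≤ √s * ρ := by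
      refine le_of_sq_le_sq ?_ (by positivity)
      rw [mul_pow, Real.sq_sqrt hs0.le]
      linarith
    exact (norm_add_le _ _).trans (by linarith)
  have hfin : cusumStat α x ℓ u k = ‖cusum x ℓ u k‖ ^ 2 / s := rfl
  rw [hfin, div_le_iff₀ hs0]
  calc ‖cusum x ℓ u k‖ ^ 2 ≤ (√s * (√A + ρ)) ^ 2 := by gcongr
    _ = (√A + ρ) ^ 2 * s := by rw [mul_pow, Real.sq_sqrt hs0.le]; ring

/-- The dichotomy behind the localization of a maximizer: a value below a strictly convex chord is
either far below the maximum `V`, or its nearest end point has a value close to the maximum and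
exceeds it by an amount proportional to the distance. -/
theorem far_or_le_near {V y ys yo A t c ρ : ℝ} (hc0 : 0 ≤ c) (hc1 : c ≤ 1 / 2) (ht0 : 0 ≤ t)
    (ht1 : t ≤ 1 / 2) (hys0 : 0 ≤ ys) (hys : ys ≤ V) (hyo0 : 0 ≤ yo) (hyo : yo ≤ V)
    (hA0 : 0 ≤ A) (hA : A ≤ (1 - c * (t * (1 - t))) * ((1 - t) * ys + t * yo))
    (hρ0 : 0 ≤ ρ) (hρ : ρ ≤ c / 96 * √V) (hy : y ≤ (√A + ρ) ^ 2) :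
    y ≤ (1 - c / 32) * V ∨ (V / 2 ≤ ys ∧ y ≤ ys - c / 8 * (t * V) + 3 * (ρ * √V)) := by
  have hV : 0 ≤ V := hys0.trans hys
  set W := √V with hW
  have hW0 : 0 ≤ W := Real.sqrt_nonneg _
  have hWV : W ^ 2 = V := Real.sq_sqrt hV
  have hlerp1 : (1 - t) * ys + t * yo ≤ V := by nlinarith
  have hlerp0 : 0 ≤ (1 - t) * ys + t * yo := add_nonneg (mul_nonneg (by linarith) hys0)
    (mul_nonneg ht0 hyo0)
  have htt : 0 ≤ t * (1 - t) := mul_nonneg ht0 (by linarith)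
  have hAl : A ≤ (1 - t) * ys + t * yo := by
    have := mul_nonneg (mul_nonneg hc0 htt) hlerp0
    linarith
  have hAW : √A ≤ W := Real.sqrt_le_sqrt (hAl.trans hlerp1)
  have hsA : √A ^ 2 = A := Real.sq_sqrt hA0
  have hρW : ρ ≤ W := by nlinarith
  have hy1 : y ≤ A + 3 * (ρ * W) := by
    have h1 : √A * ρ ≤ W * ρ := mul_le_mul_of_nonneg_right hAW hρ0
    have h2 : ρ * ρ ≤ W * ρ := mul_le_mul_of_nonneg_right hρW hρ0
    nlinarith
  have hρV : ρ * W ≤ c / 96 * V := by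
    rw [← hWV]
    nlinarith
  by_cases hfar : y ≤ (1 - c / 32) * V
  · exact Or.inl hfar
  · right
    have h1 : (1 - c / 16) * V ≤ A := by nlinarith [not_le.1 hfar]
    have h2 : (1 - c / 16) * V ≤ (1 - t) * ys + t * V := by nlinarith
    have h3 : V - c / 8 * V ≤ ys := by
      -- divide by `1 - t ≥ 1 / 2`
      have h4 : (1 - t) * (V - ys) ≤ c / 16 * V := by linarith
      have h5 : 1 / 2 * (V - ys) ≤ (1 - t) * (V - ys) := by
        apply mul_le_mul_of_nonneg_right <;> linarith
      linarith
    have hcV : c * V ≤ 1 / 2 * V := mul_le_mul_of_nonneg_right hc1 hV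
    refine ⟨by linarith, hy1.trans ?_⟩
    have h6 : (1 - t) * ys + t * yo ≤ ys + t * (c / 8 * V) := by nlinarith
    have h7 : V / 2 ≤ (1 - t) * ys + t * yo := by linarith
    have h8 : t / 2 * (V / 2) ≤ (t * (1 - t)) * ((1 - t) * ys + t * yo) :=
      mul_le_mul (by nlinarith) h7 (by linarith) htt
    have h9 : c * (t / 2 * (V / 2)) ≤ c * ((t * (1 - t)) * ((1 - t) * ys + t * yo)) :=
      mul_le_mul_of_nonneg_left h8 hc0
    linarith

end Convexity

/-! ### The deterministic multiple break model -/

section Model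

variable {E : Type*} [NormedAddCommGroup E] [InnerProductSpace ℝ E]

/-- Observations `x_i = ν_j + e_i` for `b_j < i ≤ b_{j+1}`, `0 ≤ j ≤ n`, with well separated anchors
`0 = b_0 < ⋯ < b_{n+1} = N` and jumps of the means of size at least `c₀`. -/
structure BreakModel (n N : ℕ) (b : ℕ → ℕ) (γ c₀ : ℝ) (ν : ℕ → E) (e x : ℕ → E) : Prop where
  zero : b 0 = 0
  last : b (n + 1) = N
  gap : ∀ j ≤ n, 2 * γ * N ≤ (b (j + 1) : ℝ) - b j
  jump : ∀ j < n, c₀ ≤ ‖ν (j + 1) - ν j‖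
  obs : ∀ j ≤ n, ∀ i, b j < i → i ≤ b (j + 1) → x i = ν j + e i

/-- The point `p` estimates the anchor `b_a`: it is equal to it or, at a break, within a distance
that is at most `B` after scaling with the squared jump. -/
def NearAnchor (n : ℕ) (b : ℕ → ℕ) (ν : ℕ → E) (B : ℝ) (a p : ℕ) : Prop :=
  p = b a ∨ (0 < a ∧ a ≤ n ∧ |(p : ℝ) - b a| * ‖ν a - ν (a - 1)‖ ^ 2 ≤ B)

variable {n N : ℕ} {b : ℕ → ℕ} {γ c₀ B : ℝ} {ν e x : ℕ → E}

theorem BreakModel.gap_nat (h : BreakModel n N b γ c₀ ν e x) (hγ : 0 ≤ γ) {j : ℕ} (hj : j ≤ n) :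
    b j ≤ b (j + 1) := by
  have h1 := h.gap j hj
  have h2 : 0 ≤ 2 * γ * N := by positivity
  have : (b j : ℝ) ≤ b (j + 1) := by linarith
  exact_mod_cast this

theorem BreakModel.mono (h : BreakModel n N b γ c₀ ν e x) (hγ : 0 ≤ γ) {i j : ℕ} (hij : i ≤ j)
    (hj : j ≤ n + 1) : b i ≤ b j := by
  induction j, hij using Nat.le_induction with
  | base => exact le_rfl
  | succ j hij ih => exact (ih (by omega)).trans (h.gap_nat hγ (by omega))

theorem BreakModel.le_N (h : BreakModel n N b γ c₀ ν e x) (hγ : 0 ≤ γ) {j : ℕ} (hj : j ≤ n + 1) :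
    b j ≤ N := by
  rw [← h.last]
  exact h.mono hγ hj le_rfl

theorem BreakModel.jump' (h : BreakModel n N b γ c₀ ν e x) {a : ℕ} (ha0 : 0 < a) (han : a ≤ n) :
    c₀ ≤ ‖ν a - ν (a - 1)‖ := by
  have := h.jump (a - 1) (by omega)
  rwa [Nat.sub_add_cancel ha0] at this

theorem NearAnchor.dist_le (h : BreakModel n N b γ c₀ ν e x) (hc : 0 < c₀) (hB : 0 ≤ B) {a p : ℕ}
    (ha : NearAnchor n b ν B a p) : |(p : ℝ) - b a| ≤ B / c₀ ^ 2 := by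
  rcases ha with rfl | ⟨h0, hn, hB'⟩
  · rw [sub_self, abs_zero]
    positivity
  · rw [le_div_iff₀ (by positivity)]
    refine le_trans ?_ hB'
    have := h.jump' h0 hn
    gcongr

theorem NearAnchor.dist_mul_le (h : BreakModel n N b γ c₀ ν e x) (hc : 0 < c₀) {a p : ℕ}
    (h0 : 0 < a) (hn : a ≤ n) (hB' : |(p : ℝ) - b a| * ‖ν a - ν (a - 1)‖ ^ 2 ≤ B) :
    |(p : ℝ) - b a| * ‖ν a - ν (a - 1)‖ ≤ B / c₀ := by
  rw [le_div_iff₀ hc]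
  refine le_trans ?_ hB'
  have := h.jump' h0 hn
  rw [sq, ← mul_assoc]
  gcongr

/-- A stray piece contains at least one observation, so the jump is at most of size `√B`. -/
theorem NearAnchor.norm_jump_sq_le {a p : ℕ} (hpa : p ≠ b a)
    (hB' : |(p : ℝ) - b a| * ‖ν a - ν (a - 1)‖ ^ 2 ≤ B) : ‖ν a - ν (a - 1)‖ ^ 2 ≤ B := by
  refine le_trans ?_ hB'
  have h1 : (1 : ℝ) ≤ |(p : ℝ) - b a| := by
    have h2 : (1 : ℤ) ≤ |(p : ℤ) - b a| := Int.one_le_abs (by omega)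
    exact_mod_cast h2
  exact le_mul_of_one_le_left (sq_nonneg _) h1

/-- The part of the partial sums which is not affine on regime `j`, apart from the noise. -/
def resid (ν e x : ℕ → E) (j k : ℕ) : E := psum x k - psum e k - (k : ℝ) • ν j

theorem BreakModel.psum_sub (h : BreakModel n N b γ c₀ ν e x) {j k k' : ℕ} (hj : j ≤ n)
    (hk : b j ≤ k) (hkk : k ≤ k') (hk' : k' ≤ b (j + 1)) :
    psum x k' - psum x k = (psum e k' - psum e k) + ((k' : ℝ) - k) • ν j := by
  rw [psum_sub_psum x hkk, psum_sub_psum e hkk,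
    Finset.sum_congr rfl fun i hi => h.obs j hj i (by have := (Finset.mem_Ioc.1 hi).1; omega)
      (by have := (Finset.mem_Ioc.1 hi).2; omega),
    Finset.sum_add_distrib, Finset.sum_const, Nat.card_Ioc, ← Nat.cast_smul_eq_nsmul ℝ,
    Nat.cast_sub hkk, add_comm]

theorem BreakModel.resid_eq (h : BreakModel n N b γ c₀ ν e x) {j k : ℕ} (hj : j ≤ n)
    (hk : b j ≤ k) (hk' : k ≤ b (j + 1)) : resid ν e x j k = resid ν e x j (b j) := by
  have h1 := h.psum_sub hj le_rfl hk hk'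
  rw [← sub_eq_zero]
  have e1 : resid ν e x j k - resid ν e x j (b j) =
      (psum x k - psum x (b j)) - (psum e k - psum e (b j)) - ((k : ℝ) - b j) • ν j := by
    unfold resid
    module
  rw [e1, h1]
  abel

theorem BreakModel.resid_left (h : BreakModel n N b γ c₀ ν e x) {j k : ℕ} (h0 : 0 < j)
    (hj : j ≤ n + 1) (hk : b (j - 1) ≤ k) (hk' : k ≤ b j) :
    resid ν e x j k - resid ν e x j (b j) = ((b j : ℝ) - k) • (ν j - ν (j - 1)) := by
  have h1 := h.psum_sub (j := j - 1) (by omega) hk hk' (by rw [Nat.sub_add_cancel h0])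
  have e1 : resid ν e x j k - resid ν e x j (b j) =
      -(psum x (b j) - psum x k) + (psum e (b j) - psum e k) + ((b j : ℝ) - k) • ν j := by
    unfold resid
    module
  rw [e1, h1]
  module

theorem BreakModel.resid_right (h : BreakModel n N b γ c₀ ν e x) {j k : ℕ}
    (hj : j + 1 ≤ n) (hk : b (j + 1) ≤ k) (hk' : k ≤ b (j + 2)) :
    resid ν e x j k - resid ν e x j (b (j + 1)) =
      ((k : ℝ) - b (j + 1)) • (ν (j + 1) - ν j) := by
  have h1 := h.psum_sub (j := j + 1) hj le_rfl hk hk'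
  have e1 : resid ν e x j k - resid ν e x j (b (j + 1)) =
      (psum x k - psum x (b (j + 1))) - (psum e k - psum e (b (j + 1))) -
        ((k : ℝ) - b (j + 1)) • ν j := by
    unfold resid
    module
  rw [e1, h1]
  module

/-- Near anchors stay in the neighbouring regimes. -/
theorem NearAnchor.bounds (h : BreakModel n N b γ c₀ ν e x) (hγ : 0 ≤ γ) (hc : 0 < c₀) (hB : 0 ≤ B)
    (hBN : B / c₀ ^ 2 ≤ γ * N / 2) {a p : ℕ} (ha : NearAnchor n b ν B a p) :
    (∀ j ≤ n, a = j + 1 → (b j : ℝ) + γ * N ≤ p) ∧ (a ≤ n → (p : ℝ) + γ * N ≤ b (a + 1)) := by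
  have h1 := abs_le.1 (ha.dist_le h hc hB)
  have hγN : 0 ≤ γ * N := by positivity
  constructor
  · rintro j hj rfl
    have := h.gap j hj
    linarith
  · intro han
    have := h.gap a han
    linarith

theorem NearAnchor.le_N (h : BreakModel n N b γ c₀ ν e x) (hγ : 0 ≤ γ) (hc : 0 < c₀) (hB : 0 ≤ B)
    (hBN : B / c₀ ^ 2 ≤ γ * N / 2) {a p : ℕ} (ha : NearAnchor n b ν B a p) (han : a ≤ n + 1) :
    p ≤ N := by
  have hb := ha.bounds h hγ hc hB hBN
  rcases ha with rfl | ⟨h0, hn, _⟩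
  · exact h.le_N hγ han
  · have h1 := hb.2 hn
    have h2 : (b (a + 1) : ℝ) ≤ N := by exact_mod_cast h.le_N hγ (by omega : a + 1 ≤ n + 1)
    have hγN : 0 ≤ γ * N := by positivity
    have : (p : ℝ) ≤ N := by linarith
    exact_mod_cast this

/-- On a segment of regime `j` with end points near the anchors the residual mean is bounded: it is
the product of the jump and the length of a stray piece. -/
theorem NearAnchor.norm_resid_le (h : BreakModel n N b γ c₀ ν e x) (hγ : 0 ≤ γ) (hc : 0 < c₀)
    (hB : 0 ≤ B) (hBN : B / c₀ ^ 2 ≤ γ * N / 2) {j p p' k : ℕ} (hj : j ≤ n)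
    (hp : NearAnchor n b ν B j p) (hp' : NearAnchor n b ν B (j + 1) p') (hpk : p ≤ k)
    (hkp : k ≤ p') : ‖resid ν e x j k - resid ν e x j (b j)‖ ≤ B / c₀ := by
  have hBc : 0 ≤ B / c₀ := by positivity
  have hγN : 0 ≤ γ * N := by positivity
  have hpk' : (p : ℝ) ≤ k := by exact_mod_cast hpk
  have hkp' : (k : ℝ) ≤ p' := by exact_mod_cast hkp
  rcases lt_or_ge k (b j) with h1 | h1
  · have h1' : (k : ℝ) < b j := by exact_mod_cast h1
    have hbd := hp.bounds h hγ hc hB hBN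
    rcases hp with rfl | ⟨h0, hn, hBp⟩
    · omega
    · have h2 := hbd.1 (j - 1) (by omega) (by omega)
      have h3 : b (j - 1) ≤ k := by
        have : (b (j - 1) : ℝ) ≤ k := by linarith
        exact_mod_cast this
      rw [h.resid_left h0 (by omega) h3 h1.le, norm_smul, Real.norm_of_nonneg (by linarith)]
      refine le_trans ?_ (NearAnchor.dist_mul_le h hc h0 hn hBp)
      gcongr
      rw [abs_sub_comm]
      exact le_trans (by linarith) (le_abs_self _)
  rcases le_or_gt k (b (j + 1)) with h2 | h2
  · rw [h.resid_eq hj h1 h2, sub_self, norm_zero]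
    exact hBc
  · have h2' : (b (j + 1) : ℝ) < k := by exact_mod_cast h2
    have hbd := hp'.bounds h hγ hc hB hBN
    rcases hp' with rfl | ⟨h0, hn, hBp⟩
    · omega
    · have h3 := hbd.2 hn
      have h4 : k ≤ b (j + 2) := by
        have : (k : ℝ) ≤ b (j + 1 + 1) := by linarith
        exact_mod_cast this
      rw [← h.resid_eq hj (h.gap_nat hγ hj) le_rfl, h.resid_right hn h2.le h4, norm_smul,
        Real.norm_of_nonneg (by linarith)]
      refine le_trans ?_ (NearAnchor.dist_mul_le h hc h0 hn hBp)
      rw [Nat.add_sub_cancel]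
      gcongr
      exact le_trans (by linarith) (le_abs_self _)

/-- The noise together with the residual mean: the non-affine part of the partial sums. -/
def roughPart (ν e x : ℕ → E) (j k : ℕ) : E := psum e k + resid ν e x j k

theorem psum_eq_roughPart (ν e x : ℕ → E) (j k : ℕ) :
    psum x k = roughPart ν e x j k + (k : ℝ) • ν j := by
  unfold roughPart resid
  abel

/-- The affine mean of regime `j` does not contribute to the chord defect. -/
theorem chordDefect_eq (ν e x : ℕ → E) (j : ℕ) {p p' k : ℕ} (hp : (p' : ℝ) - p ≠ 0) :
    chordDefect x p p' k = (roughPart ν e x j k - roughPart ν e x j p) -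
      (((k : ℝ) - p) / ((p' : ℝ) - p)) • (roughPart ν e x j p' - roughPart ν e x j p) := by
  obtain ⟨t, ht⟩ : ∃ t : ℝ, t = ((k : ℝ) - p) / ((p' : ℝ) - p) := ⟨_, rfl⟩
  have hk : (k : ℝ) = p + t * ((p' : ℝ) - p) := by rw [ht]; field_simp; ring
  rw [chordDefect, ← ht, psum_eq_roughPart ν e x j k, psum_eq_roughPart ν e x j p,
    psum_eq_roughPart ν e x j p', hk]
  module

/-- The chord defect, seen from the right end point of the chord. -/
theorem chordDefect_eq' (ν e x : ℕ → E) (j : ℕ) {p p' k : ℕ} (hp : (p' : ℝ) - p ≠ 0) :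
    chordDefect x p p' k = (((p' : ℝ) - k) / ((p' : ℝ) - p)) •
      (roughPart ν e x j p' - roughPart ν e x j p) -
        (roughPart ν e x j p' - roughPart ν e x j k) := by
  have e1 : ((p' : ℝ) - k) / ((p' : ℝ) - p) = 1 - ((k : ℝ) - p) / ((p' : ℝ) - p) := by
    field_simp
    ring
  rw [chordDefect_eq ν e x j hp, e1]
  module

/-- The size of the rough part on a scale `K`, with endpoints off by at most `B / c₀²`. -/
def roughConst (K B c₀ : ℝ) : ℝ := 6 * K * (1 + B / c₀ ^ 2) + 12 * (B / c₀) ^ 2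

theorem roughConst_nonneg {K B c₀ : ℝ} (hK : 0 ≤ K) (hB : 0 ≤ B) :
    0 ≤ roughConst K B c₀ := by
  unfold roughConst
  positivity

/-- The rough part between two points of a subsample of regime `j`, one of which is close to an
anchor, inherits the growth of the noise. -/
theorem norm_roughPart_sub_sq_le {α K : ℝ} (hα0 : 0 < α) (hα1 : α < 1) (hK : 0 ≤ K)
    (hB : 0 ≤ B) (hN : 0 < N) {m : ℕ}
    (he : TameNoise α K N m b e) {i j k p : ℕ} (hi : i ≤ m) (hk : k ≤ N) (hp : p ≤ N)
    (hpi : |(p : ℝ) - b i| ≤ B / c₀ ^ 2)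
    (hrk : ‖resid ν e x j k - resid ν e x j (b j)‖ ≤ B / c₀)
    (hrp : ‖resid ν e x j p - resid ν e x j (b j)‖ ≤ B / c₀) :
    ‖roughPart ν e x j k - roughPart ν e x j p‖ ^ 2 ≤
      roughConst K B c₀ * (|(k : ℝ) - p| ^ α * (N : ℝ) ^ (1 - α)) := by
  rcases eq_or_ne k p with rfl | hkp
  · rw [sub_self, norm_zero]
    have := mul_nonneg (roughConst_nonneg (c₀ := c₀) hK hB)
      (by positivity : 0 ≤ |(k : ℝ) - k| ^ α * (N : ℝ) ^ (1 - α))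
    simpa using this
  have hN1 : (1 : ℝ) ≤ N := by exact_mod_cast hN
  have hN' : (0 : ℝ) ≤ (N : ℝ) ^ (1 - α) := by positivity
  have hN'' : (1 : ℝ) ≤ (N : ℝ) ^ (1 - α) := Real.one_le_rpow hN1 (by linarith)
  have h1 : (1 : ℝ) ≤ |(k : ℝ) - p| := by
    have h2 : (1 : ℤ) ≤ |(k : ℤ) - p| := Int.one_le_abs (by omega)
    exact_mod_cast h2
  set h := |(k : ℝ) - p| with hh
  have hhα : 1 ≤ h ^ α := Real.one_le_rpow h1 hα0.le
  set w := B / c₀ ^ 2 with hw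
  have hw0 : 0 ≤ w := (abs_nonneg _).trans hpi
  have hwα : (1 + w) ^ α ≤ 1 + w := by
    have := Real.rpow_le_rpow_of_exponent_le (by linarith : 1 ≤ 1 + w) hα1.le
    rwa [Real.rpow_one] at this
  have hkα : |(k : ℝ) - b i| ^ α ≤ (1 + w) * h ^ α := by
    have h2 : |(k : ℝ) - b i| ≤ (1 + w) * h := by
      have h3 : |(k : ℝ) - b i| ≤ |(k : ℝ) - p| + |(p : ℝ) - b i| := abs_sub_le _ _ _
      nlinarith
    calc |(k : ℝ) - b i| ^ α ≤ ((1 + w) * h) ^ α := Real.rpow_le_rpow (abs_nonneg _) h2 hα0.le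
      _ = (1 + w) ^ α * h ^ α := Real.mul_rpow (by positivity) (by positivity)
      _ ≤ _ := by gcongr
  have hpα : |(p : ℝ) - b i| ^ α ≤ (1 + w) * h ^ α := by
    calc |(p : ℝ) - b i| ^ α ≤ (1 + w) ^ α :=
          Real.rpow_le_rpow (abs_nonneg _) (by linarith) hα0.le
      _ ≤ 1 + w := hwα
      _ ≤ _ := le_mul_of_one_le_right (by linarith) hhα
  have g1 := he.global i hi k hk
  have g2 := he.global i hi p hp
  set X := psum e k - psum e (b i) with hX
  set Y := psum e p - psum e (b i) with hY
  set Z := resid ν e x j k - resid ν e x j p with hZ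
  have hZn : ‖Z‖ ≤ 2 * (B / c₀) := by
    have e1 : Z = (resid ν e x j k - resid ν e x j (b j)) -
        (resid ν e x j p - resid ν e x j (b j)) := by rw [hZ]; abel
    rw [e1]
    refine (norm_sub_le _ _).trans (by linarith)
  have hBc0 : 0 ≤ B / c₀ := (norm_nonneg _).trans hrk
  have e2 : roughPart ν e x j k - roughPart ν e x j p = X - Y + Z := by
    unfold roughPart
    rw [hX, hY, hZ]
    abel
  have h3 : ‖X - Y + Z‖ ≤ ‖X‖ + ‖Y‖ + ‖Z‖ :=
    (norm_add_le _ _).trans (add_le_add (norm_sub_le _ _) le_rfl)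
  have h4 : ‖X - Y + Z‖ ^ 2 ≤ 3 * (‖X‖ ^ 2 + ‖Y‖ ^ 2 + ‖Z‖ ^ 2) := by
    have : ‖X - Y + Z‖ ^ 2 ≤ (‖X‖ + ‖Y‖ + ‖Z‖) ^ 2 := by gcongr
    nlinarith [sq_nonneg (‖X‖ - ‖Y‖), sq_nonneg (‖X‖ - ‖Z‖), sq_nonneg (‖Y‖ - ‖Z‖)]
  have h5 : ‖Z‖ ^ 2 ≤ (2 * (B / c₀)) ^ 2 := by gcongr
  have h6 : ‖X‖ ^ 2 ≤ K * ((1 + w) * h ^ α * (N : ℝ) ^ (1 - α)) := g1.trans (by gcongr)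
  have h7 : ‖Y‖ ^ 2 ≤ K * ((1 + w) * h ^ α * (N : ℝ) ^ (1 - α)) := g2.trans (by gcongr)
  have h8 : 1 ≤ h ^ α * (N : ℝ) ^ (1 - α) := by nlinarith
  have h9 : 12 * (B / c₀) ^ 2 * 1 ≤ 12 * (B / c₀) ^ 2 * (h ^ α * (N : ℝ) ^ (1 - α)) := by gcongr
  rw [e2, roughConst]
  nlinarith

end Model

/-! ### Segments between near anchors -/

section Sample

variable {E : Type*} [NormedAddCommGroup E] [InnerProductSpace ℝ E]

/-- A sample of the break model whose noise is tame on the scale `K`, with the tolerance `B` for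
the estimated breaks small in comparison with the distances of the true ones. -/
structure TameSample (α K B γ c₀ : ℝ) (n N : ℕ) (b : ℕ → ℕ) (ν e x : ℕ → E) : Prop where
  model : BreakModel n N b γ c₀ ν e x
  tame : TameNoise α K N (n + 1) b e
  α_pos : 0 < α
  α_lt : α < 1
  γ_pos : 0 < γ
  γ_le : γ ≤ 1 / 2
  c_pos : 0 < c₀
  K_pos : 0 < K
  B_nonneg : 0 ≤ B
  N_pos : 0 < N
  shift_le : B / c₀ ^ 2 ≤ γ * N / 2

variable {α K B γ c₀ : ℝ} {n N : ℕ} {b : ℕ → ℕ} {ν e x : ℕ → E}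

namespace TameSample

variable (h : TameSample α K B γ c₀ n N b ν e x)
include h

theorem scale_pos : 0 < γ * N := by
  have h1 := h.γ_pos
  have h2 : (0 : ℝ) < N := by exact_mod_cast h.N_pos
  positivity

theorem near_le_N {a p : ℕ} (ha : a ≤ n + 1) (hp : NearAnchor n b ν B a p) : p ≤ N :=
  hp.le_N h.model h.γ_pos.le h.c_pos h.B_nonneg h.shift_le ha

theorem near_gap {j p p' : ℕ} (hj : j ≤ n) (hp : NearAnchor n b ν B j p)
    (hp' : NearAnchor n b ν B (j + 1) p') : (p : ℝ) + γ * N ≤ p' := by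
  have h1 := abs_le.1 (hp.dist_le h.model h.c_pos h.B_nonneg)
  have h2 := abs_le.1 (hp'.dist_le h.model h.c_pos h.B_nonneg)
  have h3 := h.model.gap j hj
  have h4 := h.shift_le
  linarith

theorem near_gap_of_lt {a a' p p' : ℕ} (ha : a < a') (ha' : a' ≤ n + 1)
    (hp : NearAnchor n b ν B a p) (hp' : NearAnchor n b ν B a' p') : (p : ℝ) + γ * N ≤ p' := by
  have h1 := abs_le.1 (hp.dist_le h.model h.c_pos h.B_nonneg)
  have h2 := abs_le.1 (hp'.dist_le h.model h.c_pos h.B_nonneg)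
  have h3 := h.model.gap a (by omega)
  have h4 := h.shift_le
  have h5 : (b (a + 1) : ℝ) ≤ b a' := by exact_mod_cast h.model.mono h.γ_pos.le ha ha'
  linarith

/-- The growth of the rough part from either end of a regime. -/
theorem norm_rough_sq_le {j p p' k : ℕ} (hj : j ≤ n) (hp : NearAnchor n b ν B j p)
    (hp' : NearAnchor n b ν B (j + 1) p') (hpk : p ≤ k) (hkp : k ≤ p') :
    ‖roughPart ν e x j k - roughPart ν e x j p‖ ^ 2 ≤
        roughConst K B c₀ * (((k : ℝ) - p) ^ α * (N : ℝ) ^ (1 - α)) ∧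
      ‖roughPart ν e x j p' - roughPart ν e x j k‖ ^ 2 ≤
        roughConst K B c₀ * (((p' : ℝ) - k) ^ α * (N : ℝ) ^ (1 - α)) := by
  have hpk' : (p : ℝ) ≤ k := by exact_mod_cast hpk
  have hkp' : (k : ℝ) ≤ p' := by exact_mod_cast hkp
  have hp'N := h.near_le_N (by omega) hp'
  have hr := fun m (h1 : p ≤ m) (h2 : m ≤ p') => NearAnchor.norm_resid_le h.model h.γ_pos.le h.c_pos
    h.B_nonneg h.shift_le hj hp hp' h1 h2
  constructor
  · have := norm_roughPart_sub_sq_le (i := j) (ν := ν) (x := x) (j := j) h.α_pos h.α_lt h.K_pos.le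
      h.B_nonneg h.N_pos h.tame (by omega) (by omega : k ≤ N) (by omega : p ≤ N)
      (hp.dist_le h.model h.c_pos h.B_nonneg) (hr k hpk hkp) (hr p le_rfl (by omega))
    rwa [abs_of_nonneg (by linarith)] at this
  · have := norm_roughPart_sub_sq_le (i := j + 1) (ν := ν) (x := x) (j := j) h.α_pos h.α_lt
      h.K_pos.le h.B_nonneg h.N_pos h.tame (by omega) (by omega : k ≤ N) (by omega : p' ≤ N)
      (hp'.dist_le h.model h.c_pos h.B_nonneg) (hr k hpk hkp) (hr p' (by omega) le_rfl)
    rwa [abs_of_nonpos (by linarith), neg_sub, ← norm_neg, neg_sub] at this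

theorem roughConst_nonneg' : 0 ≤ roughConst K B c₀ := roughConst_nonneg h.K_pos.le h.B_nonneg

theorem norm_rough_total_le {j p p' : ℕ} (hj : j ≤ n) (hp : NearAnchor n b ν B j p)
    (hp' : NearAnchor n b ν B (j + 1) p') :
    ‖roughPart ν e x j p' - roughPart ν e x j p‖ ≤ √(roughConst K B c₀ * N) := by
  have hg := h.near_gap hj hp hp'
  have hs := h.scale_pos
  have hpp : p ≤ p' := by
    have : (p : ℝ) ≤ p' := by linarith
    exact_mod_cast this
  have hN : (0 : ℝ) < N := by exact_mod_cast h.N_pos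
  have hp'N : (p' : ℝ) ≤ N := by exact_mod_cast h.near_le_N (by omega) hp'
  apply Real.le_sqrt_of_sq_le
  refine (h.norm_rough_sq_le hj hp hp' hpp le_rfl).1.trans ?_
  have h0 : (0 : ℝ) ≤ p := Nat.cast_nonneg _
  have h1 : ((p' : ℝ) - p) ^ α ≤ (N : ℝ) ^ α :=
    Real.rpow_le_rpow (by linarith) (by linarith) h.α_pos.le
  have h2 : (N : ℝ) ^ α * (N : ℝ) ^ (1 - α) = N := by
    rw [← Real.rpow_add hN, add_sub_cancel, Real.rpow_one]
  have := h.roughConst_nonneg'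
  calc _ ≤ roughConst K B c₀ * ((N : ℝ) ^ α * (N : ℝ) ^ (1 - α)) := by gcongr
    _ = _ := by rw [h2]

/-- On a chord between neighbouring near anchors the deviation of the partial sums is of the order
of the noise. -/
theorem norm_chordDefect_sq_le {j p p' k : ℕ} (hj : j ≤ n) (hp : NearAnchor n b ν B j p)
    (hp' : NearAnchor n b ν B (j + 1) p') (hpk : p ≤ k) (hkp : k ≤ p') :
    ‖chordDefect x p p' k‖ ^ 2 ≤
        4 * roughConst K B c₀ * (((k : ℝ) - p) ^ α * (N : ℝ) ^ (1 - α)) ∧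
      ‖chordDefect x p p' k‖ ^ 2 ≤
        4 * roughConst K B c₀ * (((p' : ℝ) - k) ^ α * (N : ℝ) ^ (1 - α)) := by
  have hpk' : (p : ℝ) ≤ k := by exact_mod_cast hpk
  have hkp' : (k : ℝ) ≤ p' := by exact_mod_cast hkp
  have hg := h.near_gap hj hp hp'
  have hs := h.scale_pos
  have hd : 0 < (p' : ℝ) - p := by linarith
  have hpp : p ≤ p' := hpk.trans hkp
  have hT := (h.norm_rough_sq_le hj hp hp' hpp le_rfl).1
  have hR := h.norm_rough_sq_le hj hp hp' hpk hkp
  have hK1 := h.roughConst_nonneg'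
  have hN' : (0 : ℝ) ≤ (N : ℝ) ^ (1 - α) := by positivity
  -- the linear interpolation `m / (p' - p)` is at most its power with exponent `α / 2`
  have key : ∀ (m : ℝ) (X T : E), 0 ≤ m → m ≤ (p' : ℝ) - p →
      ‖X‖ ^ 2 ≤ roughConst K B c₀ * (m ^ α * (N : ℝ) ^ (1 - α)) →
      ‖T‖ ^ 2 ≤ roughConst K B c₀ * (((p' : ℝ) - p) ^ α * (N : ℝ) ^ (1 - α)) →
      (‖X‖ + ‖(m / ((p' : ℝ) - p)) • T‖) ^ 2 ≤
        4 * roughConst K B c₀ * (m ^ α * (N : ℝ) ^ (1 - α)) := by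
    intro m X T hm0 hm1 hX hT
    have hl0 : 0 ≤ m / ((p' : ℝ) - p) := by positivity
    have hl1 : m / ((p' : ℝ) - p) ≤ 1 := (div_le_one hd).2 hm1
    have hl2 : (m / ((p' : ℝ) - p)) ^ 2 ≤ (m / ((p' : ℝ) - p)) ^ α := by
      rcases hl0.eq_or_lt with h0 | h0
      · rw [← h0, Real.zero_rpow h.α_pos.ne']
        norm_num
      · rw [← Real.rpow_natCast]
        refine Real.rpow_le_rpow_of_exponent_ge h0 hl1 ?_
        have := h.α_lt
        norm_num
        linarith
    have h1 : ‖(m / ((p' : ℝ) - p)) • T‖ ^ 2 ≤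
        roughConst K B c₀ * (m ^ α * (N : ℝ) ^ (1 - α)) := by
      rw [norm_smul, mul_pow, Real.norm_of_nonneg hl0]
      calc (m / ((p' : ℝ) - p)) ^ 2 * ‖T‖ ^ 2 ≤ (m / ((p' : ℝ) - p)) ^ α *
            (roughConst K B c₀ * (((p' : ℝ) - p) ^ α * (N : ℝ) ^ (1 - α))) := by gcongr
        _ = roughConst K B c₀ *
            ((m / ((p' : ℝ) - p)) ^ α * ((p' : ℝ) - p) ^ α * (N : ℝ) ^ (1 - α)) := by ring
        _ = _ := by rw [← Real.mul_rpow hl0 hd.le, div_mul_cancel₀ _ hd.ne']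
    nlinarith [sq_nonneg (‖X‖ - ‖(m / ((p' : ℝ) - p)) • T‖)]
  constructor
  · rw [chordDefect_eq ν e x j hd.ne']
    refine le_trans ?_ (key ((k : ℝ) - p) _ _ (by linarith) (by linarith) hR.1 hT)
    gcongr
    exact norm_sub_le _ _
  · rw [chordDefect_eq' ν e x j hd.ne']
    refine le_trans ?_ (key ((p' : ℝ) - k) _ _ (by linarith) (by linarith) hR.2 hT)
    gcongr
    rw [add_comm]
    exact norm_sub_le _ _

/-- The weight dominates the growth of the noise at distance `m` from an end point of the chord. -/
theorem mul_splitRatio_rpow_ge {ℓ u k : ℕ} (hu : u ≤ N) (hL : γ * N ≤ (u : ℝ) - ℓ) {m : ℝ}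
    (hm : 0 ≤ m) (hk : m * (γ * N / 2) ≤ ((k : ℝ) - ℓ) * ((u : ℝ) - k)) :
    γ / 2 * (m ^ α * (N : ℝ) ^ (1 - α)) ≤ ((u : ℝ) - ℓ) * splitRatio ℓ u k ^ α := by
  have hs := h.scale_pos
  have hN : (0 : ℝ) < N := by exact_mod_cast h.N_pos
  have hγ := h.γ_pos
  have hα := h.α_pos
  have hα1 := h.α_lt
  have huN : (u : ℝ) ≤ N := by exact_mod_cast hu
  have hl0 : (0 : ℝ) ≤ ℓ := Nat.cast_nonneg _
  set L := (u : ℝ) - ℓ with hLdef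
  have hL0 : 0 < L := by linarith
  have hLN : L ≤ N := by linarith
  have h1 : m * (γ / 2) / L ≤ splitRatio ℓ u k := by
    unfold splitRatio
    rw [← hLdef, div_le_div_iff₀ hL0 (by positivity)]
    have h2 : m * (γ / 2) * L ≤ m * (γ * N / 2) := by
      calc m * (γ / 2) * L ≤ m * (γ / 2) * N := by gcongr
        _ = _ := by ring
    nlinarith
  have h3 : (m * (γ / 2) / L) ^ α ≤ splitRatio ℓ u k ^ α :=
    Real.rpow_le_rpow (by positivity) h1 hα.le
  have h4 : L * (m * (γ / 2) / L) ^ α = m ^ α * (γ / 2) ^ α * L ^ (1 - α) := by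
    rw [Real.div_rpow (by positivity) hL0.le, Real.mul_rpow hm (by positivity), Real.rpow_sub hL0,
      Real.rpow_one]
    ring
  have h5 : (γ / 2) ^ α * (γ / 2) ^ (1 - α) = γ / 2 := by
    rw [← Real.rpow_add (by positivity), add_sub_cancel, Real.rpow_one]
  have h6 : (γ / 2) ^ (1 - α) * (N : ℝ) ^ (1 - α) ≤ L ^ (1 - α) := by
    rw [← Real.mul_rpow (by positivity) hN.le]
    exact Real.rpow_le_rpow (by positivity) (by linarith) (by linarith)
  calc γ / 2 * (m ^ α * (N : ℝ) ^ (1 - α)) =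
        m ^ α * (γ / 2) ^ α * ((γ / 2) ^ (1 - α) * (N : ℝ) ^ (1 - α)) := by
        nth_rewrite 1 [← h5]
        ring
    _ ≤ m ^ α * (γ / 2) ^ α * L ^ (1 - α) := by gcongr
    _ = L * (m * (γ / 2) / L) ^ α := h4.symm
    _ ≤ _ := by gcongr

/-- The deviation from a chord, after normalization by the weight, is bounded. -/
theorem norm_chordDefect_sq_le_weight {j p p' k ℓ u : ℕ} (hj : j ≤ n)
    (hp : NearAnchor n b ν B j p) (hp' : NearAnchor n b ν B (j + 1) p') (hpk : p ≤ k)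
    (hkp : k ≤ p') (hℓ : ℓ ≤ p) (hu : p' ≤ u) (huN : u ≤ N) :
    ‖chordDefect x p p' k‖ ^ 2 ≤
      8 * γ⁻¹ * roughConst K B c₀ * (((u : ℝ) - ℓ) * splitRatio ℓ u k ^ α) := by
  have hpk' : (p : ℝ) ≤ k := by exact_mod_cast hpk
  have hkp' : (k : ℝ) ≤ p' := by exact_mod_cast hkp
  have hℓ' : (ℓ : ℝ) ≤ p := by exact_mod_cast hℓ
  have hu' : (p' : ℝ) ≤ u := by exact_mod_cast hu
  have hg := h.near_gap hj hp hp'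
  have hs := h.scale_pos
  have hγ := h.γ_pos
  have hK1 := h.roughConst_nonneg'
  have hq := h.norm_chordDefect_sq_le hj hp hp' hpk hkp
  have fin : ∀ m : ℝ, 0 ≤ m → m * (γ * N / 2) ≤ ((k : ℝ) - ℓ) * ((u : ℝ) - k) →
      ‖chordDefect x p p' k‖ ^ 2 ≤
        4 * roughConst K B c₀ * (m ^ α * (N : ℝ) ^ (1 - α)) →
      ‖chordDefect x p p' k‖ ^ 2 ≤
        8 * γ⁻¹ * roughConst K B c₀ * (((u : ℝ) - ℓ) * splitRatio ℓ u k ^ α) := by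
    intro m hm hmk hq
    refine hq.trans ?_
    calc 4 * roughConst K B c₀ * (m ^ α * (N : ℝ) ^ (1 - α)) = 8 * γ⁻¹ * roughConst K B c₀ *
          (γ / 2 * (m ^ α * (N : ℝ) ^ (1 - α))) := by field_simp; ring
      _ ≤ _ := mul_le_mul_of_nonneg_left
        (h.mul_splitRatio_rpow_ge huN (by linarith) hm hmk) (by positivity)
  rcases le_total ((k : ℝ) - p) ((p' : ℝ) - k) with hc | hc
  · refine fin ((k : ℝ) - p) (by linarith) ?_ hq.1
    apply mul_le_mul <;> linarith
  · refine fin ((p' : ℝ) - k) (by linarith) ?_ hq.2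
    rw [mul_comm]
    apply mul_le_mul <;> linarith

/-- Without a break the weighted statistic stays bounded. -/
theorem weightedStat_le_of_null {j ℓ u k : ℕ} (hj : j ≤ n)
    (hℓ : NearAnchor n b ν B j ℓ) (hu : NearAnchor n b ν B (j + 1) u) (h1 : ℓ + 2 ≤ k)
    (h2 : k + 2 ≤ u) : weightedStat α x ℓ u k ≤ 8 * γ⁻¹ * roughConst K B c₀ := by
  have hlt : ℓ < u := by omega
  have hlt' : (ℓ : ℝ) < u := by exact_mod_cast hlt
  have huN := h.near_le_N (by omega) hu
  rw [weightedStat_eq α x h1 h2]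
  have hp := penalty_nonneg α x h1 h2
  have hq := h.norm_chordDefect_sq_le_weight (k := k) hj hℓ hu (by omega) (by omega) le_rfl le_rfl huN
  have hc := cusum_eq_combination x (ℓ := ℓ) (u := u) (p := ℓ) (p' := u) (k := k)
    (by linarith)
  rw [cusum_left, cusum_right x hlt, smul_zero, smul_zero, zero_add, zero_add] at hc
  have hw : 0 < ((u : ℝ) - ℓ) * splitRatio ℓ u k ^ α :=
    mul_pos (by linarith) (Real.rpow_pos_of_pos (splitRatio_pos (by omega) (by omega)) _)
  have : cusumStat α x ℓ u k ≤ 8 * γ⁻¹ * roughConst K B c₀ := by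
    unfold cusumStat
    rw [div_le_iff₀ hw, hc]
    exact hq
  linarith

end TameSample

end Sample

theorem energySeg_eq_empty {E : Type*} [NormedAddCommGroup E] {α τ : ℝ} {x : ℕ → E} {ℓ u : ℕ}
    (h : ∀ k, ℓ + 2 ≤ k → k + 2 ≤ u → weightedStat α x ℓ u k ≤ τ) :
    energySeg α τ x ℓ u = ∅ := by
  rw [energySeg]
  split_ifs with h1 h2
  · have h3 := sargmax_mem _ (splits_nonempty h1) (weightedStat α x ℓ u)
    rw [Finset.mem_Icc] at h3
    exact absurd h2 (not_lt.2 (h _ h3.1 (by unfold splitPoint; omega)))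
  · rfl
  · rfl

theorem weightedStat_le_splitPoint {E : Type*} [NormedAddCommGroup E] (α : ℝ) (x : ℕ → E)
    {ℓ u : ℕ} (h : ℓ + 4 < u) {k : ℕ} (h1 : ℓ + 2 ≤ k) (h2 : k + 2 ≤ u) :
    weightedStat α x ℓ u k ≤ weightedStat α x ℓ u (splitPoint α x ℓ u h) := by
  have h3 := (maximizers _ (weightedStat α x ℓ u)).min'_mem
    (maximizers_nonempty (splits_nonempty h) (weightedStat α x ℓ u))
  simp only [maximizers, Finset.mem_filter] at h3
  exact h3.2 k (Finset.mem_Icc.2 ⟨h1, by omega⟩)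

theorem splitPoint_bounds {E : Type*} [NormedAddCommGroup E] (α : ℝ) (x : ℕ → E)
    {ℓ u : ℕ} (h : ℓ + 4 < u) : ℓ + 2 ≤ splitPoint α x ℓ u h ∧ splitPoint α x ℓ u h + 2 ≤ u := by
  have h3 := sargmax_mem _ (splits_nonempty h) (weightedStat α x ℓ u)
  rw [Finset.mem_Icc] at h3
  unfold splitPoint
  omega

/-! ### Segments which contain breaks -/

section Segment

variable {E : Type*} [NormedAddCommGroup E] [InnerProductSpace ℝ E]
variable {α K B γ c₀ : ℝ} {n N : ℕ} {b : ℕ → ℕ} {ν e x : ℕ → E}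

/-- The segment `ℓ < i ≤ u` extends from an estimate of the anchor `b_a` to one of `b_{a'}`. -/
structure NearSegment (n : ℕ) (b : ℕ → ℕ) (ν : ℕ → E) (B : ℝ) (a a' ℓ u : ℕ) : Prop where
  lt : a < a'
  le : a' ≤ n + 1
  left : NearAnchor n b ν B a ℓ
  right : NearAnchor n b ν B a' u

/-- The end points of a segment and the true breaks between them. -/
def node (b : ℕ → ℕ) (a a' ℓ u i : ℕ) : ℕ := if i ≤ a then ℓ else if a' ≤ i then u else b i

variable {a a' ℓ u : ℕ}

theorem node_left : node b a a' ℓ u a = ℓ := if_pos le_rfl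

theorem node_right (h : a < a') : node b a a' ℓ u a' = u := by
  rw [node, if_neg (by omega), if_pos le_rfl]

theorem node_of_mem {i : ℕ} (h : a < i) (h' : i < a') : node b a a' ℓ u i = b i := by
  rw [node, if_neg (by omega), if_neg (by omega)]

theorem NearSegment.near_node (s : NearSegment n b ν B a a' ℓ u) {i : ℕ} (h1 : a ≤ i)
    (h2 : i ≤ a') : NearAnchor n b ν B i (node b a a' ℓ u i) := by
  rcases h1.eq_or_lt with rfl | h1
  · rw [node_left]
    exact s.left
  rcases h2.eq_or_lt with rfl | h2
  · rw [node_right s.lt]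
    exact s.right
  rw [node_of_mem h1 h2]
  exact Or.inl rfl

variable (h : TameSample α K B γ c₀ n N b ν e x) (s : NearSegment n b ν B a a' ℓ u)
include h s

theorem NearSegment.u_le : u ≤ N := h.near_le_N s.le s.right

theorem NearSegment.gap : (ℓ : ℝ) + γ * N ≤ u := h.near_gap_of_lt s.lt s.le s.left s.right

theorem NearSegment.length_le : (u : ℝ) - ℓ ≤ N := by
  have h1 : (u : ℝ) ≤ N := by exact_mod_cast s.u_le h
  have h2 : (0 : ℝ) ≤ ℓ := Nat.cast_nonneg _
  linarith

theorem NearSegment.node_gap {i : ℕ} (h1 : a ≤ i) (h2 : i < a') :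
    (node b a a' ℓ u i : ℝ) + γ * N ≤ node b a a' ℓ u (i + 1) :=
  h.near_gap (by have := s.le; omega) (s.near_node h1 h2.le) (s.near_node (by omega) h2)

theorem NearSegment.node_bounds {i : ℕ} (h1 : a ≤ i) (h2 : i ≤ a') :
    ℓ ≤ node b a a' ℓ u i ∧ node b a a' ℓ u i ≤ u := by
  have hs := h.scale_pos
  constructor
  · rcases h1.eq_or_lt with rfl | h1
    · rw [node_left]
    · have := h.near_gap_of_lt h1 (h2.trans s.le) s.left (s.near_node h1.le h2)
      have : (ℓ : ℝ) ≤ node b a a' ℓ u i := by linarith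
      exact_mod_cast this
  · rcases h2.eq_or_lt with rfl | h2
    · rw [node_right s.lt]
    · have := h.near_gap_of_lt h2 s.le (s.near_node h1 h2.le) s.right
      have : (node b a a' ℓ u i : ℝ) ≤ u := by linarith
      exact_mod_cast this

theorem NearSegment.break_gap {i : ℕ} (h1 : a < i) (h2 : i < a') :
    (ℓ : ℝ) + γ * N ≤ b i ∧ (b i : ℝ) + γ * N ≤ u :=
  ⟨h.near_gap_of_lt h1 (h2.le.trans s.le) s.left (Or.inl rfl),
    h.near_gap_of_lt h2 s.le (Or.inl rfl) s.right⟩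

theorem NearSegment.exists_node {k : ℕ} (h1 : ℓ ≤ k) (h2 : k ≤ u) :
    ∃ j, a ≤ j ∧ j < a' ∧ node b a a' ℓ u j ≤ k ∧ k ≤ node b a a' ℓ u (j + 1) := by
  by_contra! hcon
  have : ∀ j, a ≤ j → j ≤ a' → node b a a' ℓ u j ≤ k := by
    intro j hj
    induction j, hj using Nat.le_induction with
    | base => intro _; rw [node_left]; exact h1
    | succ j hj ih => intro h3; exact (hcon j hj h3 (ih (by omega))).le
  have h3 := hcon (a' - 1) (by have := s.lt; omega) (by have := s.lt; omega)
    (this _ (by have := s.lt; omega) (by omega))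
  rw [Nat.sub_add_cancel (by have := s.lt; omega), node_right s.lt] at h3
  omega

/-- Values at nodes are bounded by the maximum over the breaks, as they vanish at the ends. -/
theorem NearSegment.cusumStat_node_le {V : ℝ} (hV0 : 0 ≤ V)
    (hV : ∀ i, a < i → i < a' → cusumStat α x ℓ u (b i) ≤ V) {i : ℕ} (h1 : a ≤ i) (h2 : i ≤ a') :
    cusumStat α x ℓ u (node b a a' ℓ u i) ≤ V := by
  have hs := h.scale_pos
  have hlt : ℓ < u := by
    have := s.gap h
    have : (ℓ : ℝ) < u := by linarith
    exact_mod_cast this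
  rcases h1.eq_or_lt with rfl | h1
  · rw [node_left]
    simpa [cusumStat, cusum_left] using hV0
  rcases h2.eq_or_lt with rfl | h2
  · rw [node_right s.lt]
    simpa [cusumStat, cusum_right x hlt] using hV0
  rw [node_of_mem h1 h2]
  exact hV i h1 h2

/-- The means of the regimes in a segment differ from the overall mean by the size of the CUSUM
statistic and of the noise. -/
theorem NearSegment.norm_mean_sub_le {D : ℝ} (hD : 0 ≤ D)
    (hV : ∀ i, a < i → i < a' → cusumStat α x ℓ u (b i) ≤ ((u : ℝ) - ℓ) * D ^ 2) {j : ℕ}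
    (h1 : a ≤ j) (h2 : j < a') :
    γ * N * ‖ν j - ((u : ℝ) - ℓ)⁻¹ • (psum x u - psum x ℓ)‖ ≤
      2 * (N * D) + √(roughConst K B c₀ * N) := by
  have hs := h.scale_pos
  have hgap := s.gap h
  have hL0 : 0 < (u : ℝ) - ℓ := by linarith
  have hLN := s.length_le h
  have hlt : ℓ < u := by
    have : (ℓ : ℝ) < u := by linarith
    exact_mod_cast this
  have hcus : ∀ i, a ≤ i → i ≤ a' → ‖cusum x ℓ u (node b a a' ℓ u i)‖ ≤ N * D := by
    intro i hi1 hi2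
    obtain ⟨hb1, hb2⟩ := s.node_bounds h hi1 hi2
    have hs1 := splitRatio_nonneg hb1 hb2
    have hs2 := splitRatio_le ℓ u (node b a a' ℓ u i)
    have hs3 : splitRatio ℓ u (node b a a' ℓ u i) ^ α ≤ 1 :=
      Real.rpow_le_one hs1 (by linarith) h.α_pos.le
    have hle := s.cusumStat_node_le h (V := ((u : ℝ) - ℓ) * D ^ 2) (by positivity) hV hi1 hi2
    refine le_trans (le_of_sq_le_sq (b := ((u : ℝ) - ℓ) * D) ?_ (by positivity)) (by gcongr)
    rw [norm_cusum_sq α x hlt hb1 hb2]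
    calc _ ≤ (((u : ℝ) - ℓ) * 1) * (((u : ℝ) - ℓ) * D ^ 2) := by
          gcongr
          exact cusumStat_nonneg α x hb1 hb2
      _ = _ := by ring
  have hg := s.node_gap h h1 h2
  have hr := h.norm_rough_total_le (by have := s.le; omega) (s.near_node h1 h2.le)
    (s.near_node (by omega) h2)
  have hc1 := hcus j h1 h2.le
  have hc2 := hcus (j + 1) (by omega) h2
  set p := node b a a' ℓ u j with hp
  set p' := node b a a' ℓ u (j + 1) with hp'
  have e1 : ((p' : ℝ) - p) • (ν j - ((u : ℝ) - ℓ)⁻¹ • (psum x u - psum x ℓ)) =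
      cusum x ℓ u p' - cusum x ℓ u p - (roughPart ν e x j p' - roughPart ν e x j p) := by
    have e2 : cusum x ℓ u p' - cusum x ℓ u p = (psum x p' - psum x p) -
        (((p' : ℝ) - p) * ((u : ℝ) - ℓ)⁻¹) • (psum x u - psum x ℓ) := by
      unfold cusum
      rw [div_eq_mul_inv, div_eq_mul_inv]
      module
    rw [e2, psum_eq_roughPart ν e x j p', psum_eq_roughPart ν e x j p]
    module
  have h3 : ((p' : ℝ) - p) * ‖ν j - ((u : ℝ) - ℓ)⁻¹ • (psum x u - psum x ℓ)‖ ≤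
      2 * (N * D) + √(roughConst K B c₀ * N) := by
    have h4 := congrArg norm e1
    rw [norm_smul, Real.norm_of_nonneg (by linarith)] at h4
    rw [h4]
    refine (norm_sub_le _ _).trans ?_
    have := norm_sub_le (cusum x ℓ u p') (cusum x ℓ u p)
    linarith
  refine le_trans ?_ h3
  gcongr
  linarith

theorem NearSegment.norm_mean_sub_mean_le {D : ℝ} (hD : 0 ≤ D)
    (hV : ∀ i, a < i → i < a' → cusumStat α x ℓ u (b i) ≤ ((u : ℝ) - ℓ) * D ^ 2)
    (hr : 16 * roughConst K B c₀ ≤ (γ * c₀) ^ 2 * N) {i j : ℕ}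
    (hi1 : a ≤ i) (hi2 : i < a') (hj1 : a ≤ j) (hj2 : j < a') :
    γ * ‖ν i - ν j‖ ≤ 4 * D + γ * c₀ / 2 := by
  have hN : (0 : ℝ) < N := by exact_mod_cast h.N_pos
  have hγ := h.γ_pos
  have hc := h.c_pos
  have h1 := s.norm_mean_sub_le h hD hV hi1 hi2
  have h2 := s.norm_mean_sub_le h hD hV hj1 hj2
  have h3 : √(roughConst K B c₀ * N) ≤ γ * c₀ / 4 * N := by
    apply Real.sqrt_le_iff.2 ⟨by positivity, ?_⟩
    nlinarith
  have h4 := norm_sub_le_norm_sub_add_norm_sub (ν i)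
    (((u : ℝ) - ℓ)⁻¹ • (psum x u - psum x ℓ)) (ν j)
  rw [norm_sub_rev (((u : ℝ) - ℓ)⁻¹ • (psum x u - psum x ℓ)) (ν j)] at h4
  have h5 : γ * N * ‖ν i - ν j‖ ≤ (4 * D + γ * c₀ / 2) * N := by
    have := mul_le_mul_of_nonneg_left h4 h.scale_pos.le
    rw [mul_add] at this
    linarith
  nlinarith

/-- A break in the segment makes the signal strength `D` at least of the order of the minimal jump;
here `(u-ℓ) D²` is a bound for the CUSUM statistic at the breaks. -/
theorem NearSegment.le_signal {D : ℝ} (hD : 0 ≤ D) (haa : a + 2 ≤ a')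
    (hV : ∀ i, a < i → i < a' → cusumStat α x ℓ u (b i) ≤ ((u : ℝ) - ℓ) * D ^ 2)
    (hr : 16 * roughConst K B c₀ ≤ (γ * c₀) ^ 2 * N) : γ * c₀ / 8 ≤ D := by
  have h1 := s.norm_mean_sub_mean_le h hD hV hr (i := a + 1) (j := a) (by omega) (by omega) le_rfl
    (by omega)
  have h2 := h.model.jump a (by have := s.le; omega)
  have := mul_le_mul_of_nonneg_left h2 h.γ_pos.le
  linarith

/-- The signal strength `D` controls all jumps inside the segment. -/
theorem NearSegment.norm_mean_sub_mean_le' {D : ℝ} (hD : 0 ≤ D) (haa : a + 2 ≤ a')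
    (hV : ∀ i, a < i → i < a' → cusumStat α x ℓ u (b i) ≤ ((u : ℝ) - ℓ) * D ^ 2)
    (hr : 16 * roughConst K B c₀ ≤ (γ * c₀) ^ 2 * N) {i j : ℕ}
    (hi1 : a ≤ i) (hi2 : i < a') (hj1 : a ≤ j) (hj2 : j < a') :
    γ * ‖ν i - ν j‖ ≤ 8 * D := by
  have h1 := s.norm_mean_sub_mean_le h hD hV hr hi1 hi2 hj1 hj2
  have h2 := s.le_signal h hD haa hV hr
  linarith

/-- All means occurring in the segment, including the ones on the stray parts next to its ends. -/
theorem NearSegment.norm_obs_sub_sq_le {D : ℝ} (hD : 0 ≤ D) (haa : a + 2 ≤ a')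
    (hV : ∀ i, a < i → i < a' → cusumStat α x ℓ u (b i) ≤ ((u : ℝ) - ℓ) * D ^ 2)
    (hr : 16 * roughConst K B c₀ ≤ (γ * c₀) ^ 2 * N) {i : ℕ} (hi1 : ℓ < i) (hi2 : i ≤ u) :
    ‖x i - ν a‖ ^ 2 ≤ 2 * ‖e i‖ ^ 2 + (4 * B + 256 * γ⁻¹ ^ 2 * D ^ 2) := by
  have hγ := h.γ_pos
  have hs := h.scale_pos
  have hB := h.B_nonneg
  have hle := s.le
  have hmean : ∀ j, a ≤ j → j < a' → ‖ν j - ν a‖ ≤ 8 * γ⁻¹ * D := by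
    intro j h1 h2
    have := s.norm_mean_sub_mean_le' h hD haa hV hr h1 h2 le_rfl s.lt
    rw [mul_comm 8, mul_assoc, inv_mul_eq_div, le_div_iff₀ hγ]
    linarith
  have fin : ∀ m, x i = ν m + e i → ‖ν m - ν a‖ ^ 2 ≤ 2 * B + 128 * γ⁻¹ ^ 2 * D ^ 2 →
      ‖x i - ν a‖ ^ 2 ≤ 2 * ‖e i‖ ^ 2 + (4 * B + 256 * γ⁻¹ ^ 2 * D ^ 2) := by
    intro m hm1 hm2
    have h1 : ‖x i - ν a‖ ≤ ‖e i‖ + ‖ν m - ν a‖ := by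
      rw [hm1, show ν m + e i - ν a = e i + (ν m - ν a) by abel]
      exact norm_add_le _ _
    have h2 : ‖x i - ν a‖ ^ 2 ≤ (‖e i‖ + ‖ν m - ν a‖) ^ 2 := by gcongr
    nlinarith [sq_nonneg (‖e i‖ - ‖ν m - ν a‖)]
  have hi1' : (ℓ : ℝ) < i := by exact_mod_cast hi1
  have hi2' : (i : ℝ) ≤ u := by exact_mod_cast hi2
  rcases le_or_gt i (b a) with hia | hia
  · -- a stray part to the left of the anchor
    have hbd := s.left.bounds h.model hγ.le h.c_pos hB h.shift_le
    rcases s.left with hℓ | ⟨h0, hn, hBl⟩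
    · omega
    have h1 := hbd.1 (a - 1) (by omega) (by omega)
    have h2 : b (a - 1) < i := by
      have : (b (a - 1) : ℝ) < i := by linarith
      exact_mod_cast this
    refine fin (a - 1) (h.model.obs _ (by omega) i h2 (by rwa [Nat.sub_add_cancel h0])) ?_
    rw [norm_sub_rev]
    have := NearAnchor.norm_jump_sq_le (by omega : ℓ ≠ b a) hBl
    have : 0 ≤ 128 * γ⁻¹ ^ 2 * D ^ 2 := by positivity
    linarith
  rcases le_or_gt i (b a') with hia' | hia'
  · obtain ⟨j, hj1, hj2, hj3, hj4⟩ : ∃ j, a ≤ j ∧ j < a' ∧ b j < i ∧ i ≤ b (j + 1) := by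
      by_contra! hcon
      have : ∀ j, a ≤ j → j ≤ a' → b j < i := by
        intro j hj
        induction j, hj using Nat.le_induction with
        | base => intro _; exact hia
        | succ j hj ih => intro h3; exact hcon j hj h3 (ih (by omega))
      exact absurd (this a' s.lt.le le_rfl) (by omega)
    refine fin j (h.model.obs _ (by omega) i hj3 hj4) ?_
    have h1 := hmean j hj1 hj2
    have h2 : ‖ν j - ν a‖ ^ 2 ≤ (8 * γ⁻¹ * D) ^ 2 := by gcongr
    have : 0 ≤ γ⁻¹ ^ 2 * D ^ 2 := by positivity
    nlinarith
  · -- a stray part to the right of the anchor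
    have hbd := s.right.bounds h.model hγ.le h.c_pos hB h.shift_le
    rcases s.right with hu | ⟨h0, hn, hBr⟩
    · omega
    have h1 := hbd.2 hn
    have h2 : i ≤ b (a' + 1) := by
      have : (i : ℝ) ≤ b (a' + 1) := by linarith
      exact_mod_cast this
    refine fin a' (h.model.obs _ hn i hia' h2) ?_
    have h3 := NearAnchor.norm_jump_sq_le (by omega : u ≠ b a') hBr
    have h4 := hmean (a' - 1) (by omega) (by omega)
    have h5 : ‖ν a' - ν a‖ ≤ ‖ν a' - ν (a' - 1)‖ + ‖ν (a' - 1) - ν a‖ :=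
      norm_sub_le_norm_sub_add_norm_sub _ _ _
    have h6 : ‖ν (a' - 1) - ν a‖ ^ 2 ≤ (8 * γ⁻¹ * D) ^ 2 := by gcongr
    have h7 : ‖ν a' - ν a‖ ^ 2 ≤ (‖ν a' - ν (a' - 1)‖ + ‖ν (a' - 1) - ν a‖) ^ 2 := by gcongr
    nlinarith [sq_nonneg (‖ν a' - ν (a' - 1)‖ - ‖ν (a' - 1) - ν a‖)]

theorem NearSegment.norm_obs_sub_sq_le' {D : ℝ} (hD : 0 ≤ D) (haa : a + 2 ≤ a')
    (hV : ∀ i, a < i → i < a' → cusumStat α x ℓ u (b i) ≤ ((u : ℝ) - ℓ) * D ^ 2)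
    (hr : 16 * roughConst K B c₀ ≤ (γ * c₀) ^ 2 * N) {i : ℕ} (hi1 : ℓ < i) (hi2 : i ≤ u) :
    ‖x i - ν a‖ ^ 2 ≤ 2 * √(K * N) + (4 * B + 256 * γ⁻¹ ^ 2 * D ^ 2) := by
  refine (s.norm_obs_sub_sq_le h hD haa hV hr hi1 hi2).trans ?_
  have h1 := h.tame.four i (by omega) (hi2.trans (s.u_le h))
  have h2 : ‖e i‖ ^ 2 ≤ √(K * N) := by
    apply Real.le_sqrt_of_sq_le
    rw [← pow_mul]
    exact h1
  linarith

theorem NearSegment.sum_norm_obs_sub_sq_le {D : ℝ} (hD : 0 ≤ D) (haa : a + 2 ≤ a')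
    (hV : ∀ i, a < i → i < a' → cusumStat α x ℓ u (b i) ≤ ((u : ℝ) - ℓ) * D ^ 2)
    (hr : 16 * roughConst K B c₀ ≤ (γ * c₀) ^ 2 * N) :
    ∑ i ∈ Finset.Ioc ℓ u, ‖x i - ν a‖ ^ 2 ≤
      ((u : ℝ) - ℓ) * (2 * γ⁻¹ * K + (4 * B + 256 * γ⁻¹ ^ 2 * D ^ 2)) := by
  have hγ := h.γ_pos
  have hK := h.K_pos
  have hgap := s.gap h
  have hs := h.scale_pos
  have hlu : ℓ ≤ u := by
    have : (ℓ : ℝ) ≤ u := by linarith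
    exact_mod_cast this
  calc ∑ i ∈ Finset.Ioc ℓ u, ‖x i - ν a‖ ^ 2
      ≤ ∑ i ∈ Finset.Ioc ℓ u, (2 * ‖e i‖ ^ 2 + (4 * B + 256 * γ⁻¹ ^ 2 * D ^ 2)) :=
        Finset.sum_le_sum fun i hi => s.norm_obs_sub_sq_le h hD haa hV hr
          (Finset.mem_Ioc.1 hi).1 (Finset.mem_Ioc.1 hi).2
    _ = 2 * ∑ i ∈ Finset.Ioc ℓ u, ‖e i‖ ^ 2 +
        ((u : ℝ) - ℓ) * (4 * B + 256 * γ⁻¹ ^ 2 * D ^ 2) := by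
      rw [Finset.sum_add_distrib, ← Finset.mul_sum, Finset.sum_const, Nat.card_Ioc, nsmul_eq_mul,
        Nat.cast_sub hlu]
    _ ≤ 2 * (K * N) + ((u : ℝ) - ℓ) * (4 * B + 256 * γ⁻¹ ^ 2 * D ^ 2) := by
      gcongr
      refine le_trans (Finset.sum_le_sum_of_subset_of_nonneg ?_ fun _ _ _ => by positivity)
        h.tame.sum_sq
      intro i hi
      rw [Finset.mem_Ioc] at hi ⊢
      have := s.u_le h
      omega
    _ ≤ 2 * (K * (γ⁻¹ * ((u : ℝ) - ℓ))) +
        ((u : ℝ) - ℓ) * (4 * B + 256 * γ⁻¹ ^ 2 * D ^ 2) := by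
      gcongr
      rw [inv_mul_eq_div, le_div_iff₀ hγ]
      linarith
    _ = _ := by ring

end Segment

/-! ### The CUSUM statistic near and far from the breaks -/

section Dichotomy

variable {E : Type*} [NormedAddCommGroup E] [InnerProductSpace ℝ E]
variable {α K B γ c₀ : ℝ} {n N : ℕ} {b : ℕ → ℕ} {ν e x : ℕ → E}

/-- The curvature constant of the weighted CUSUM statistic. -/
def gain (α γ : ℝ) : ℝ := 2 * (2 ^ α - 1) * γ ^ 2

theorem gain_pos {α γ : ℝ} (hα : 0 < α) (hγ : 0 < γ) : 0 < gain α γ := by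
  have := two_rpow_sub_one_pos hα
  unfold gain
  positivity

theorem gain_le {α γ : ℝ} (hα0 : 0 < α) (hα : α ≤ 1) (hγ0 : 0 ≤ γ) (hγ : γ ≤ 1 / 2) :
    gain α γ ≤ 1 / 2 := by
  have h1 := two_rpow_sub_one_le hα
  have h0 := two_rpow_sub_one_pos hα0
  have h2 : γ ^ 2 ≤ (1 / 2) ^ 2 := by gcongr
  unfold gain
  nlinarith

/-- In the left half of a chord that starts at a break the chord defect is the local noise plus a
linear term with a small slope. -/
theorem TameSample.norm_chordDefect_le_of_left (h : TameSample α K B γ c₀ n N b ν e x)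
    {j p' k : ℕ} (hj : j ≤ n) (hp' : NearAnchor n b ν B (j + 1) p') (hjk : b j ≤ k)
    (hk : (k : ℝ) - b j ≤ (p' : ℝ) - k) :
    ‖chordDefect x (b j) p' k‖ ≤ ‖psum e k - psum e (b j)‖ +
      γ⁻¹ * (((k : ℝ) - b j) / N) * √(roughConst K B c₀ * N) := by
  have hs := h.scale_pos
  have hγ := h.γ_pos
  have hN : (0 : ℝ) < N := by exact_mod_cast h.N_pos
  have hg := h.near_gap hj (Or.inl rfl) hp'
  have hr := h.norm_rough_total_le hj (Or.inl rfl) hp'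
  have hjk' : (b j : ℝ) ≤ k := by exact_mod_cast hjk
  have hd := abs_le.1 (hp'.dist_le h.model h.c_pos h.B_nonneg)
  have hgap := h.model.gap j hj
  have hsh := h.shift_le
  have hk2 : k ≤ b (j + 1) := by
    have : (k : ℝ) ≤ b (j + 1) := by linarith
    exact_mod_cast this
  have e1 : roughPart ν e x j k - roughPart ν e x j (b j) = psum e k - psum e (b j) := by
    unfold roughPart
    rw [h.model.resid_eq hj hjk hk2]
    abel
  rw [chordDefect_eq ν e x j (by linarith), e1]
  refine (norm_sub_le _ _).trans ?_
  rw [norm_smul, Real.norm_of_nonneg (div_nonneg (by linarith) (by linarith))]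
  gcongr
  rw [inv_mul_eq_div, div_div, mul_comm (N : ℝ)]
  gcongr
  linarith

/-- The mirror image of `norm_chordDefect_le_of_left`. -/
theorem TameSample.norm_chordDefect_le_of_right (h : TameSample α K B γ c₀ n N b ν e x)
    {j p k : ℕ} (hj : j ≤ n) (hp : NearAnchor n b ν B j p) (hjk : k ≤ b (j + 1))
    (hk : (b (j + 1) : ℝ) - k ≤ (k : ℝ) - p) :
    ‖chordDefect x p (b (j + 1)) k‖ ≤ ‖psum e k - psum e (b (j + 1))‖ +
      γ⁻¹ * (((b (j + 1) : ℝ) - k) / N) * √(roughConst K B c₀ * N) := by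
  have hs := h.scale_pos
  have hγ := h.γ_pos
  have hN : (0 : ℝ) < N := by exact_mod_cast h.N_pos
  have hg := h.near_gap hj hp (Or.inl rfl)
  have hr := h.norm_rough_total_le hj hp (Or.inl rfl)
  have hjk' : (k : ℝ) ≤ b (j + 1) := by exact_mod_cast hjk
  have hd := abs_le.1 (hp.dist_le h.model h.c_pos h.B_nonneg)
  have hgap := h.model.gap j hj
  have hsh := h.shift_le
  have hk2 : b j ≤ k := by
    have : (b j : ℝ) ≤ k := by linarith
    exact_mod_cast this
  have e1 : roughPart ν e x j (b (j + 1)) - roughPart ν e x j k =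
      psum e (b (j + 1)) - psum e k := by
    unfold roughPart
    rw [h.model.resid_eq hj hk2 hjk, h.model.resid_eq hj (hk2.trans hjk) le_rfl]
    abel
  rw [chordDefect_eq' ν e x j (by linarith), e1, norm_sub_rev (psum e k)]
  refine ((norm_sub_le _ _).trans (add_comm _ _).le).trans ?_
  rw [norm_smul, Real.norm_of_nonneg (div_nonneg (by linarith) (by linarith))]
  gcongr
  rw [inv_mul_eq_div, div_div, mul_comm (N : ℝ)]
  gcongr
  linarith

variable {a a' ℓ u : ℕ}
variable (h : TameSample α K B γ c₀ n N b ν e x) (s : NearSegment n b ν B a a' ℓ u)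
include h s

/-- The effect of the chord defect `q` on the statistic at a point in the interior. -/
theorem NearSegment.defect_mul_le {D : ℝ} (hD : 0 ≤ D) {k : ℕ} (hk1 : γ * N / 2 ≤ (k : ℝ) - ℓ)
    (hk2 : γ * N / 2 ≤ (u : ℝ) - k) {q : ℝ} (hq : 0 ≤ q) :
    q / √(((u : ℝ) - ℓ) * splitRatio ℓ u k ^ α) * √(((u : ℝ) - ℓ) * D ^ 2) ≤
      2 * γ⁻¹ * q * D := by
  have hs := h.scale_pos
  have hγ := h.γ_pos
  have hγ1 := h.γ_le
  have hLN := s.length_le h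
  obtain ⟨L, hL⟩ : ∃ L : ℝ, L = (u : ℝ) - ℓ := ⟨_, rfl⟩
  have hL0 : 0 < L := by linarith
  have hsr : γ / 4 ≤ splitRatio ℓ u k := by
    unfold splitRatio
    rw [← hL]
    have hLN' : L ≤ N := by rw [hL]; exact hLN
    have hγL : γ * L ≤ γ * N := by gcongr
    rw [le_div_iff₀ (by positivity)]
    have e1 : γ / 4 * L ^ 2 = (γ * L / 2) * (L / 2) := by ring
    rw [e1]
    rcases le_total ((k : ℝ) - ℓ) ((u : ℝ) - k) with hc | hc
    · apply mul_le_mul <;> first | positivity | linarith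
    · rw [mul_comm]
      apply mul_le_mul <;> first | positivity | linarith
  have hsr' : γ / 4 ≤ splitRatio ℓ u k ^ α := by
    refine hsr.trans ?_
    have h1 := splitRatio_le ℓ u k
    have := Real.rpow_le_rpow_of_exponent_ge (x := splitRatio ℓ u k) (by linarith) (by linarith)
      h.α_lt.le
    rwa [Real.rpow_one] at this
  rw [← hL]
  set w := splitRatio ℓ u k ^ α with hw
  have hw0 : 0 < w := by linarith
  refine le_of_sq_le_sq ?_ (by positivity)
  rw [mul_pow, div_pow, Real.sq_sqrt (by positivity), Real.sq_sqrt (by positivity)]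
  have e2 : q ^ 2 / (L * w) * (L * D ^ 2) = q ^ 2 * D ^ 2 * w⁻¹ := by field_simp
  rw [e2]
  have h3 : w⁻¹ ≤ 4 * γ⁻¹ ^ 2 := by
    have h4 : w⁻¹ ≤ (γ / 4)⁻¹ := by gcongr
    have h5 : (γ / 4)⁻¹ = 4 * γ⁻¹ := by field_simp
    have h6 : 1 ≤ γ⁻¹ := (one_le_inv₀ hγ).2 (by linarith)
    nlinarith
  calc q ^ 2 * D ^ 2 * w⁻¹ ≤ q ^ 2 * D ^ 2 * (4 * γ⁻¹ ^ 2) := by gcongr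
    _ = _ := by ring

/-- The second alternative of `far_or_le_near` in terms of the distance to the break and the local
noise. -/
theorem NearSegment.near_bound {D : ℝ} (hD : 0 ≤ D) {k m : ℕ} {t d Δ q : ℝ}
    (hk1 : γ * N / 2 ≤ (k : ℝ) - ℓ) (hk2 : γ * N / 2 ≤ (u : ℝ) - k)
    (hd : |(k : ℝ) - b m| = d) (hdt : d = t * Δ) (hΔ : Δ ≤ (u : ℝ) - ℓ) (ht : 0 ≤ t) (hq : 0 ≤ q)
    (hqm : q ≤ ‖psum e k - psum e (b m)‖ + γ⁻¹ * (d / N) * √(roughConst K B c₀ * N))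
    (hcs : cusumStat α x ℓ u k ≤ cusumStat α x ℓ u (b m) -
      gain α γ / 8 * (t * (((u : ℝ) - ℓ) * D ^ 2)) +
        3 * (q / √(((u : ℝ) - ℓ) * splitRatio ℓ u k ^ α) * √(((u : ℝ) - ℓ) * D ^ 2))) :
    cusumStat α x ℓ u k ≤ cusumStat α x ℓ u (b m) -
      gain α γ / 8 * (|(k : ℝ) - b m| * D ^ 2) +
      6 * γ⁻¹ * D * (‖psum e k - psum e (b m)‖ +
        γ⁻¹ * (|(k : ℝ) - b m| / N) * √(roughConst K B c₀ * N)) := by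
  have hγ := h.γ_pos
  have hg0 := gain_pos h.α_pos h.γ_pos
  rw [hd]
  have h1 := s.defect_mul_le h hD hk1 hk2 hq
  have h2 : d * D ^ 2 ≤ t * (((u : ℝ) - ℓ) * D ^ 2) := by
    rw [hdt, mul_assoc]
    gcongr
  have h3 := mul_le_mul_of_nonneg_left h2 (by positivity : 0 ≤ gain α γ / 8)
  have h4 := mul_le_mul_of_nonneg_left hqm (by positivity : 0 ≤ 6 * γ⁻¹ * D)
  linarith

set_option maxHeartbeats 1000000 in
/-- A value of the CUSUM statistic is either far below the maximum over the breaks or close to a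
break with a large value, below which it drops linearly up to the local noise. -/
theorem NearSegment.far_or_near {D : ℝ} (hD : 0 < D)
    (hV : ∀ i, a < i → i < a' → cusumStat α x ℓ u (b i) ≤ ((u : ℝ) - ℓ) * D ^ 2)
    (hK : 8 * γ⁻¹ * roughConst K B c₀ ≤ (gain α γ / 96) ^ 2 * (((u : ℝ) - ℓ) * D ^ 2))
    {k : ℕ} (hk1 : ℓ < k) (hk2 : k < u) :
    cusumStat α x ℓ u k ≤ (1 - gain α γ / 32) * (((u : ℝ) - ℓ) * D ^ 2) ∨
      ∃ m, a < m ∧ m < a' ∧ ((u : ℝ) - ℓ) * D ^ 2 / 2 ≤ cusumStat α x ℓ u (b m) ∧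
        γ * N / 2 ≤ (k : ℝ) - ℓ ∧ γ * N / 2 ≤ (u : ℝ) - k ∧
        cusumStat α x ℓ u k ≤ cusumStat α x ℓ u (b m) -
          gain α γ / 8 * (|(k : ℝ) - b m| * D ^ 2) +
          6 * γ⁻¹ * D * (‖psum e k - psum e (b m)‖ +
            γ⁻¹ * (|(k : ℝ) - b m| / N) * √(roughConst K B c₀ * N)) := by
  have hs := h.scale_pos
  have hγ := h.γ_pos
  have hN : (0 : ℝ) < N := by exact_mod_cast h.N_pos
  have hgap := s.gap h
  have hLN := s.length_le h
  have huN := s.u_le h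
  have hle := s.le
  have hL0 : 0 < (u : ℝ) - ℓ := by linarith
  have hlu : ℓ < u := hk1.trans hk2
  obtain ⟨j, hj1, hj2, hj3, hj4⟩ := s.exists_node h hk1.le hk2.le
  have hng := s.node_gap h hj1 hj2
  have hb1 := s.node_bounds h hj1 hj2.le
  have hb2 := s.node_bounds h (i := j + 1) (by omega) hj2
  have hV0 : 0 < ((u : ℝ) - ℓ) * D ^ 2 := by positivity
  have hy1 := s.cusumStat_node_le h hV0.le hV hj1 hj2.le
  have hy2 := s.cusumStat_node_le h hV0.le hV (i := j + 1) (by omega) hj2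
  have hn1 := s.near_node hj1 hj2.le
  have hn2 := s.near_node (i := j + 1) (by omega) hj2
  have hq := h.norm_chordDefect_sq_le_weight (j := j) (k := k) (by omega) hn1 hn2 hj3 hj4 hb1.1
    hb2.2 huN
  have hnode1 : ∀ i, i = j → a < i → node b a a' ℓ u j = b i := by
    rintro i rfl hi
    exact node_of_mem hi hj2
  have hnode1' : j = a → node b a a' ℓ u j = ℓ := by
    rintro rfl
    exact node_left
  have hnode2 : j + 1 < a' → node b a a' ℓ u (j + 1) = b (j + 1) :=
    fun hi => node_of_mem (by omega) hi
  have hnode2' : j + 1 = a' → node b a a' ℓ u (j + 1) = u := by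
    intro hi
    rw [hi]
    exact node_right s.lt
  have hdef1 : j ≠ a → (k : ℝ) - node b a a' ℓ u j ≤ (node b a a' ℓ u (j + 1) : ℝ) - k →
      ‖chordDefect x (node b a a' ℓ u j) (node b a a' ℓ u (j + 1)) k‖ ≤
        ‖psum e k - psum e (b j)‖ +
          γ⁻¹ * (((k : ℝ) - b j) / N) * √(roughConst K B c₀ * N) := by
    intro hja hhalf
    have e1 := hnode1 j rfl (by omega)
    rw [e1] at hj3 hhalf ⊢
    exact h.norm_chordDefect_le_of_left (by omega) hn2 hj3 hhalf
  have hdef2 : j + 1 ≠ a' → (node b a a' ℓ u (j + 1) : ℝ) - k ≤ (k : ℝ) - node b a a' ℓ u j →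
      ‖chordDefect x (node b a a' ℓ u j) (node b a a' ℓ u (j + 1)) k‖ ≤
        ‖psum e k - psum e (b (j + 1))‖ +
          γ⁻¹ * (((b (j + 1) : ℝ) - k) / N) * √(roughConst K B c₀ * N) := by
    intro hja hhalf
    have e1 := hnode2 (by omega)
    rw [e1] at hj4 hhalf ⊢
    exact h.norm_chordDefect_le_of_right (by omega) hn1 hj4 hhalf
  set p := node b a a' ℓ u j with hp
  set p' := node b a a' ℓ u (j + 1) with hp'
  set q := ‖chordDefect x p p' k‖ with hqdef
  have hq0 : 0 ≤ q := norm_nonneg _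
  set W := ((u : ℝ) - ℓ) * splitRatio ℓ u k ^ α with hW
  have hW0 : 0 < W := mul_pos hL0 (Real.rpow_pos_of_pos (splitRatio_pos hk1 hk2) _)
  clear_value W q p p'
  have hp0 : (ℓ : ℝ) ≤ p := by exact_mod_cast hb1.1
  have hp1 : (p : ℝ) ≤ k := by exact_mod_cast hj3
  have hp2 : (k : ℝ) ≤ p' := by exact_mod_cast hj4
  have hp3 : (p' : ℝ) ≤ u := by exact_mod_cast hb2.2
  have hd0 : 0 < (p' : ℝ) - p := by linarith
  have hpp : p < p' := by
    have : (p : ℝ) < p' := by linarith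
    exact_mod_cast this
  obtain ⟨t, ht⟩ : ∃ t : ℝ, t = ((k : ℝ) - p) / ((p' : ℝ) - p) := ⟨_, rfl⟩
  have ht0 : 0 ≤ t := by rw [ht]; exact div_nonneg (by linarith) hd0.le
  have ht1 : t ≤ 1 := by rw [ht, div_le_one hd0]; linarith
  have htk : (k : ℝ) - p = t * ((p' : ℝ) - p) := by rw [ht, div_mul_cancel₀ _ hd0.ne']
  have htk' : (p' : ℝ) - k = (1 - t) * ((p' : ℝ) - p) := by linarith
  have hρ2 : q ^ 2 ≤ (q / √W) ^ 2 * W := by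
    rw [div_pow, Real.sq_sqrt hW0.le, div_mul_cancel₀ _ hW0.ne']
  have hρ0 : 0 ≤ q / √W := by positivity
  have hg0 := gain_pos h.α_pos h.γ_pos
  have hg1 := gain_le h.α_pos h.α_lt.le h.γ_pos.le h.γ_le
  have hρ1 : q / √W ≤ gain α γ / 96 * √(((u : ℝ) - ℓ) * D ^ 2) := by
    refine le_of_sq_le_sq ?_ (by positivity)
    rw [mul_pow, Real.sq_sqrt hV0.le, div_pow, Real.sq_sqrt hW0.le]
    refine le_trans ?_ hK
    rwa [div_le_iff₀ hW0]
  have hmain := cusumStat_le_of_chordDefect h.α_pos h.α_lt.le x hb1.1 hj3 hpp hj4 hb2.2 hk1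
    hk2 ht rfl hρ0 (by rw [← hqdef, ← hW]; exact hρ2)
  have hya := cusumStat_nonneg α x hb1.1 hb1.2
  have hyb := cusumStat_nonneg α x hb2.1 hb2.2
  have hlerp : 0 ≤ (1 - t) * cusumStat α x ℓ u p + t * cusumStat α x ℓ u p' :=
    add_nonneg (mul_nonneg (by linarith) hya) (mul_nonneg ht0 hyb)
  -- the chord covers at least the proportion `γ` of the segment
  have hcur : gain α γ * (t * (1 - t)) ≤
      2 * (2 ^ α - 1) * (t * (1 - t) * (((p' : ℝ) - p) / ((u : ℝ) - ℓ)) ^ 2) := by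
    have h1 : γ ≤ ((p' : ℝ) - p) / ((u : ℝ) - ℓ) := by
      rw [le_div_iff₀ hL0]
      nlinarith
    have h2 := two_rpow_sub_one_pos h.α_pos
    have h3 : 0 ≤ t * (1 - t) := mul_nonneg ht0 (by linarith)
    calc gain α γ * (t * (1 - t)) = 2 * (2 ^ α - 1) * (t * (1 - t) * γ ^ 2) := by
          unfold gain; ring
      _ ≤ _ := by gcongr
  have hcur1 : 2 * (2 ^ α - 1) * (t * (1 - t) * (((p' : ℝ) - p) / ((u : ℝ) - ℓ)) ^ 2) ≤ 1 := by
    have h1 : ((p' : ℝ) - p) / ((u : ℝ) - ℓ) ≤ 1 := by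
      rw [div_le_one hL0]
      linarith
    have h1' : 0 ≤ ((p' : ℝ) - p) / ((u : ℝ) - ℓ) := by positivity
    have h2 : (((p' : ℝ) - p) / ((u : ℝ) - ℓ)) ^ 2 ≤ 1 := pow_le_one₀ h1' h1
    have h3 := two_rpow_sub_one_le h.α_lt.le
    have h4 := two_rpow_sub_one_pos h.α_pos
    have h5 : 0 ≤ t * (1 - t) := mul_nonneg ht0 (by linarith)
    have h6 : t * (1 - t) ≤ 1 / 4 := by nlinarith [sq_nonneg (t - 1 / 2)]
    calc _ ≤ 2 * 1 * (1 / 4 * (1 : ℝ)) := by gcongr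
      _ ≤ 1 := by norm_num
  have hA0 := mul_nonneg (sub_nonneg.2 hcur1) hlerp
  have hA1 : (1 - 2 * (2 ^ α - 1) * (t * (1 - t) * (((p' : ℝ) - p) / ((u : ℝ) - ℓ)) ^ 2)) *
      ((1 - t) * cusumStat α x ℓ u p + t * cusumStat α x ℓ u p') ≤
      (1 - gain α γ * (t * (1 - t))) *
        ((1 - t) * cusumStat α x ℓ u p + t * cusumStat α x ℓ u p') := by
    gcongr
  -- `far_or_le_near` at the nearer end of the chord, which is a break as `Y` vanishes at `ℓ` and `u`
  rcases le_total t (1 / 2) with hth | hth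
  · have hhalf : (k : ℝ) - p ≤ (p' : ℝ) - k := by
      rw [htk, htk']
      gcongr
      linarith
    rcases far_or_le_near hg0.le hg1 ht0 hth hya hy1 hyb hy2 hA0 hA1 hρ0 hρ1 hmain with hc | ⟨hc1, hc2⟩
    · exact Or.inl hc
    · have hja : j ≠ a := by
        intro hja
        rw [hnode1' hja] at hc1
        have : cusumStat α x ℓ u ℓ = 0 := by simp [cusumStat, cusum_left]
        linarith
      have e1 := hnode1 j rfl (by omega)
      have hbg := s.break_gap h (i := j) (by omega) hj2
      refine Or.inr ⟨j, by omega, hj2, ?_, ?_, ?_, ?_⟩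
      · rw [← e1]; exact hc1
      · rw [← e1] at hbg
        linarith
      · linarith
      · refine s.near_bound h hD.le (t := t) (Δ := (p' : ℝ) - p) (q := q) ?_ ?_ rfl ?_ (by linarith)
          ht0 hq0 ?_ ?_
        · rw [← e1] at hbg
          linarith
        · linarith
        · rw [← e1, abs_of_nonneg (by linarith), htk]
        · rw [abs_of_nonneg (by rw [← e1]; linarith)]
          exact hdef1 hja hhalf
        · rw [← e1, ← hW]
          exact hc2
  · have hhalf : (p' : ℝ) - k ≤ (k : ℝ) - p := by
      rw [htk, htk']
      gcongr
      linarith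
    have hlerp' : (1 - gain α γ * (t * (1 - t))) *
        ((1 - t) * cusumStat α x ℓ u p + t * cusumStat α x ℓ u p') =
        (1 - gain α γ * ((1 - t) * (1 - (1 - t)))) *
        ((1 - (1 - t)) * cusumStat α x ℓ u p' + (1 - t) * cusumStat α x ℓ u p) := by ring
    rw [hlerp'] at hA1
    rcases far_or_le_near hg0.le hg1 (by linarith) (by linarith) hyb hy2 hya hy1 hA0 hA1 hρ0 hρ1
      hmain with hc | ⟨hc1, hc2⟩
    · exact Or.inl hc
    · have hja : j + 1 ≠ a' := by
        intro hja
        rw [hnode2' hja] at hc1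
        have : cusumStat α x ℓ u u = 0 := by simp [cusumStat, cusum_right x hlu]
        linarith
      have e1 := hnode2 (by omega)
      have hbg := s.break_gap h (i := j + 1) (by omega) (by omega)
      refine Or.inr ⟨j + 1, by omega, by omega, ?_, ?_, ?_, ?_⟩
      · rw [← e1]; exact hc1
      · linarith
      · rw [← e1] at hbg
        linarith
      · refine s.near_bound h hD.le (t := 1 - t) (Δ := (p' : ℝ) - p) (q := q) ?_ ?_ rfl ?_
          (by linarith) (by linarith) hq0 ?_ ?_
        · linarith
        · rw [← e1] at hbg
          linarith
        · rw [← e1, abs_of_nonpos (by linarith), ← htk']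
          ring
        · rw [abs_of_nonpos (by rw [← e1]; linarith), neg_sub]
          exact hdef2 hja hhalf
        · rw [← e1, ← hW]
          exact hc2

end Dichotomy

/-! ### Localization of the split point -/

section Localization

variable {E : Type*} [NormedAddCommGroup E] [InnerProductSpace ℝ E]
variable {α K B γ c₀ : ℝ} {n N : ℕ} {b : ℕ → ℕ} {ν e x : ℕ → E}

/-- The sample size `N` is large in comparison with the noise scale `K` and the tolerance `B`, and
the latter dominates `K²`: `rough_le` makes the chord defects small in comparison with the signal,
`noise_le` does this for the penalty, and `tol_ge` is the accuracy that the local noise allows. -/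
structure Calibrated (α K B γ c₀ : ℝ) (N : ℕ) : Prop where
  rough_le : roughConst K B c₀ ≤ (gain α γ * γ ^ 3 * c₀) ^ 2 / 5000000 * N
  noise_le : (√(K * N) + K + B + 1) * (1 + 64 / (γ * c₀) ^ 2) ≤ gain α γ * γ ^ 9 / 2 ^ 30 * N
  tol_ge : 64 * γ⁻¹ ^ 2 * (K ^ 2 / ((gain α γ * γ / 192) ^ 4 * (γ * c₀ / 8) ^ 2)) ≤ B
  long : 4 ≤ γ ^ 2 * N

variable {a a' ℓ u : ℕ}
variable (h : TameSample α K B γ c₀ n N b ν e x)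
include h

theorem TameSample.gain_bounds : 0 < gain α γ ∧ gain α γ ≤ 1 / 2 :=
  ⟨gain_pos h.α_pos h.γ_pos, gain_le h.α_pos h.α_lt.le h.γ_pos.le h.γ_le⟩

variable (hcal : Calibrated α K B γ c₀ N)
include hcal

theorem TameSample.rough_le_jump : 16 * roughConst K B c₀ ≤ (γ * c₀) ^ 2 * N := by
  obtain ⟨g0, g1⟩ := h.gain_bounds
  have hγ := h.γ_pos
  have hγ1 := h.γ_le
  have hc := h.c_pos
  have h1 := hcal.rough_le
  have h2 : gain α γ * γ ^ 3 * c₀ ≤ 1 * (γ * c₀) := by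
    have h3 : gain α γ * γ ^ 2 ≤ 1 := mul_le_one₀ (by linarith) (by positivity)
      (pow_le_one₀ hγ.le (by linarith))
    calc gain α γ * γ ^ 3 * c₀ = gain α γ * γ ^ 2 * (γ * c₀) := by ring
      _ ≤ _ := by gcongr
  have h4 : (gain α γ * γ ^ 3 * c₀) ^ 2 ≤ (1 * (γ * c₀)) ^ 2 := by gcongr
  have hN : (0 : ℝ) ≤ N := Nat.cast_nonneg _
  have h5 := mul_le_mul_of_nonneg_right h4 hN
  have h6 : 0 ≤ (γ * c₀) ^ 2 * N := by positivity
  linarith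

/-- The bound on normalized chord defects is small in comparison with the signal `L D²`. -/
theorem TameSample.rough_le_signal {D L : ℝ} (hD : γ * c₀ / 8 ≤ D) (hL : γ * N ≤ L) :
    8 * γ⁻¹ * roughConst K B c₀ ≤ (gain α γ / 96) ^ 2 * (L * D ^ 2) := by
  obtain ⟨g0, g1⟩ := h.gain_bounds
  have hγ := h.γ_pos
  have hγ1 := h.γ_le
  have hc := h.c_pos
  have hN : (0 : ℝ) ≤ N := Nat.cast_nonneg _
  have hL0 : 0 < L := h.scale_pos.trans_le hL
  have h1 : 8 * γ⁻¹ * roughConst K B c₀ ≤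
      8 * γ⁻¹ * ((gain α γ * γ ^ 3 * c₀) ^ 2 / 5000000 * N) := by
    gcongr
    exact hcal.rough_le
  refine h1.trans ?_
  have e1 : 8 * γ⁻¹ * ((gain α γ * γ ^ 3 * c₀) ^ 2 / 5000000 * N) =
      8 / 5000000 * γ ^ 2 * (gain α γ ^ 2 * (γ ^ 3 * c₀ ^ 2 * N)) := by
    field_simp
  have e2 : (gain α γ / 96) ^ 2 * (γ * N * (γ * c₀ / 8) ^ 2) =
      1 / 589824 * (gain α γ ^ 2 * (γ ^ 3 * c₀ ^ 2 * N)) := by ring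
  have h2 : (gain α γ / 96) ^ 2 * (γ * N * (γ * c₀ / 8) ^ 2) ≤
      (gain α γ / 96) ^ 2 * (L * D ^ 2) := by gcongr
  refine le_trans ?_ h2
  rw [e1, e2]
  gcongr
  have : γ ^ 2 ≤ 1 := pow_le_one₀ hγ.le (by linarith)
  linarith

/-- All terms of the penalty are small in comparison with `N D²`; the factor `Q`
is a multiple of `D²` which dominates both `1` and `D²`, as `D` is bounded from below. -/
theorem TameSample.noise_mul_le {D : ℝ} (hD : γ * c₀ / 8 ≤ D) :
    ∃ Q : ℝ, 1 ≤ Q ∧ D ^ 2 ≤ Q ∧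
      (√(K * N) + K + B + 1) * Q ≤ gain α γ * γ ^ 9 / 2 ^ 30 * N * D ^ 2 := by
  have hγ := h.γ_pos
  have hc := h.c_pos
  have hD2 : (γ * c₀ / 8) ^ 2 ≤ D ^ 2 := by gcongr
  have h1 : 1 ≤ 64 / (γ * c₀) ^ 2 * D ^ 2 := by
    rw [div_mul_eq_mul_div, le_div_iff₀ (by positivity)]
    nlinarith
  refine ⟨(1 + 64 / (γ * c₀) ^ 2) * D ^ 2, ?_, ?_, ?_⟩
  · nlinarith
  · nlinarith
  · rw [← mul_assoc]
    exact mul_le_mul_of_nonneg_right hcal.noise_le (sq_nonneg _)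

/-- At a distance `d` from the break with `d D²` beyond the accuracy, the local noise is small in
comparison with `d D`. -/
theorem TameSample.norm_local_le {D : ℝ} (hD : γ * c₀ / 8 ≤ D) {m k : ℕ} (hm : m ≤ n + 1)
    (hk : k ≤ N)
    (hd : K ^ 2 / ((gain α γ * γ / 192) ^ 4 * (γ * c₀ / 8) ^ 2) ≤ |(k : ℝ) - b m| * D ^ 2) :
    ‖psum e k - psum e (b m)‖ ≤ gain α γ * γ / 192 * (|(k : ℝ) - b m| * D) := by
  obtain ⟨g0, g1⟩ := h.gain_bounds
  have hγ := h.γ_pos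
  have hc := h.c_pos
  have hD0 : 0 < D := lt_of_lt_of_le (by positivity) hD
  have h1 := h.tame.local' m hm k hk
  have hd0 := abs_nonneg ((k : ℝ) - b m)
  obtain ⟨d, hdd⟩ : ∃ d : ℝ, d = |(k : ℝ) - b m| := ⟨_, rfl⟩
  obtain ⟨δ, hδ⟩ : ∃ δ : ℝ, δ = gain α γ * γ / 192 := ⟨_, rfl⟩
  have hδ0 : 0 < δ := by rw [hδ]; positivity
  rw [← hdd] at hd0 h1 hd ⊢
  rw [← hδ] at hd ⊢
  have hD2 : (γ * c₀ / 8) ^ 2 ≤ D ^ 2 := by gcongr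
  refine le_of_pow_le_pow_left₀ (n := 4) (by norm_num) (by positivity) (h1.trans ?_)
  rw [div_le_iff₀ (by positivity)] at hd
  calc K ^ 2 * d ^ 3 ≤ (d * D ^ 2 * (δ ^ 4 * (γ * c₀ / 8) ^ 2)) * d ^ 3 := by gcongr
    _ ≤ (d * D ^ 2 * (δ ^ 4 * D ^ 2)) * d ^ 3 := by gcongr
    _ = (δ * (d * D)) ^ 4 := by ring

theorem TameSample.slope_le {D : ℝ} (hD : γ * c₀ / 8 ≤ D) {d : ℝ} (hd : 0 ≤ d) :
    γ⁻¹ * (d / N) * √(roughConst K B c₀ * N) ≤ gain α γ * γ / 192 * (d * D) := by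
  obtain ⟨g0, g1⟩ := h.gain_bounds
  have hγ := h.γ_pos
  have hc := h.c_pos
  have hN : (0 : ℝ) < N := by exact_mod_cast h.N_pos
  have h1 : √(roughConst K B c₀ * N) ≤ gain α γ * γ ^ 3 * c₀ / 1536 * N := by
    apply Real.sqrt_le_iff.2 ⟨by positivity, ?_⟩
    have h2 := mul_le_mul_of_nonneg_right hcal.rough_le hN.le
    refine h2.trans ?_
    have : 0 ≤ (gain α γ * γ ^ 3 * c₀) ^ 2 * N ^ 2 := by positivity
    nlinarith
  calc γ⁻¹ * (d / N) * √(roughConst K B c₀ * N) ≤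
        γ⁻¹ * (d / N) * (gain α γ * γ ^ 3 * c₀ / 1536 * N) := by gcongr
    _ = gain α γ * γ / 192 * (d * (γ * c₀ / 8)) := by field_simp; ring
    _ ≤ _ := by gcongr

variable (s : NearSegment n b ν B a a' ℓ u)
include s

/-- The penalty at a break is small in comparison with the signal. -/
theorem NearSegment.penalty_break_le {D : ℝ} (hD : γ * c₀ / 8 ≤ D) (haa : a + 2 ≤ a')
    (hV : ∀ i, a < i → i < a' → cusumStat α x ℓ u (b i) ≤ ((u : ℝ) - ℓ) * D ^ 2) {m : ℕ}
    (hm1 : a < m) (hm2 : m < a') :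
    penalty α x ℓ u (b m) ≤ gain α γ / 64 * (((u : ℝ) - ℓ) * D ^ 2) := by
  obtain ⟨g0, g1⟩ := h.gain_bounds
  have hγ := h.γ_pos
  have hγ1 := h.γ_le
  have hc := h.c_pos
  have hN : (0 : ℝ) < N := by exact_mod_cast h.N_pos
  have hK := h.K_pos
  have hB := h.B_nonneg
  have hD0 : 0 < D := lt_of_lt_of_le (by positivity) hD
  have hgap := s.gap h
  have hs := h.scale_pos
  have hLN := s.length_le h
  have hbg := s.break_gap h hm1 hm2
  have hγL : γ * ((u : ℝ) - ℓ) ≤ γ * N := by gcongr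
  have hlong := hcal.long
  have hγ2 : γ * (γ * N) ≤ γ * ((u : ℝ) - ℓ) := by
    gcongr
    linarith
  have hL0 : 0 < (u : ℝ) - ℓ := by linarith
  have h1 := penalty_le (α := α) (by linarith [h.α_lt]) hγ x (k := b m) (by nlinarith)
    (by linarith) (by linarith) (s.sum_norm_obs_sub_sq_le h hD0.le haa hV (h.rough_le_jump hcal))
  rw [mul_div_cancel_left₀ _ hL0.ne'] at h1
  refine h1.trans ?_
  obtain ⟨Q, hQ1, hQ2, hQ3⟩ := h.noise_mul_le hcal hD
  obtain ⟨y, hy⟩ : ∃ y : ℝ, y = γ⁻¹ := ⟨_, rfl⟩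
  have hy1 : 1 ≤ y := by rw [hy]; exact (one_le_inv₀ hγ).2 (by linarith)
  have hyγ : y * γ = 1 := by rw [hy]; field_simp
  rw [← hy]
  have hsq : 0 ≤ √(K * N) := Real.sqrt_nonneg _
  have h2 : 2 * y ^ 2 * (2 * y * K + (4 * B + 256 * y ^ 2 * D ^ 2)) ≤
      512 * y ^ 4 * ((√(K * N) + K + B + 1) * Q) := by
    have hy3 : y ^ 3 ≤ y ^ 4 := pow_le_pow_right₀ hy1 (by norm_num)
    have hy2 : y ^ 2 ≤ y ^ 4 := pow_le_pow_right₀ hy1 (by norm_num)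
    have hy4 : 0 ≤ y ^ 4 := by positivity
    calc 2 * y ^ 2 * (2 * y * K + (4 * B + 256 * y ^ 2 * D ^ 2))
        = 4 * y ^ 3 * K + 8 * y ^ 2 * B + 512 * y ^ 4 * D ^ 2 := by ring
      _ ≤ 512 * y ^ 4 * (K * Q) + 512 * y ^ 4 * (B * Q) + 512 * y ^ 4 * Q +
          512 * y ^ 4 * (√(K * N) * Q) := by
        have i1 : 4 * y ^ 3 * K ≤ 512 * y ^ 4 * (K * Q) := by
          have : K ≤ K * Q := le_mul_of_one_le_right hK.le hQ1
          gcongr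
          linarith
        have i2 : 8 * y ^ 2 * B ≤ 512 * y ^ 4 * (B * Q) := by
          have : B ≤ B * Q := le_mul_of_one_le_right hB hQ1
          gcongr
          linarith
        have i3 : 512 * y ^ 4 * D ^ 2 ≤ 512 * y ^ 4 * Q := by gcongr
        have i4 : 0 ≤ 512 * y ^ 4 * (√(K * N) * Q) := by positivity
        linarith
      _ = _ := by ring
  refine h2.trans ?_
  have h3 : 512 * y ^ 4 * ((√(K * N) + K + B + 1) * Q) ≤
      512 * y ^ 4 * (gain α γ * γ ^ 9 / 2 ^ 30 * N * D ^ 2) := by gcongr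
  refine h3.trans ?_
  have e1 : 512 * y ^ 4 * (gain α γ * γ ^ 9 / 2 ^ 30 * N * D ^ 2) =
      512 / 2 ^ 30 * (y * γ) ^ 4 * γ ^ 4 * (gain α γ * (γ * N * D ^ 2)) := by ring
  have hγ4 : γ ^ 4 ≤ 1 := pow_le_one₀ hγ.le (by linarith)
  rw [e1, hyγ]
  have e2 : gain α γ / 64 * (((u : ℝ) - ℓ) * D ^ 2) =
      1 / 64 * (gain α γ * (((u : ℝ) - ℓ) * D ^ 2)) := by ring
  rw [e2]
  gcongr
  · norm_num
    linarith
  · linarith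

/-- Near a break the penalty varies less than the drop of the CUSUM statistic. -/
theorem NearSegment.penalty_le_near {D : ℝ} (hD : γ * c₀ / 8 ≤ D) (haa : a + 2 ≤ a')
    (hV : ∀ i, a < i → i < a' → cusumStat α x ℓ u (b i) ≤ ((u : ℝ) - ℓ) * D ^ 2) {m k : ℕ}
    (hm1 : a < m) (hm2 : m < a') (hk1 : γ * N / 2 ≤ (k : ℝ) - ℓ)
    (hk2 : γ * N / 2 ≤ (u : ℝ) - k) :
    penalty α x ℓ u (b m) ≤
      penalty α x ℓ u k + gain α γ / 32 * (|(k : ℝ) - b m| * D ^ 2) := by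
  obtain ⟨g0, g1⟩ := h.gain_bounds
  have hγ := h.γ_pos
  have hγ1 := h.γ_le
  have hc := h.c_pos
  have hN : (0 : ℝ) < N := by exact_mod_cast h.N_pos
  have hK := h.K_pos
  have hB := h.B_nonneg
  have hD0 : 0 < D := lt_of_lt_of_le (by positivity) hD
  have hgap := s.gap h
  have hs := h.scale_pos
  have hLN := s.length_le h
  have hbg := s.break_gap h hm1 hm2
  have hγL : γ * ((u : ℝ) - ℓ) ≤ γ * N := by gcongr
  have hlong := hcal.long
  have hγ2 : γ * (γ * N) ≤ γ * ((u : ℝ) - ℓ) := by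
    gcongr
    linarith
  have hL0 : 0 < (u : ℝ) - ℓ := by linarith
  have hr := h.rough_le_jump hcal
  have h1 := penalty_le_add (γ := γ / 2) h.α_pos (by linarith [h.α_lt]) (by positivity) x
    (k := k) (k' := b m) (by nlinarith)
    (by linarith) (by linarith) (by linarith) (by linarith)
    (fun i hi => s.norm_obs_sub_sq_le' h hD0.le haa hV hr (Finset.mem_Ioc.1 hi).1
      (Finset.mem_Ioc.1 hi).2) (s.sum_norm_obs_sub_sq_le h hD0.le haa hV hr)
  rw [mul_div_cancel_left₀ _ hL0.ne'] at h1
  refine h1.trans (add_le_add le_rfl ?_)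
  obtain ⟨Q, hQ1, hQ2, hQ3⟩ := h.noise_mul_le hcal hD
  obtain ⟨d, hd⟩ : ∃ d : ℝ, d = |(k : ℝ) - b m| := ⟨_, rfl⟩
  have hd0 : 0 ≤ d := by rw [hd]; positivity
  obtain ⟨y, hy⟩ : ∃ y : ℝ, y = γ⁻¹ := ⟨_, rfl⟩
  have hy1 : 1 ≤ y := by rw [hy]; exact (one_le_inv₀ hγ).2 (by linarith)
  have hyγ : y * γ = 1 := by rw [hy]; field_simp
  have ey : (γ / 2)⁻¹ = 2 * y := by rw [hy]; field_simp
  rw [ey, ← hd, ← hy]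
  have hsq : 0 ≤ √(K * N) := Real.sqrt_nonneg _
  have h2 : 2 * √(K * N) + (4 * B + 256 * y ^ 2 * D ^ 2) +
      (2 * y * K + (4 * B + 256 * y ^ 2 * D ^ 2)) ≤
      512 * y ^ 2 * ((√(K * N) + K + B + 1) * Q) := by
    have hy2 : y ≤ y ^ 2 := by nlinarith
    have hy3 : 1 ≤ y ^ 2 := hy1.trans hy2
    calc 2 * √(K * N) + (4 * B + 256 * y ^ 2 * D ^ 2) +
          (2 * y * K + (4 * B + 256 * y ^ 2 * D ^ 2))
        = 2 * 1 * √(K * N) + 8 * 1 * B + 2 * y * K + 512 * y ^ 2 * D ^ 2 := by ring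
      _ ≤ 512 * y ^ 2 * (√(K * N) * Q) + 512 * y ^ 2 * (B * Q) + 512 * y ^ 2 * (K * Q) +
          512 * y ^ 2 * Q := by
        have i1 : K ≤ K * Q := le_mul_of_one_le_right hK.le hQ1
        have i2 : B ≤ B * Q := le_mul_of_one_le_right hB hQ1
        have i3 : √(K * N) ≤ √(K * N) * Q := le_mul_of_one_le_right hsq hQ1
        gcongr <;> linarith
      _ = _ := by ring
  have h3 : d / ((u : ℝ) - ℓ) ≤ y * d / N := by
    rw [div_le_div_iff₀ hL0 hN]
    calc d * N = d * (y * γ) * N := by rw [hyγ, mul_one]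
      _ = y * d * (γ * N) := by ring
      _ ≤ _ := by
        gcongr
        linarith
  calc 1000 * (2 * y) ^ 6 * (d / ((u : ℝ) - ℓ)) * (2 * √(K * N) + (4 * B + 256 * y ^ 2 * D ^ 2) +
      (2 * y * K + (4 * B + 256 * y ^ 2 * D ^ 2)))
      ≤ 1000 * (2 * y) ^ 6 * (y * d / N) * (512 * y ^ 2 * ((√(K * N) + K + B + 1) * Q)) := by
        gcongr
    _ ≤ 1000 * (2 * y) ^ 6 * (y * d / N) *
        (512 * y ^ 2 * (gain α γ * γ ^ 9 / 2 ^ 30 * N * D ^ 2)) := by gcongr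
    _ = 32768000 / 2 ^ 30 * (y * γ) ^ 9 * (gain α γ * (d * D ^ 2)) := by field_simp; ring
    _ ≤ _ := by
      rw [hyγ]
      have : 0 ≤ gain α γ * (d * D ^ 2) := by positivity
      norm_num
      linarith

/-- In a segment that contains breaks the split point is close to one of them, and the statistic
there is of the order `N`. -/
theorem NearSegment.splitPoint_near (haa : a + 2 ≤ a') (hlu : ℓ + 4 < u) :
    ∃ m, a < m ∧ m < a' ∧ NearAnchor n b ν B m (splitPoint α x ℓ u hlu) ∧
      γ ^ 3 * c₀ ^ 2 * N / 128 ≤ weightedStat α x ℓ u (splitPoint α x ℓ u hlu) := by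
  obtain ⟨g0, g1⟩ := h.gain_bounds
  have hγ := h.γ_pos
  have hγ1 := h.γ_le
  have hc := h.c_pos
  have hN : (0 : ℝ) < N := by exact_mod_cast h.N_pos
  have hgap := s.gap h
  have hs := h.scale_pos
  have hL0 : 0 < (u : ℝ) - ℓ := by linarith
  have hlong := hcal.long
  have h4 : 2 ≤ γ * N := by nlinarith
  have hsplit : ∀ i, a < i → i < a' → ℓ + 2 ≤ b i ∧ b i + 2 ≤ u := by
    intro i h1 h2
    have h3 := s.break_gap h h1 h2
    have h5 : (ℓ : ℝ) + 2 ≤ b i := by linarith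
    have h6 : (b i : ℝ) + 2 ≤ u := by linarith
    exact ⟨by exact_mod_cast h5, by exact_mod_cast h6⟩
  obtain ⟨M, hM, hmax⟩ := (Finset.Ioo a a').exists_max_image
    (fun i => cusumStat α x ℓ u (b i)) ⟨a + 1, Finset.mem_Ioo.2 ⟨by omega, by omega⟩⟩
  rw [Finset.mem_Ioo] at hM
  have hM0 : 0 ≤ cusumStat α x ℓ u (b M) :=
    cusumStat_nonneg α x (by have := hsplit M hM.1 hM.2; omega)
      (by have := hsplit M hM.1 hM.2; omega)
  obtain ⟨D, hD0, hDV⟩ : ∃ D : ℝ, 0 ≤ D ∧ cusumStat α x ℓ u (b M) = ((u : ℝ) - ℓ) * D ^ 2 := by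
    refine ⟨√(cusumStat α x ℓ u (b M) / ((u : ℝ) - ℓ)), Real.sqrt_nonneg _, ?_⟩
    rw [Real.sq_sqrt (by positivity), mul_div_cancel₀ _ hL0.ne']
  have hV : ∀ i, a < i → i < a' → cusumStat α x ℓ u (b i) ≤ ((u : ℝ) - ℓ) * D ^ 2 := by
    intro i h1 h2
    rw [← hDV]
    exact hmax i (Finset.mem_Ioo.2 ⟨h1, h2⟩)
  have hr := h.rough_le_jump hcal
  have hD := s.le_signal h hD0 haa hV hr
  have hDpos : 0 < D := lt_of_lt_of_le (by positivity) hD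
  have hkb := splitPoint_bounds α x hlu
  have hopt : ∀ i, a < i → i < a' →
      weightedStat α x ℓ u (b i) ≤ weightedStat α x ℓ u (splitPoint α x ℓ u hlu) := fun i h1 h2 =>
    weightedStat_le_splitPoint α x hlu (hsplit i h1 h2).1 (hsplit i h1 h2).2
  have hkN : splitPoint α x ℓ u hlu ≤ N := by have := s.u_le h; omega
  set k := splitPoint α x ℓ u hlu with hk
  clear_value k
  have hwk := weightedStat_eq α x hkb.1 hkb.2
  have hpk := penalty_nonneg α x hkb.1 hkb.2
  have hwM := weightedStat_eq α x (hsplit M hM.1 hM.2).1 (hsplit M hM.1 hM.2).2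
  have hpM := s.penalty_break_le h hcal hD haa hV hM.1 hM.2
  have hoM := hopt M hM.1 hM.2
  have hV0 : 0 < ((u : ℝ) - ℓ) * D ^ 2 := by positivity
  have hgV : 0 < gain α γ * (((u : ℝ) - ℓ) * D ^ 2) := by positivity
  have hlow : γ ^ 3 * c₀ ^ 2 * N / 128 ≤ weightedStat α x ℓ u k := by
    have h5 : γ * N * (γ * c₀ / 8) ^ 2 ≤ ((u : ℝ) - ℓ) * D ^ 2 := by
      gcongr
      linarith
    have h6 : gain α γ * (((u : ℝ) - ℓ) * D ^ 2) ≤ 1 / 2 * (((u : ℝ) - ℓ) * D ^ 2) := by gcongr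
    nlinarith
  rcases s.far_or_near h hDpos hV (h.rough_le_signal hcal hD (by linarith)) (k := k) (by omega)
    (by omega) with hfar | ⟨m, hm1, hm2, hmV, hk1, hk2, hnear⟩
  · -- the best break beats a far value, as its penalty is small
    exfalso
    linarith
  refine ⟨m, hm1, hm2, Or.inr ⟨by omega, by have := s.le; omega, ?_⟩, hlow⟩
  have hd0 := abs_nonneg ((k : ℝ) - b m)
  have hdist : |(k : ℝ) - b m| * D ^ 2 ≤
      K ^ 2 / ((gain α γ * γ / 192) ^ 4 * (γ * c₀ / 8) ^ 2) := by
    -- otherwise the statistic is larger at the break itself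
    by_contra! hcon
    have hX := h.norm_local_le hcal hD (by have := s.le; omega : m ≤ n + 1) hkN hcon.le
    have hS := h.slope_le hcal hD hd0
    have hpm := s.penalty_le_near h hcal hD haa hV hm1 hm2 hk1 hk2
    have hwm := weightedStat_eq α x (hsplit m hm1 hm2).1 (hsplit m hm1 hm2).2
    have hom := hopt m hm1 hm2
    have h5 : 6 * γ⁻¹ * D * (‖psum e k - psum e (b m)‖ +
        γ⁻¹ * (|(k : ℝ) - b m| / N) * √(roughConst K B c₀ * N)) ≤
        gain α γ / 16 * (|(k : ℝ) - b m| * D ^ 2) := by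
      calc _ ≤ 6 * γ⁻¹ * D * (gain α γ * γ / 192 * (|(k : ℝ) - b m| * D) +
            gain α γ * γ / 192 * (|(k : ℝ) - b m| * D)) := by gcongr
        _ = _ := by field_simp; ring
    have h6 : 0 < |(k : ℝ) - b m| * D ^ 2 := lt_of_le_of_lt (by positivity) hcon
    have h7 : 0 < gain α γ * (|(k : ℝ) - b m| * D ^ 2) := by positivity
    linarith
  have hj := s.norm_mean_sub_mean_le' h hD0 haa hV hr (i := m) (j := m - 1) hm1.le hm2 (by omega)
    (by omega)
  have hj' : ‖ν m - ν (m - 1)‖ ≤ 8 * γ⁻¹ * D := by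
    rw [mul_comm 8, mul_assoc, inv_mul_eq_div, le_div_iff₀ hγ]
    linarith
  calc |(k : ℝ) - b m| * ‖ν m - ν (m - 1)‖ ^ 2 ≤ |(k : ℝ) - b m| * (8 * γ⁻¹ * D) ^ 2 := by gcongr
    _ = 64 * γ⁻¹ ^ 2 * (|(k : ℝ) - b m| * D ^ 2) := by ring
    _ ≤ _ := by gcongr
    _ ≤ B := hcal.tol_ge

end Localization

/-! ### Binary segmentation recovers the breaks of a tame sample -/

section Recovery

variable {E : Type*} [NormedAddCommGroup E] [InnerProductSpace ℝ E]
variable {α K B γ c₀ τ : ℝ} {n N : ℕ} {b : ℕ → ℕ} {ν e x : ℕ → E}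

/-- Every segment between near anchors is split near its breaks, and nowhere else. -/
theorem TameSample.energySeg_eq_image (h : TameSample α K B γ c₀ n N b ν e x)
    (hcal : Calibrated α K B γ c₀ N) (hτ : 8 * γ⁻¹ * roughConst K B c₀ ≤ τ)
    (hτ' : τ < γ ^ 3 * c₀ ^ 2 * N / 128) {a a' ℓ u : ℕ} (s : NearSegment n b ν B a a' ℓ u) :
    ∃ f : ℕ → ℕ, (∀ j, a < j → j < a' → NearAnchor n b ν B j (f j)) ∧
      energySeg α τ x ℓ u = (Finset.Ioo a a').image f := by
  obtain ⟨d, hd⟩ : ∃ d, a' - a ≤ d := ⟨_, le_rfl⟩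
  induction d generalizing a a' ℓ u with
  | zero => exact absurd s.lt (by omega)
  | succ d ih =>
    have hlt := s.lt
    have hle := s.le
    have hs := h.scale_pos
    rcases Nat.lt_or_ge (a + 1) a' with haa | haa
    · have hgap := s.gap h
      have hlu : ℓ + 4 < u := by
        have h1 := hcal.long
        have h2 := h.γ_le
        have h3 := h.γ_pos
        have : (ℓ : ℝ) + 4 < u := by nlinarith
        exact_mod_cast this
      obtain ⟨m, hm1, hm2, hm3, hm4⟩ := s.splitPoint_near h hcal haa hlu
      rw [energySeg, dif_pos hlu, if_pos (hτ'.trans_le hm4)]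
      set k := splitPoint α x ℓ u hlu
      obtain ⟨f, hf1, hf2⟩ := ih (s := ⟨hm1, by omega, s.left, hm3⟩) (by omega)
      obtain ⟨f', hf1', hf2'⟩ := ih (s := ⟨hm2, hle, hm3, s.right⟩) (by omega)
      refine ⟨fun j => if j < m then f j else if j = m then k else f' j, ?_, ?_⟩
      · intro j hj1 hj2
        dsimp only
        split_ifs with h1 h2
        · exact hf1 j hj1 h1
        · exact h2 ▸ hm3
        · exact hf1' j (by omega) hj2
      · rw [hf2, hf2']
        ext i
        simp only [Finset.mem_insert, Finset.mem_union, Finset.mem_image, Finset.mem_Ioo]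
        constructor
        · rintro (rfl | ⟨j, hj, rfl⟩ | ⟨j, hj, rfl⟩)
          · exact ⟨m, ⟨hm1, hm2⟩, by simp⟩
          · exact ⟨j, ⟨hj.1, by omega⟩, by simp [hj.2]⟩
          · exact ⟨j, ⟨by omega, hj.2⟩, by rw [if_neg (by omega), if_neg (by omega)]⟩
        · rintro ⟨j, hj, rfl⟩
          split_ifs with h1 h2
          · exact Or.inr (Or.inl ⟨j, ⟨hj.1, h1⟩, rfl⟩)
          · exact Or.inl rfl
          · exact Or.inr (Or.inr ⟨j, ⟨by omega, hj.2⟩, rfl⟩)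
    · obtain rfl : a' = a + 1 := by omega
      refine ⟨id, fun j h1 h2 => by omega, ?_⟩
      rw [energySeg_eq_empty fun k h1 h2 =>
        (h.weightedStat_le_of_null (by omega) s.left s.right h1 h2).trans hτ]
      have : Finset.Ioo a (a + 1) = ∅ := by
        ext i
        simp only [Finset.mem_Ioo, Finset.notMem_empty, iff_false]
        omega
      rw [this, Finset.image_empty]

/-- The estimates near distinct breaks are distinct and ordered, so the output has exactly `n`
elements, each within the tolerance of its break. -/
theorem TameSample.breaksRecovered (h : TameSample α K B γ c₀ n N b ν e x)
    (hcal : Calibrated α K B γ c₀ N) (hτ : 8 * γ⁻¹ * roughConst K B c₀ ≤ τ)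
    (hτ' : τ < γ ^ 3 * c₀ ^ 2 * N / 128) {ρ : ℝ} (hρ : B / c₀ ^ 2 ≤ ρ) :
    BreaksRecovered (estimatedBreaks α τ x N) (fun j : Fin n => b (j + 1)) ρ := by
  have hs := h.scale_pos
  have s : NearSegment n b ν B 0 (n + 1) 0 N :=
    ⟨Nat.succ_pos n, le_rfl, Or.inl h.model.zero.symm, Or.inl h.model.last.symm⟩
  obtain ⟨f, hf1, hf2⟩ := h.energySeg_eq_image hcal hτ hτ' s
  have hmono : ∀ i j, 0 < i → i < j → j < n + 1 → f i < f j := by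
    intro i j h1 h2 h3
    have := h.near_gap_of_lt h2 h3.le (hf1 i h1 (by omega)) (hf1 j (by omega) h3)
    have : (f i : ℝ) < f j := by linarith
    exact_mod_cast this
  have hcard : (estimatedBreaks α τ x N).card = n := by
    rw [estimatedBreaks, hf2, Finset.card_image_of_injOn, Nat.card_Ioo]
    · omega
    · intro i hi j hj hij
      have hi := Finset.mem_Ioo.1 (Finset.mem_coe.1 hi)
      have hj := Finset.mem_Ioo.1 (Finset.mem_coe.1 hj)
      rcases lt_trichotomy i j with h1 | h1 | h1
      · exact absurd hij (hmono i j hi.1 h1 hj.2).ne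
      · exact h1
      · exact absurd hij (hmono j i hj.1 h1 hi.2).ne'
  refine ⟨hcard, fun j => ?_⟩
  have hu := Finset.orderEmbOfFin_unique hcard (f := fun j : Fin n => f (j + 1))
    (fun j => by
      rw [estimatedBreaks, hf2]
      exact Finset.mem_image_of_mem _ (Finset.mem_Ioo.2 ⟨by omega, by omega⟩))
    (fun i j hij => hmono _ _ (by omega) (by have : (i : ℕ) < j := hij; omega) (by omega))
  rw [← congrFun hu j]
  exact ((hf1 _ (by omega) (by omega)).dist_le h.model h.c_pos h.B_nonneg).trans hρ

end Recovery

/-! ### From the observations to the break model -/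

section Observation

/-- The natural number `j` as an element of `{0, …, m}`, truncated at `m`. -/
def clampFin (m j : ℕ) : Fin (m + 1) := ⟨min j m, by omega⟩

theorem clampFin_of_le {m j : ℕ} (h : j ≤ m) : clampFin m j = ⟨j, by omega⟩ :=
  Fin.ext (min_eq_left h)

variable {E : Type*} [NormedAddCommGroup E] [InnerProductSpace ℝ E] {R : ℕ} {θ : Fin (R + 2) → ℝ}

theorem breakTime_mono (hθ : StrictMono θ) (N : ℕ) {i j : Fin (R + 2)} (hij : i ≤ j) :
    breakTime θ N i ≤ breakTime θ N j :=
  Nat.floor_mono (mul_le_mul_of_nonneg_left (hθ.monotone hij) (Nat.cast_nonneg N))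

theorem exists_breakTime_gap (hθ : StrictMono θ) (hθ0 : θ 0 = 0) :
    ∃ γ : ℝ, 0 < γ ∧ γ ≤ 1 / 2 ∧ ∀ᶠ N : ℕ in atTop, ∀ j ≤ R,
      2 * γ * N ≤ (breakTime θ N (clampFin (R + 1) (j + 1)) : ℝ) -
        breakTime θ N (clampFin (R + 1) j) := by
  obtain ⟨m, -, hm⟩ := (Finset.univ : Finset (Fin (R + 1))).exists_min_image
    (fun j => θ j.succ - θ j.castSucc) ⟨0, Finset.mem_univ _⟩
  obtain ⟨δ, hδ⟩ : ∃ δ, δ = θ m.succ - θ m.castSucc := ⟨_, rfl⟩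
  have hδ0 : 0 < δ := by
    rw [hδ, sub_pos]
    exact hθ Fin.castSucc_lt_succ
  refine ⟨min (δ / 4) (1 / 2), by positivity, min_le_right _ _, ?_⟩
  filter_upwards [eventually_ge_atTop ⌈2 / δ⌉₊] with N hN j hj
  have hN' : 2 / δ ≤ N := Nat.ceil_le.1 hN
  rw [div_le_iff₀ hδ0] at hN'
  have h1 := hm ⟨j, by omega⟩ (Finset.mem_univ _)
  rw [clampFin_of_le (by omega), clampFin_of_le (by omega)]
  simp only [Fin.succ_mk, Fin.castSucc_mk] at h1
  rw [← hδ] at h1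
  have h2 : (0 : ℝ) ≤ θ ⟨j, by omega⟩ := by
    rw [← hθ0]
    exact hθ.monotone (Fin.zero_le _)
  have h3 := Nat.floor_le (mul_nonneg (Nat.cast_nonneg N) h2)
  have h4 := Nat.lt_floor_add_one ((N : ℝ) * θ ⟨j + 1, by omega⟩)
  have h5 : (N : ℝ) * δ ≤ N * θ ⟨j + 1, by omega⟩ - N * θ ⟨j, by omega⟩ := by
    rw [← mul_sub]
    gcongr
  have h6 : 2 * min (δ / 4) (1 / 2) * N ≤ 2 * (δ / 4) * N := by
    gcongr
    exact min_le_left _ _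
  unfold breakTime
  linarith

/-- The observations follow the break model with anchors `⌊N θ_j⌋`. -/
theorem breakModel_observation (hθ : StrictMono θ) (hθ0 : θ 0 = 0)
    (hθ1 : θ (Fin.last (R + 1)) = 1) {μ : Fin (R + 1) → E} {c₀ : ℝ}
    (hμ : ∀ j : Fin R, c₀ ≤ ‖μ j.succ - μ j.castSucc‖) (ε : ℤ → E) {N : ℕ} {γ : ℝ}
    (hgap : ∀ j ≤ R, 2 * γ * N ≤ (breakTime θ N (clampFin (R + 1) (j + 1)) : ℝ) -
      breakTime θ N (clampFin (R + 1) j)) :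
    BreakModel R N (fun j => breakTime θ N (clampFin (R + 1) j)) γ c₀
      (fun j => μ (clampFin R j)) (fun i => ε i) (fun i => observation θ μ ε N i) where
  zero := by
    have : clampFin (R + 1) 0 = 0 := rfl
    simp only [this, breakTime, hθ0, mul_zero, Nat.floor_zero]
  last := by
    have : clampFin (R + 1) (R + 1) = Fin.last (R + 1) := clampFin_of_le le_rfl
    simp only [this, breakTime, hθ1, mul_one, Nat.floor_natCast]
  gap := hgap
  jump j hj := by
    have := hμ ⟨j, hj⟩
    simp only [clampFin_of_le hj.le, clampFin_of_le (Nat.succ_le_of_lt hj)]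
    exact this
  obs j hj i h1 h2 := by
    simp only [clampFin_of_le (by omega : j ≤ R + 1)] at h1
    simp only [clampFin_of_le (by omega : j + 1 ≤ R + 1)] at h2
    simp only [clampFin_of_le hj]
    unfold observation
    congr 1
    rw [Finset.sum_eq_single (⟨j, by omega⟩ : Fin (R + 1))]
    · exact if_pos ⟨h1, h2⟩
    · intro j' _ hne
      refine if_neg fun hh => ?_
      rcases lt_or_gt_of_ne hne with h3 | h3
      · have h4 := breakTime_mono hθ N (i := j'.succ) (j := ⟨j, by omega⟩)
          (by rw [Fin.le_def]; exact h3)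
        omega
      · have h4 := breakTime_mono hθ N (i := ⟨j + 1, by omega⟩) (j := j'.castSucc)
          (by rw [Fin.le_def]; exact h3)
        omega
    · intro hh
      exact absurd (Finset.mem_univ _) hh

end Observation

/-! ### Calibration of the noise level and conclusion -/

section Calibration

/-- A noise level `K` whose seventh power is below `N`, the threshold and the precision is admissible
with tolerance `K³`. -/
theorem exists_calibrated {α γ c₀ : ℝ} (hα : 0 < α) (hγ : 0 < γ) (hc : 0 < c₀) :
    ∃ K₀ : ℝ, 1 ≤ K₀ ∧ ∀ (K τ ρ : ℝ) (N : ℕ), K₀ ≤ K → K ^ 7 ≤ N → K ^ 7 ≤ τ → K ^ 7 ≤ ρ →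
      Calibrated α K (K ^ 3) γ c₀ N ∧ 8 * γ⁻¹ * roughConst K (K ^ 3) c₀ ≤ τ ∧
        K ^ 3 / c₀ ^ 2 ≤ ρ ∧ K ^ 3 / c₀ ^ 2 ≤ γ * N / 2 := by
  have hg := gain_pos hα hγ
  obtain ⟨C, hC⟩ : ∃ C, C = 6 + 18 / c₀ ^ 2 := ⟨_, rfl⟩
  have hC0 : 0 < C := by rw [hC]; positivity
  obtain ⟨δ, hδ⟩ : ∃ δ, δ = (gain α γ * γ ^ 3 * c₀) ^ 2 / 5000000 := ⟨_, rfl⟩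
  have hδ0 : 0 < δ := by rw [hδ]; positivity
  obtain ⟨δ', hδ'⟩ : ∃ δ', δ' = gain α γ * γ ^ 9 / 2 ^ 30 := ⟨_, rfl⟩
  have hδ'0 : 0 < δ' := by rw [hδ']; positivity
  obtain ⟨κ, hκ⟩ : ∃ κ, κ = 1 + 64 / (γ * c₀) ^ 2 := ⟨_, rfl⟩
  have hκ0 : 0 < κ := by rw [hκ]; positivity
  obtain ⟨T, hT⟩ : ∃ T, T = 64 * γ⁻¹ ^ 2 / ((gain α γ * γ / 192) ^ 4 * (γ * c₀ / 8) ^ 2) := ⟨_, rfl⟩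
  have hT0 : 0 < T := by rw [hT]; positivity
  refine ⟨1 + C / δ + 4 * κ / δ' + T + 4 / γ ^ 2 + 8 * γ⁻¹ * C + 1 / c₀ ^ 2 + 2 / (γ * c₀ ^ 2), ?_, ?_⟩
  · have : 0 ≤ C / δ + 4 * κ / δ' + T + 4 / γ ^ 2 + 8 * γ⁻¹ * C + 1 / c₀ ^ 2 + 2 / (γ * c₀ ^ 2) := by
      positivity
    linarith
  intro K τ ρ N hK hKN hKτ hKρ
  have p1 : 0 ≤ C / δ := by positivity
  have p2 : 0 ≤ 4 * κ / δ' := by positivity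
  have p3 : 0 ≤ 4 / γ ^ 2 := by positivity
  have p4 : 0 ≤ 8 * γ⁻¹ * C := by positivity
  have p5 : 0 ≤ 1 / c₀ ^ 2 := by positivity
  have p6 : 0 ≤ 2 / (γ * c₀ ^ 2) := by positivity
  have hK1 : 1 ≤ K := by linarith
  have k1 : C / δ ≤ K := by linarith
  have k2 : 4 * κ / δ' ≤ K := by linarith
  have k3 : T ≤ K := by linarith
  have k4 : 4 / γ ^ 2 ≤ K := by linarith
  have k5 : 8 * γ⁻¹ * C ≤ K := by linarith
  have k6 : 1 / c₀ ^ 2 ≤ K := by linarith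
  have k7 : 2 / (γ * c₀ ^ 2) ≤ K := by linarith
  have hK0 : 0 < K := by linarith
  have hN0 : (0 : ℝ) < N := lt_of_lt_of_le (by positivity) hKN
  rw [div_le_iff₀ hδ0] at k1
  rw [div_le_iff₀ hδ'0] at k2
  rw [div_le_iff₀ (by positivity)] at k4
  have hpow : ∀ i ≤ 7, K ^ i ≤ K ^ 7 := fun i hi => pow_le_pow_right₀ hK1 hi
  have hrough : roughConst K (K ^ 3) c₀ ≤ C * K ^ 6 := by
    have e : roughConst K (K ^ 3) c₀ = 6 * K ^ 1 + 6 / c₀ ^ 2 * K ^ 4 + 12 / c₀ ^ 2 * K ^ 6 := by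
      unfold roughConst
      field_simp
    have h1 : K ^ 1 ≤ K ^ 6 := pow_le_pow_right₀ hK1 (by norm_num)
    have h4 : K ^ 4 ≤ K ^ 6 := pow_le_pow_right₀ hK1 (by norm_num)
    rw [e, hC]
    calc 6 * K ^ 1 + 6 / c₀ ^ 2 * K ^ 4 + 12 / c₀ ^ 2 * K ^ 6 ≤
          6 * K ^ 6 + 6 / c₀ ^ 2 * K ^ 6 + 12 / c₀ ^ 2 * K ^ 6 := by gcongr
      _ = _ := by ring
  refine ⟨⟨?_, ?_, ?_, ?_⟩, ?_, ?_, ?_⟩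
  · rw [← hδ]
    calc roughConst K (K ^ 3) c₀ ≤ C * K ^ 6 := hrough
      _ ≤ K * δ * K ^ 6 := by gcongr
      _ = δ * K ^ 7 := by ring
      _ ≤ δ * N := by gcongr
  · rw [← hκ, ← hδ']
    have hs : K * √(K * N) ≤ N := by
      rw [← Real.sqrt_sq hK0.le, ← Real.sqrt_mul (sq_nonneg _)]
      apply Real.sqrt_le_iff.2 ⟨hN0.le, ?_⟩
      rw [Real.sqrt_sq hK0.le]
      calc K ^ 2 * (K * N) = K ^ 3 * N := by ring
        _ ≤ K ^ 7 * N := by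
          gcongr ?_ * _
          exact hpow 3 (by norm_num)
        _ ≤ N * N := by gcongr
        _ = _ := by ring
    have h1 := hpow 1 (by norm_num)
    have h2 := hpow 2 (by norm_num)
    have h4 := hpow 4 (by norm_num)
    have h5 : K * (√(K * N) + K + K ^ 3 + 1) ≤ 4 * N := by
      have e : K * (√(K * N) + K + K ^ 3 + 1) = K * √(K * N) + K ^ 2 + K ^ 4 + K ^ 1 := by ring
      linarith
    have h6 : K * ((√(K * N) + K + K ^ 3 + 1) * κ) ≤ K * (δ' * N) := by
      calc K * ((√(K * N) + K + K ^ 3 + 1) * κ) = K * (√(K * N) + K + K ^ 3 + 1) * κ := by ring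
        _ ≤ 4 * N * κ := by gcongr
        _ = 4 * κ * N := by ring
        _ ≤ K * δ' * N := by gcongr
        _ = _ := by ring
    exact le_of_mul_le_mul_left h6 hK0
  · calc _ = T * K ^ 2 := by rw [hT]; ring
      _ ≤ K * K ^ 2 := by gcongr
      _ = _ := by ring
  · have h1 := hpow 1 (by norm_num)
    calc (4 : ℝ) ≤ K * γ ^ 2 := k4
      _ = γ ^ 2 * K ^ 1 := by ring
      _ ≤ γ ^ 2 * N := by
        gcongr
        exact h1.trans hKN
  · calc 8 * γ⁻¹ * roughConst K (K ^ 3) c₀ ≤ 8 * γ⁻¹ * (C * K ^ 6) := by gcongr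
      _ = 8 * γ⁻¹ * C * K ^ 6 := by ring
      _ ≤ K * K ^ 6 := by gcongr
      _ = K ^ 7 := by ring
      _ ≤ τ := hKτ
  · calc K ^ 3 / c₀ ^ 2 = 1 / c₀ ^ 2 * K ^ 3 := by ring
      _ ≤ K * K ^ 3 := by gcongr
      _ = K ^ 4 := by ring
      _ ≤ ρ := (hpow 4 (by norm_num)).trans hKρ
  · calc K ^ 3 / c₀ ^ 2 = γ / 2 * (2 / (γ * c₀ ^ 2) * K ^ 3) := by field_simp
      _ ≤ γ / 2 * (K * K ^ 3) := by gcongr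
      _ = γ / 2 * K ^ 4 := by ring
      _ ≤ γ / 2 * N := by
        gcongr
        exact (hpow 4 (by norm_num)).trans hKN
      _ = _ := by ring

/-- The condition on the thresholds forces them to infinity, at a slower rate than `N`. -/
theorem tendsto_threshold {p : ℝ} (hp : 0 < p) {τ : ℕ → ℝ} (hτpos : ∀ᶠ N in atTop, 0 < τ N)
    (hτ : Tendsto (fun N : ℕ => Real.log N ^ p / τ N + τ N / N) atTop (𝓝 0)) :
    Tendsto τ atTop atTop ∧ Tendsto (fun N : ℕ => τ N / N) atTop (𝓝 0) := by
  constructor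
  · have h1 : Tendsto (fun N => (τ N)⁻¹) atTop (𝓝[>] 0) := by
      refine tendsto_nhdsWithin_iff.2 ⟨?_, hτpos.mono fun N hN => inv_pos.2 hN⟩
      refine tendsto_of_tendsto_of_tendsto_of_le_of_le' tendsto_const_nhds hτ
        (hτpos.mono fun N hN => (inv_pos.2 hN).le) ?_
      filter_upwards [hτpos, eventually_ge_atTop 3] with N hN hN3
      have h2 : 1 ≤ Real.log N := by
        rw [← Real.log_exp 1]
        refine Real.log_le_log (Real.exp_pos 1) ?_
        have : (3 : ℝ) ≤ N := by exact_mod_cast hN3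
        linarith [Real.exp_one_lt_d9]
      have h3 : 1 ≤ Real.log N ^ p := Real.one_le_rpow h2 hp.le
      have h4 : (τ N)⁻¹ ≤ Real.log N ^ p / τ N := by
        rw [inv_eq_one_div]
        gcongr
      have h5 : 0 ≤ τ N / N := by positivity
      linarith
    have h2 := h1.inv_tendsto_nhdsGT_zero
    refine h2.congr fun N => ?_
    simp
  · refine tendsto_of_tendsto_of_tendsto_of_le_of_le' tendsto_const_nhds hτ
      (hτpos.mono fun N hN => by positivity) ?_
    filter_upwards [hτpos, eventually_ge_atTop 1] with N hN hN1
    have h2 : 0 ≤ Real.log N := Real.log_natCast_nonneg N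
    have : 0 ≤ Real.log N ^ p / τ N := by positivity
    linarith

end Calibration

section Moments

variable {Ω S E : Type*} [MeasurableSpace Ω] [MeasurableSpace S] [NormedAddCommGroup E]
  [InnerProductSpace ℝ E] [CompleteSpace E] {P : Measure Ω} [IsProbabilityMeasure P]
  {g : (ℕ → S) → E} {η : ℤ → Ω → S} {a κ : ℝ}

/-- The fourth moment is the same for all errors. -/
theorem integral_norm_shiftNoise_pow_four (h : ShiftCondition P g η a κ) (ℓ : ℤ) :
    ∫ ω, ‖shiftNoise g η ℓ ω‖ ^ 4 ∂P = ∫ ω, ‖shiftNoise g η 1 ω‖ ^ 4 ∂P := by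
  have e : ∀ ℓ, ∫ ω, ‖shiftNoise g η ℓ ω‖ ^ 4 ∂P =
      (∫⁻ ω, ‖shiftNoise g η ℓ ω‖ₑ ^ (4 : ℝ) ∂P).toReal := by
    intro ℓ
    rw [integral_eq_lintegral_of_nonneg_ae (f := fun ω => ‖shiftNoise g η ℓ ω‖ ^ 4)
      (ae_of_all _ fun ω => pow_nonneg (norm_nonneg _) 4)
      ((memLp_four_shiftNoise h ℓ).1.norm.pow 4)]
    congr 1
    refine lintegral_congr fun ω => ?_
    rw [← ofReal_norm, ENNReal.ofReal_rpow_of_nonneg (norm_nonneg _) (by norm_num)]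
    norm_cast
  rw [e, e, lintegral_enorm_shiftNoise_rpow h]

end Moments

end

theorem theorem4
    {d r : ℕ} (T : Set (EuclideanSpace ℝ (Fin d))) (hT : IsCompact T)
    {Ω S : Type*} [MeasurableSpace Ω] [MeasurableSpace S]
    (P : Measure Ω) [IsProbabilityMeasure P]
    -- the errors
    (g : (ℕ → S) → FunL2 d r T) (η : ℤ → Ω → S) (a κ : ℝ)
    (hshift : ShiftCondition P g η a κ)
    -- the breaks
    (R : ℕ) (θ : Fin (R + 2) → ℝ) (hθ : StrictMono θ)
    (hθ0 : θ 0 = 0) (hθ1 : θ (Fin.last (R + 1)) = 1)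
    (μ : ℕ → Fin (R + 1) → FunL2 d r T) (c₀ : ℝ) (hc₀ : 0 < c₀)
    (hμ : ∀ N, ∀ j : Fin R, c₀ ≤ ‖μ N j.succ - μ N j.castSucc‖)
    -- the observations
    (X : ℕ → ℕ → Ω → FunL2 d r T)
    (hX : ∀ N i ω, X N i ω = observation θ (μ N) (fun ℓ => shiftNoise g η ℓ ω) N i)
    -- the threshold
    (ν : ℝ) (hν : 4 + a < ν)
    (hXν : ∀ N i, 1 ≤ i → i ≤ N → ∫⁻ ω, ‖X N i ω‖ₑ ^ ν ∂P < ∞)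
    (τ : ℕ → ℝ) (hτpos : ∀ᶠ N in atTop, 0 < τ N)
    (hτ : Tendsto (fun N : ℕ => Real.log N ^ (2 / ν) / τ N + τ N / N) atTop (𝓝 0))
    -- the weight and the precision
    (α : ℝ) (hα0 : 0 < α) (hα1 : α < 1)
    (ρ : ℕ → ℝ) (hρ : Tendsto ρ atTop atTop) :
    Tendsto
      (fun N : ℕ => P {ω | BreaksRecovered
        (estimatedBreaks α (τ N) (fun i => X N i ω) N)
        (fun j : Fin R => breakTime θ N j.succ.castSucc) (ρ N)})
      atTop (𝓝 1) := by
  have ha := hshift.a_pos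
  obtain ⟨hτ1, hτ2⟩ := tendsto_threshold (p := 2 / ν) (div_pos two_pos (by linarith)) hτpos hτ
  obtain ⟨γ, hγ0, hγ1, hgap⟩ := exists_breakTime_gap hθ hθ0
  obtain ⟨C, hC0, hC⟩ := exists_integral_sumMax_shiftNoise_le hshift
  obtain ⟨A, hA⟩ := exists_measureReal_not_tameNoise_le (memLp_four_shiftNoise hshift) hC0 hC
    (fun i => (integral_norm_shiftNoise_pow_four hshift i).le) hα0 hα1 (R + 1)
  obtain ⟨K₀, hK₀, hcal⟩ := exists_calibrated hα0 hγ0 hc₀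
  -- the noise level tends to infinity, so slowly that its seventh power is below `N`, `τ` and `ρ`
  obtain ⟨M, hM⟩ : ∃ M : ℕ → ℝ, ∀ N, M N = min (N : ℝ) (min (τ N) (ρ N)) := ⟨_, fun _ => rfl⟩
  have hMtop : Tendsto M atTop atTop := by
    refine tendsto_atTop.2 fun b => ?_
    filter_upwards [tendsto_atTop.1 tendsto_natCast_atTop_atTop b, tendsto_atTop.1 hτ1 b,
      tendsto_atTop.1 hρ b] with N h1 h2 h3
    rw [hM]
    exact le_min h1 (le_min h2 h3)
  have hKtop : Tendsto (fun N => M N ^ (1 / 7 : ℝ)) atTop atTop :=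
    (tendsto_rpow_atTop (by norm_num)).comp hMtop
  have hAK : Tendsto (fun N => 1 - ENNReal.ofReal (A / M N ^ (1 / 7 : ℝ))) atTop (𝓝 1) := by
    have h1 : Tendsto (fun N => ENNReal.ofReal (A / M N ^ (1 / 7 : ℝ))) atTop (𝓝 0) := by
      rw [← ENNReal.ofReal_zero]
      exact (ENNReal.continuous_ofReal.tendsto 0).comp (tendsto_const_nhds.div_atTop hKtop)
    have h2 := ENNReal.Tendsto.sub (tendsto_const_nhds (x := (1 : ℝ≥0∞))) h1
      (Or.inl ENNReal.one_ne_top)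
    rwa [tsub_zero] at h2
  refine tendsto_of_tendsto_of_tendsto_of_le_of_le' hAK tendsto_const_nhds ?_
    (Eventually.of_forall fun N => prob_le_one)
  have hτ3 := hτ2.eventually_lt_const (by positivity : 0 < γ ^ 3 * c₀ ^ 2 / 128)
  filter_upwards [tendsto_atTop.1 hKtop K₀, hgap, hτ3, hMtop.eventually_ge_atTop 0] with
    N hK hgapN hτN hM0
  obtain ⟨K, hKdef⟩ : ∃ K : ℝ, K = M N ^ (1 / 7 : ℝ) := ⟨_, rfl⟩
  have hK7 : K ^ 7 = M N := by
    rw [hKdef, ← Real.rpow_natCast, ← Real.rpow_mul hM0]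
    norm_num
  rw [← hKdef] at hK ⊢
  have hK1 : 1 ≤ K := hK₀.trans hK
  have hKN : K ^ 7 ≤ N := by rw [hK7, hM]; exact min_le_left _ _
  have hKτ : K ^ 7 ≤ τ N := by
    rw [hK7, hM]
    exact (min_le_right _ _).trans (min_le_left _ _)
  have hKρ : K ^ 7 ≤ ρ N := by
    rw [hK7, hM]
    exact (min_le_right _ _).trans (min_le_right _ _)
  obtain ⟨hc1, hc2, hc3, hc4⟩ := hcal K (τ N) (ρ N) N hK hKN hKτ hKρ
  have hN0 : (0 : ℝ) < N := lt_of_lt_of_le (by positivity) hKN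
  have hN : 0 < N := by exact_mod_cast hN0
  have hτ4 : τ N < γ ^ 3 * c₀ ^ 2 * N / 128 := by
    rw [div_lt_iff₀ hN0] at hτN
    linarith
  set b : ℕ → ℕ := fun j => breakTime θ N (clampFin (R + 1) j) with hb
  have hmodel := fun ω => breakModel_observation hθ hθ0 hθ1 (hμ N)
    (fun ℓ => shiftNoise g η ℓ ω) hgapN
  obtain ⟨ω₀⟩ : Nonempty Ω := by
    by_contra hne
    rw [not_nonempty_iff] at hne
    exact one_ne_zero ((measure_univ (μ := P)).symm.trans (by
      rw [Set.univ_eq_empty_iff.2 hne, measure_empty]))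
  have hbad := hA K N b hK1 hN fun j hj => (hmodel ω₀).le_N hγ0.le hj
  -- the event need not be measurable, so its probability is bounded from below by subadditivity
  have hsub : (Set.univ : Set Ω) ⊆ {ω | BreaksRecovered
        (estimatedBreaks α (τ N) (fun i => X N i ω) N)
        (fun j : Fin R => breakTime θ N j.succ.castSucc) (ρ N)} ∪
      {ω | ¬ TameNoise α K N (R + 1) b (fun i => shiftNoise g η i ω)} := by
    intro ω _
    by_cases htame : TameNoise α K N (R + 1) b (fun i => shiftNoise g η i ω)
    · left
      have hsample : TameSample α K (K ^ 3) γ c₀ R N b (fun j => μ N (clampFin R j))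
          (fun i => shiftNoise g η i ω) (fun i => X N i ω) := by
        refine ⟨?_, htame, hα0, hα1, hγ0, hγ1, hc₀, by linarith, by positivity, hN, hc4⟩
        simp only [hX]
        exact hmodel ω
      have hrec := hsample.breaksRecovered hc1 hc2 hτ4 hc3
      have e : (fun j : Fin R => b (j + 1)) = fun j : Fin R => breakTime θ N j.succ.castSucc := by
        funext j
        simp only [hb, clampFin_of_le (by omega : (j : ℕ) + 1 ≤ R + 1)]
        rfl
      rw [e] at hrec
      exact hrec
    · exact Or.inr htame
  have h1 : (1 : ℝ≥0∞) ≤ P {ω | BreaksRecovered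
        (estimatedBreaks α (τ N) (fun i => X N i ω) N)
        (fun j : Fin R => breakTime θ N j.succ.castSucc) (ρ N)} +
      P {ω | ¬ TameNoise α K N (R + 1) b (fun i => shiftNoise g η i ω)} := by
    rw [← measure_univ (μ := P)]
    exact (measure_mono hsub).trans (measure_union_le _ _)
  rw [tsub_le_iff_right]
  refine h1.trans (add_le_add le_rfl ?_)
  rw [← ofReal_measureReal (measure_ne_top _ _)]
  exact ENNReal.ofReal_le_ofReal hbad
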